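/- **Setting.** Let $N\ge 1$, let $\Lambda=(\mathbb Z/N)^4$ be the periodic hypercubic lattice, $\hat s=\hat1+\hat2+\hat3+\hat4$, and let $\tilde\Lambda=\Lambda+\frac12\hat s$ be the dual lattice, with $F:\Lambda\to\tilde\Lambda$, $F(x)=x+\frac12\hat s$. On either lattice, $r$-forms are antisymmetric functions $\alpha_{x,\mu_1\cdots\mu_r}$ on the $r$-cells, $\alpha\cdot\beta$ is their scalar product (sum over sites and over $\mu_1<\dots<\mu_r$), and $$(d\alpha)_{x,\mu_1\cdots\mu_{r}}=\sum_{j=1}^{r}(-1)^{j+1}\bigl[\alpha_{x+\hat\mu_j,\mu_1\cdots\mathring\mu_j\cdots\mu_r}-\alpha_{x,\mu_1\cdots\mathring\mu_j\cdots\mu_r}\bigr],\qquad (\partial\alpha)_{x,\mu_1\cdots\mu_r}=\sum_\nu\bigl[\alpha_{x,\mu_1\cdots\mu_r\nu}-\alpha_{x-\hat\nu,\mu_1\cdots\mu_r\nu}\bigr].$$ For a $p$-form $\alpha$ and a $q$-form $\beta$, the cup product is $$(\alpha\cup\beta)_{x,\mu_1\cdots\mu_{p+q}}=\tfrac1{p!\,q!}\sum_{\sigma\in\mathfrak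 S_{p+q}}\epsilon_\sigma\,\alpha_{x,\mu_{\sigma(1)}\cdots\mu_{\sigma(p)}}\,\beta_{x+\hat\mu_{\sigma(1)}+\cdots+\hat\mu_{\sigma(p)},\,\mu_{\sigma(p+1)}\cdots\mu_{\sigma(p+q)}},$$ and the higher cup product is $$(\alpha\cup_1\beta)_{x,\mu_1\cdots\mu_{p+q-1}}=(-1)^q\sum_a(-1)^a P_{\mu_a}(P_{\mu_a}\iota_{\mu_a}\alpha\cup P_{\mu_a}\iota_{\mu_a}\beta)_{x,\mu_1\cdots\mathring\mu_a\cdots\mu_{p+q-1}}.$$ Here $(\iota_\mu\alpha)_{x,\mu_1\cdots\mu_r}=\alpha_{x,\mu\mu_1\cdots\mu_r}$. The map $P_\mu$ reverses the sign of the coordinates with index $\ge\mu$, and on forms, for $\mu_1<\dots<\mu_r$ and $S'=\{i:\mu_i\ge\mu\}$, it acts by $(P_\mu\alpha)_{x,\mu_1\cdots\mu_r}=(-1)^{|S'|}\alpha_{P_\mu x-\sum_{i\in S'}\hat\mu_i,\,\mu_1\cdots\mu_r}$. Let $P_\partial$ be the orthogonal projection of real $2$-forms onto the image of $\partial$ on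 $3$-forms. For a real $1$-form $A^e$ and an integer $2$-form $n$ put $F^e=dA^e+2\pi n$ and $$Q_0=\tfrac1{8\pi^2}\sum_xF^e\cup F^e,\quad Q=\sum_x\Bigl(\tfrac1{8\pi^2}F^e\cup F^e+\tfrac1{4\pi}F^e\cup_1dn\Bigr),\quad \tilde Q=\sum_x\Bigl(\tfrac1{8\pi^2}F^e\cup F^e-\tfrac1{4\pi}F^e\cup_1dn\Bigr),$$ $$\mathfrak P(n)=\sum_x(n\cup n+n\cup_1dn).$$ For $\beta>0$ and $\theta\in\mathbb R$ let $$Z[\beta,\theta]=\int DA^eDA^m\sum_{n}\exp\Bigl(-\tfrac\beta2F^e\cdot F^e-i\theta Q_0+\tfrac i{2\pi}\partial A^m\cdot F^e\Bigr),$$ where $A^e$ is a $1$-form and $A^m$ a $3$-form with values in $[-\pi,\pi)$, each component is integrated with $\frac{dA}{2\pi}$, and $n$ runs over all integer $2$-forms. For a closed path $\gamma$ of oriented links, let $\dot\gamma_{x,\mu}$ be the number of times that $\gamma$ runs through $(x,\mu)$ minus the number of times that it runs through the reversed link. For $p,q_e,q_m\in\mathbb Z$ set $$\langle W_d^{(q_e,q_m)}(\gamma)\rangle_{\beta,\theta}^p=\frac1{Z[\beta,\theta]}\int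 DA^eDA^m\sum_n e^{-\frac\beta2F^e\cdot F^e-i\theta Q+\frac i{2\pi}\partial A^m\cdot F^e-ip\pi\mathfrak P(n)}\;e^{\,i\sum_x(q_e\dot\gamma A^e-q_m\dot\gamma\cup A^m)},$$ $$\langle\tilde W_d^{(q_e,q_m)}(\gamma)\rangle_{\beta,\theta}^p=\frac1{Z[\beta,\theta]}\int DA^eDA^m\sum_n e^{-\frac\beta2F^e\cdot F^e-i\theta\tilde Q+\frac i{2\pi}\partial A^m\cdot F^e-ip\pi\mathfrak P(n)}\;e^{\,i\sum_x(q_e\dot\gamma A^e+q_mA^m\cup\dot\gamma)}.$$ The same definitions are used on $\tilde\Lambda$; $F(\gamma)$ is the path $\gamma$ moved to $\tilde\Lambda$ by $F$. Finally put $$\tilde\beta=\frac{\beta}{(2\pi\beta)^2+(\theta/2\pi)^2},\qquad\tilde\theta=\frac{-\theta}{(2\pi\beta)^2+(\theta/2\pi)^2}.$$ **Lemma (Poisson summation).** Let $\beta>0$, $\theta\in\mathbb R$, $p,q_e,q_m\in\mathbb Z$, and let $\gamma$ be a closed path in $\Lambda$. The expectation values in (1) and (2) are well defined: all integrals and sums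 converge absolutely and the partition functions do not vanish. Moreover: 1. For every integer $2$-form $l$ on $\Lambda$ with $\epsilon_{\mu\nu\rho\sigma}(dl)_{x+\hat\mu,\nu\rho\sigma}=-\dot\gamma_{x,\mu}$ for all $x,\mu$ (where $\nu<\rho<\sigma$ are the directions other than $\mu$; no sum), with $u=\sum_xP_\partial l\cup_1dP_\partial l$ and $v=\mathfrak P(l)$, $$\langle W_d^{(q_e,q_m)}(\gamma)\rangle_{\beta,\theta}^p=\langle\tilde W_d^{(q_m,-q_e)}(F(\gamma))\rangle_{\tilde\beta,\tilde\theta}^p\;\exp\Bigl(-\tfrac{i}{2}\theta u\,q_m^2-\tfrac{i}{2}\tilde\theta u\,q_e^2-ip\pi v(q_m^2+q_e^2)\Bigr).$$ 2. $\langle W_d^{(q_e,q_m)}(\gamma)\rangle_{\beta,\theta}^p=\langle W_d^{(-q_e,-q_m)}(\gamma)\rangle_{\beta,\theta}^p.$ -/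

import Mathlib

open MeasureTheory

noncomputable section

namespace LatticeMaxwell

/-! ## The periodic hypercubic lattice and its dual -/

/-- The original lattice `Λ` (integer coordinates modulo `N`) or the dual lattice
`Λ̃ = Λ + ŝ/2` (half-odd-integer coordinates modulo `N`). -/
inductive LatticeKind
  | primal
  | dual

/-- A site is labelled by `k : Fin 4 → ZMod N`. On the original lattice its coordinates are `k`,
on the dual lattice they are `k + (1/2, 1/2, 1/2, 1/2)`. -/
abbrev Site (N : ℕ) (_Λ : LatticeKind) : Type := Fin 4 → ZMod N

/-- The map `F : Λ → Λ̃`, `F x = x + ŝ/2`; with the labelling of `Site` it keeps the label. -/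
def dualSite {N : ℕ} (x : Site N .primal) : Site N .dual := x

/-- The set of the directions of an `r`-cell, `μ₁ < ⋯ < μᵣ`. -/
abbrev Dirs (r : ℕ) : Type := {S : Finset (Fin 4) // S.card = r}

/-- An `r`-cell `(x, μ₁ ⋯ μᵣ)` with `μ₁ < ⋯ < μᵣ`. -/
abbrev Cell (N : ℕ) (Λ : LatticeKind) (r : ℕ) : Type := Site N Λ × Dirs r

/-- `R`-valued `r`-forms. An antisymmetric `α_{x, μ₁ ⋯ μᵣ}` is given by its values at ordered
indices `μ₁ < ⋯ < μᵣ`. -/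
abbrev Form (N : ℕ) (Λ : LatticeKind) (r : ℕ) (R : Type) : Type := Cell N Λ r → R

/-- The lattice vector `∑_{μ ∈ S} μ̂`. -/
def dirVec (N : ℕ) (S : Finset (Fin 4)) : Fin 4 → ZMod N := fun i => if i ∈ S then 1 else 0

/-- The sign of the permutation that sorts the increasing enumeration of `I` followed by that of
`J` (for disjoint `I`, `J`): `-1` to the number of inversions. For complementary `I`, `J` it is
the Levi-Civita symbol `ε_{I J}`. -/
def shuffleSign (I J : Finset (Fin 4)) : ℤ :=
  (-1) ^ ((I ×ˢ J).filter (fun q => q.2 < q.1)).card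

section Calculus

variable {N : ℕ} {Λ : LatticeKind} {R : Type} [CommRing R]

/-- The exterior derivative
`(dα)_{x, μ₁⋯μᵣ₊₁} = ∑ⱼ (-1)^{j+1} (α_{x + μ̂ⱼ, μ₁ ⋯ (no μⱼ) ⋯ μᵣ₊₁} - α_{x, μ₁ ⋯ (no μⱼ) ⋯ μᵣ₊₁})`. -/
def latD {r : ℕ} (α : Form N Λ r R) : Form N Λ (r + 1) R := fun c =>
  ∑ μ : Fin 4, ∑ T : Dirs r,
    if μ ∉ T.1 ∧ insert μ T.1 = c.2.1 then
      (shuffleSign {μ} T.1 : R) * (α (c.1 + dirVec N {μ}, T) - α (c.1, T))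
    else 0

/-- The boundary operator
`(∂α)_{x, μ₁⋯μᵣ} = ∑_ν (α_{x, μ₁⋯μᵣ ν} - α_{x - ν̂, μ₁⋯μᵣ ν})`. -/
def latBdry {r : ℕ} (α : Form N Λ (r + 1) R) : Form N Λ r R := fun c =>
  ∑ ν : Fin 4, ∑ T : Dirs (r + 1),
    if ν ∉ c.2.1 ∧ insert ν c.2.1 = T.1 then
      (shuffleSign c.2.1 {ν} : R) * (α (c.1, T) - α (c.1 - dirVec N {ν}, T))
    else 0

/-- The cup product
`(α ∪ β)_{x, K} = ∑_{I ⊔ J = K} ε_{I J} α_{x, I} β_{x + ∑_{i ∈ I} î, J}`, `|I| = p`, `|J| = q`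
(each splitting once, which is what the factor `1/(p! q!)` achieves in the sum over all
permutations). -/
def cup {p q : ℕ} (α : Form N Λ p R) (β : Form N Λ q R) : Form N Λ (p + q) R := fun c =>
  ∑ I : Dirs p, ∑ J : Dirs q,
    if Disjoint I.1 J.1 ∧ I.1 ∪ J.1 = c.2.1 then
      (shuffleSign I.1 J.1 : R) * α (c.1, I) * β (c.1 + dirVec N I.1, J)
    else 0

/-- The interior product `(ι_μ α)_{x, μ₁⋯μᵣ} = α_{x, μ μ₁⋯μᵣ}`. -/
def interior {r : ℕ} (μ : Fin 4) (α : Form N Λ (r + 1) R) : Form N Λ r R := fun c =>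
  ∑ T : Dirs (r + 1),
    if μ ∉ c.2.1 ∧ insert μ c.2.1 = T.1 then (shuffleSign {μ} c.2.1 : R) * α (c.1, T) else 0

/-- The reflection `P_μ` of the coordinates with index `≥ μ`. In terms of labels, `y ↦ -y` reads
`k ↦ -k` on the original lattice and `k ↦ -k - 1` on the dual one (`-(k + 1/2) = (-k - 1) + 1/2`). -/
def reflectSite (μ : Fin 4) (x : Site N Λ) : Site N Λ := fun i =>
  if i < μ then x i else
    match Λ with
    | .primal => -x i
    | .dual => -x i - 1

/-- The parity transformation of forms, `(P_μ α)_{x, S} = (-1)^{|S'|} α_{P_μ x - ∑_{i ∈ S'} î, S}`,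
where `S'` is the set of the `i ∈ S` with `μ ≤ i`. -/
def parity {r : ℕ} (μ : Fin 4) (α : Form N Λ r R) : Form N Λ r R := fun c =>
  (-1) ^ (c.2.1.filter (fun i => μ ≤ i)).card *
    α (reflectSite μ c.1 - dirVec N (c.2.1.filter (fun i => μ ≤ i)), c.2)

/-- The higher cup product of a `P`-form and a `Q`-form (`P = p + 1`, `Q = q + 1`),
`(α ∪₁ β)_{x, μ₁⋯μ_{P+Q-1}}
  = (-1)^Q ∑ₐ (-1)^a (P_{μₐ} (P_{μₐ} ι_{μₐ} α ∪ P_{μₐ} ι_{μₐ} β))_{x, μ₁ ⋯ (no μₐ) ⋯ μ_{P+Q-1}}`. -/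
def cupOne {p q : ℕ} (α : Form N Λ (p + 1) R) (β : Form N Λ (q + 1) R) :
    Form N Λ (p + q + 1) R := fun c =>
  (-1) ^ (q + 1) * ∑ μ : Fin 4, ∑ T : Dirs (p + q),
    if μ ∉ T.1 ∧ insert μ T.1 = c.2.1 then
      (-1) ^ ((T.1.filter (fun i => i < μ)).card + 1) *
        parity μ (cup (parity μ (interior μ α)) (parity μ (interior μ β))) (c.1, T)
    else 0

variable [NeZero N]

/-- The sum over the lattice of a `4`-form. -/
def latSum (ω : Form N Λ 4 R) : R := ∑ c, ω c

/-- The scalar product of `r`-forms. -/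
def dotForm {r : ℕ} (α β : Form N Λ r R) : R := ∑ c, α c * β c

/-- The Pontryagin square `𝔓(n) = ∑ₓ (n ∪ n + n ∪₁ dn)`. -/
def pontryagin (n : Form N Λ 2 R) : R := latSum (cup n n + cupOne n (latD n))

end Calculus

section Gauge

variable {N : ℕ} [NeZero N] {Λ : LatticeKind}

/-- An integer-valued form as a real-valued form. -/
def realForm {r : ℕ} (n : Form N Λ r ℤ) : Form N Λ r ℝ := fun c => (n c : ℝ)

/-- The orthogonal projection `P_∂` of real `2`-forms onto the image of `∂` on `3`-forms (the image
is a linear subspace, so it is its own span). -/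
def projBdry (α : Form N Λ 2 ℝ) : Form N Λ 2 ℝ :=
  ((Submodule.span ℝ (Set.range fun q : Form N Λ 3 ℝ =>
    (WithLp.toLp 2 (latBdry q) : EuclideanSpace ℝ (Cell N Λ 2)))).starProjection
      (WithLp.toLp 2 α)).ofLp

/-- The field strength `F = dA + 2πn`. -/
def fieldStrength (A : Form N Λ 1 ℝ) (n : Form N Λ 2 ℤ) : Form N Λ 2 ℝ :=
  latD A + (2 * Real.pi) • realForm n

/-- `Q₀[F] = (1/8π²) ∑ₓ F ∪ F`. -/
def topChargeZero (A : Form N Λ 1 ℝ) (n : Form N Λ 2 ℤ) : ℝ :=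
  1 / (8 * Real.pi ^ 2) * latSum (cup (fieldStrength A n) (fieldStrength A n))

/-- `Q[F] = ∑ₓ ((1/8π²) F ∪ F + (1/4π) F ∪₁ dn)`. -/
def topCharge (A : Form N Λ 1 ℝ) (n : Form N Λ 2 ℤ) : ℝ :=
  1 / (8 * Real.pi ^ 2) * latSum (cup (fieldStrength A n) (fieldStrength A n)) +
    1 / (4 * Real.pi) * latSum (cupOne (fieldStrength A n) (latD (realForm n)))

/-- `Q̃[F] = ∑ₓ ((1/8π²) F ∪ F - (1/4π) F ∪₁ dn)`. -/
def topChargeDual (A : Form N Λ 1 ℝ) (n : Form N Λ 2 ℤ) : ℝ :=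
  1 / (8 * Real.pi ^ 2) * latSum (cup (fieldStrength A n) (fieldStrength A n)) -
    1 / (4 * Real.pi) * latSum (cupOne (fieldStrength A n) (latD (realForm n)))

/-! ## Contours -/

/-- The oriented link from `base` to `base ± μ̂`, `μ = dir`. -/
structure Link (N : ℕ) (Λ : LatticeKind) where
  base : Site N Λ
  dir : Fin 4
  forward : Bool

/-- The end point of an oriented link. -/
def Link.target {N : ℕ} {Λ : LatticeKind} (e : Link N Λ) : Site N Λ :=
  if e.forward then e.base + dirVec N {e.dir} else e.base - dirVec N {e.dir}

/-- The same link on the dual lattice, moved by `ŝ/2`. -/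
def Link.toDual {N : ℕ} (e : Link N .primal) : Link N .dual where
  base := dualSite e.base
  dir := e.dir
  forward := e.forward

/-- A contour: a closed path of oriented links. -/
structure Contour (N : ℕ) (Λ : LatticeKind) where
  length : ℕ
  link : Fin length → Link N Λ
  closed : ∀ i, (link i).target = (link (finRotate length i)).base

/-- The contour `F(γ)` on the dual lattice. -/
def Contour.toDual {N : ℕ} (γ : Contour N .primal) : Contour N .dual where
  length := γ.length
  link i := (γ.link i).toDual
  closed i := γ.closed i

/-- The tangent `γ̇`: `γ̇_{x,μ}` is the number of times that `γ` runs through `(x, μ)` minus the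
number of times that it runs through `(x + μ̂, -μ)`. -/
def Contour.tangent {N : ℕ} {Λ : LatticeKind} (γ : Contour N Λ) : Form N Λ 1 ℤ := fun c =>
  ∑ i, ((if (γ.link i).forward = true ∧ (γ.link i).base = c.1 ∧ {(γ.link i).dir} = c.2.1
          then 1 else 0) -
        (if (γ.link i).forward = false ∧ (γ.link i).base = c.1 + dirVec N c.2.1 ∧
            {(γ.link i).dir} = c.2.1
          then 1 else 0))

/-- The integer `2`-form `l` satisfies `ε_{μνρσ} (dl)_{x + μ̂, νρσ} = -γ̇_{x, μ}`
(with `ν < ρ < σ` the three directions other than `μ`). -/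
def IsSurfaceForm (γ : Contour N Λ) (l : Form N Λ 2 ℤ) : Prop :=
  ∀ (x : Site N Λ) (I : Dirs 1) (J : Dirs 3), Disjoint I.1 J.1 →
    shuffleSign I.1 J.1 * latD l (x + dirVec N I.1, J) = -γ.tangent (x, I)

/-- `u = ∑ₓ P_∂ l ∪₁ d P_∂ l`. -/
def uNumber (l : Form N Λ 2 ℤ) : ℝ :=
  latSum (cupOne (projBdry (realForm l)) (latD (projBdry (realForm l))))

/-! ## Path integrals -/

/-- The measure `DA = ∏ dA_c / 2π` on `r`-forms with values in `[-π, π)`. -/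
def gaugeMeasure (N : ℕ) [NeZero N] (Λ : LatticeKind) (r : ℕ) : Measure (Form N Λ r ℝ) :=
  Measure.pi fun _ =>
    ENNReal.ofReal (1 / (2 * Real.pi)) • volume.restrict (Set.Ico (-Real.pi) Real.pi)

/-- `∫ DAᵉ DAᵐ ∑_{n} w(Aᵉ, Aᵐ, n)`. -/
def pathIntegral (w : Form N Λ 1 ℝ → Form N Λ 3 ℝ → Form N Λ 2 ℤ → ℂ) : ℂ :=
  ∫ Ae, ∫ Am, ∑' n, w Ae Am n ∂(gaugeMeasure N Λ 3) ∂(gaugeMeasure N Λ 1)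

/-- Absolute convergence of `∫ DAᵉ DAᵐ ∑_{n} w(Aᵉ, Aᵐ, n)`. -/
def PathIntegrable (w : Form N Λ 1 ℝ → Form N Λ 3 ℝ → Form N Λ 2 ℤ → ℂ) : Prop :=
  Integrable (fun q : (Form N Λ 1 ℝ × Form N Λ 3 ℝ) × Form N Λ 2 ℤ => w q.1.1 q.1.2 q.2)
    (((gaugeMeasure N Λ 1).prod (gaugeMeasure N Λ 3)).prod Measure.count)

/-- `exp(-(β/2) F² - iθ Q₀[F] + (i/2π) ∂Aᵐ·F)`. -/
def partitionWeight (β θ : ℝ) (Ae : Form N Λ 1 ℝ) (Am : Form N Λ 3 ℝ) (n : Form N Λ 2 ℤ) : ℂ :=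
  Complex.exp (-(β / 2 * dotForm (fieldStrength Ae n) (fieldStrength Ae n) : ℝ)
    - Complex.I * (θ * topChargeZero Ae n : ℝ)
    + Complex.I * (1 / (2 * Real.pi) * dotForm (latBdry Am) (fieldStrength Ae n) : ℝ))

/-- The partition function `Z[β, θ]`. -/
def partitionFunction (N : ℕ) [NeZero N] (Λ : LatticeKind) (β θ : ℝ) : ℂ :=
  pathIntegral (partitionWeight (N := N) (Λ := Λ) β θ)

/-- The integrand of the expectation value of the dyonic Wilson loop `W_d`,
`exp(-(β/2) F² - iθ Q[F] + (i/2π) ∂Aᵐ·F - ipπ 𝔓(n)) exp(i (q_e γ̇·Aᵉ - q_m ∑ₓ γ̇ ∪ Aᵐ))`. -/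
def dyonicWeight (β θ : ℝ) (p qe qm : ℤ) (γ : Contour N Λ)
    (Ae : Form N Λ 1 ℝ) (Am : Form N Λ 3 ℝ) (n : Form N Λ 2 ℤ) : ℂ :=
  Complex.exp (-(β / 2 * dotForm (fieldStrength Ae n) (fieldStrength Ae n) : ℝ)
    - Complex.I * (θ * topCharge Ae n : ℝ)
    + Complex.I * (1 / (2 * Real.pi) * dotForm (latBdry Am) (fieldStrength Ae n) : ℝ)
    - Complex.I * (p * Real.pi * pontryagin n : ℝ)) *
  Complex.exp (Complex.I * (qe * dotForm (realForm γ.tangent) Ae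
    - qm * latSum (cup (realForm γ.tangent) Am) : ℝ))

/-- The integrand of the expectation value of the dual dyonic Wilson loop `W̃_d`,
`exp(-(β/2) F² - iθ Q̃[F] + (i/2π) ∂Aᵐ·F - ipπ 𝔓(n)) exp(i (q_e γ̇·Aᵉ + q_m ∑ₓ Aᵐ ∪ γ̇))`. -/
def dualDyonicWeight (β θ : ℝ) (p qe qm : ℤ) (γ : Contour N Λ)
    (Ae : Form N Λ 1 ℝ) (Am : Form N Λ 3 ℝ) (n : Form N Λ 2 ℤ) : ℂ :=
  Complex.exp (-(β / 2 * dotForm (fieldStrength Ae n) (fieldStrength Ae n) : ℝ)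
    - Complex.I * (θ * topChargeDual Ae n : ℝ)
    + Complex.I * (1 / (2 * Real.pi) * dotForm (latBdry Am) (fieldStrength Ae n) : ℝ)
    - Complex.I * (p * Real.pi * pontryagin n : ℝ)) *
  Complex.exp (Complex.I * (qe * dotForm (realForm γ.tangent) Ae
    + qm * latSum (cup Am (realForm γ.tangent)) : ℝ))

/-- `⟨W_d^{(q_e, q_m)}(γ)⟩_{β, θ}^p`. -/
def dyonicEV (β θ : ℝ) (p qe qm : ℤ) (γ : Contour N Λ) : ℂ :=
  pathIntegral (dyonicWeight β θ p qe qm γ) / partitionFunction N Λ β θ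

/-- `⟨W̃_d^{(q_e, q_m)}(γ)⟩_{β, θ}^p`. -/
def dualDyonicEV (β θ : ℝ) (p qe qm : ℤ) (γ : Contour N Λ) : ℂ :=
  pathIntegral (dualDyonicWeight β θ p qe qm γ) / partitionFunction N Λ β θ

/-- The expectation value with integrand `w` at the couplings `β`, `θ` makes sense: the integrals
and sums in its numerator and denominator converge absolutely and the denominator is not `0`. -/
def EVDefined (β θ : ℝ) (w : Form N Λ 1 ℝ → Form N Λ 3 ℝ → Form N Λ 2 ℤ → ℂ) : Prop :=
  PathIntegrable w ∧ PathIntegrable (partitionWeight (N := N) (Λ := Λ) β θ) ∧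
    partitionFunction N Λ β θ ≠ 0

end Gauge

/-- `β̃ = β / ((2πβ)² + (θ/2π)²)`. -/
def betaDual (β θ : ℝ) : ℝ :=
  β / ((2 * Real.pi * β) ^ 2 + (θ / (2 * Real.pi)) ^ 2)

/-- `θ̃ = -θ / ((2πβ)² + (θ/2π)²)`. -/
def thetaDual (β θ : ℝ) : ℝ :=
  -θ / ((2 * Real.pi * β) ^ 2 + (θ / (2 * Real.pi)) ^ 2)

end LatticeMaxwell

end

open LatticeMaxwell

/-!
Integrating out the magnetic gauge field restricts the path integral to the integer forms `n` for
which `dn` is the current of the monopole world-line, that is, to `n = q ℓ + k` with `q` the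
magnetic charge, `ℓ` a surface bounded by the loop and `k` closed. The field strength then splits
orthogonally into an exact part, a constant field carrying the six fluxes of `n` through the
coordinate two-tori, and a multiple of the projection `P_∂ ℓ`.

The sum over the exact integer forms `k` unfolds the integral over the gauge field into a Gaussian
integral over all exact fields. The topological charge couples only the constant part (the fluxes in
complementary planes) and the surface. Poisson summation over the three complementary pairs of
fluxes replaces `(β, θ)` by the dual couplings and exchanges the electric and magnetic charges,
while the Gaussian factors of the surface match because `β` and `θ` enter them through a quadratic
form that is invariant under the duality. What is left over is the phase in the theorem. The second
part is the symmetry that changes the sign of both gauge fields and of `n`.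
-/

noncomputable section

namespace LatticeMaxwell

section FinsetSums

variable {ι G : Type*} [DecidableEq ι] [AddCommGroup G]

theorem sum_sum_erase_eq_zero (K : Finset ι) {f : ι → ι → G}
    (hf : ∀ μ ∈ K, ∀ ν ∈ K, μ ≠ ν → f μ ν + f ν μ = 0) : ∑ μ ∈ K, ∑ ν ∈ K.erase μ, f μ ν = 0 := by
  rw [Finset.sum_sigma']
  refine Finset.sum_involution (fun c _ => ⟨c.2, c.1⟩) ?_ ?_ ?_ fun _ _ => rfl
  · rintro ⟨μ, ν⟩ h
    simp only [Finset.mem_sigma, Finset.mem_erase] at h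
    exact hf μ h.1 ν h.2.2 h.2.1.symm
  · rintro ⟨μ, ν⟩ h _ heq
    simp only [Finset.mem_sigma, Finset.mem_erase, Sigma.mk.injEq] at h heq
    exact h.2.1 heq.1
  · rintro ⟨μ, ν⟩ h
    simp only [Finset.mem_sigma, Finset.mem_erase] at h ⊢
    exact ⟨h.2.2, h.2.1.symm, h.1⟩

end FinsetSums

section ShuffleSign

variable {I I' J J' : Finset (Fin 4)}

theorem shuffleSign_mul_self (I J : Finset (Fin 4)) : shuffleSign I J * shuffleSign I J = 1 := by
  rw [shuffleSign, ← mul_pow, neg_one_mul, neg_neg, one_pow]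

theorem shuffleSign_union_left (h : Disjoint I I') (J : Finset (Fin 4)) :
    shuffleSign (I ∪ I') J = shuffleSign I J * shuffleSign I' J := by
  rw [shuffleSign, shuffleSign, shuffleSign, ← pow_add, Finset.union_product, Finset.filter_union,
    Finset.card_union_of_disjoint]
  exact Finset.disjoint_filter_filter (Finset.disjoint_product.2 (.inl h))

theorem shuffleSign_union_right (I : Finset (Fin 4)) (h : Disjoint J J') :
    shuffleSign I (J ∪ J') = shuffleSign I J * shuffleSign I J' := by
  rw [shuffleSign, shuffleSign, shuffleSign, ← pow_add, Finset.product_union, Finset.filter_union,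
    Finset.card_union_of_disjoint]
  exact Finset.disjoint_filter_filter (Finset.disjoint_product.2 (.inr h))

theorem shuffleSign_insert_left {μ : Fin 4} (h : μ ∉ I) (J : Finset (Fin 4)) :
    shuffleSign (insert μ I) J = shuffleSign {μ} J * shuffleSign I J := by
  rw [Finset.insert_eq, shuffleSign_union_left (Finset.disjoint_singleton_left.2 h)]

theorem shuffleSign_insert_right (I : Finset (Fin 4)) {μ : Fin 4} (h : μ ∉ J) :
    shuffleSign I (insert μ J) = shuffleSign I {μ} * shuffleSign I J := by
  rw [Finset.insert_eq, shuffleSign_union_right I (Finset.disjoint_singleton_left.2 h)]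

theorem shuffleSign_comm (h : Disjoint I J) :
    shuffleSign I J = (-1) ^ (I.card * J.card) * shuffleSign J I := by
  revert I J; decide +kernel

theorem shuffleSign_singleton_comm {μ : Fin 4} (h : μ ∉ I) :
    shuffleSign I {μ} = (-1) ^ I.card * shuffleSign {μ} I := by
  rw [shuffleSign_comm (Finset.disjoint_singleton_right.2 h), Finset.card_singleton, mul_one]

theorem shuffleSign_singleton_singleton {μ ν : Fin 4} (h : μ ≠ ν) :
    shuffleSign {μ} {ν} = -shuffleSign {ν} {μ} := by
  rw [shuffleSign_singleton_comm (by simpa using h.symm), Finset.card_singleton, pow_one,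
    neg_one_mul]

end ShuffleSign

section DirVec

variable (N : ℕ) {S T : Finset (Fin 4)}

theorem dirVec_empty : dirVec N ∅ = 0 := by
  funext i
  simp [dirVec]

theorem dirVec_union (h : Disjoint S T) : dirVec N (S ∪ T) = dirVec N S + dirVec N T := by
  funext i
  have hi : i ∈ S → i ∉ T := fun hS => Finset.disjoint_left.1 h hS
  by_cases hS : i ∈ S <;> by_cases hT : i ∈ T <;> simp_all [dirVec]

theorem dirVec_insert {i : Fin 4} (h : i ∉ S) :
    dirVec N (insert i S) = dirVec N {i} + dirVec N S := by
  rw [Finset.insert_eq, dirVec_union N (Finset.disjoint_singleton_left.2 h)]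

end DirVec

section Components

variable {N : ℕ} {Λ : LatticeKind} {R : Type} [CommRing R] {p q r : ℕ}

theorem sum_dirs_eq_sum {f : Finset (Fin 4) → R} (hf : ∀ S, S.card ≠ r → f S = 0) :
    ∑ T : Dirs r, f T.1 = ∑ S, f S := by
  rw [← Finset.sum_filter_of_ne (p := fun S => S.card = r) fun S _ hS => not_imp_comm.1 (hf S) hS]
  exact (Finset.sum_subtype _ (by simp) f).symm

theorem sum_dirs_ite_eq {f : Finset (Fin 4) → R} (hf : ∀ S, S.card ≠ r → f S = 0)
    (S : Finset (Fin 4)) : (∑ T : Dirs r, if T.1 = S then f T.1 else 0) = f S := by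
  rw [sum_dirs_eq_sum (f := fun T => if T = S then f T else 0)
      fun T hT => by rw [hf T hT, ite_self],
    Finset.sum_ite_eq' Finset.univ S f, if_pos (Finset.mem_univ S)]

/-- The component `α_{x,S}` of an `r`-form along an arbitrary set `S` of directions, with the value
`0` for `|S| ≠ r`. It avoids casts between forms whose degrees agree only propositionally. -/
def component (α : Form N Λ r R) (x : Site N Λ) (S : Finset (Fin 4)) : R :=
  if h : S.card = r then α (x, ⟨S, h⟩) else 0

theorem component_coe (α : Form N Λ r R) (x : Site N Λ) (T : Dirs r) :
    component α x T.1 = α (x, T) := dif_pos T.2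

theorem component_of_card_ne (α : Form N Λ r R) (x : Site N Λ) {S : Finset (Fin 4)}
    (h : S.card ≠ r) : component α x S = 0 := dif_neg h

theorem form_ext {α β : Form N Λ r R}
    (h : ∀ x S, S.card = r → component α x S = component β x S) : α = β := by
  funext ⟨x, T⟩
  simpa only [component_coe] using h x T.1 T.2

theorem component_latD (α : Form N Λ r R) (x : Site N Λ) (K : Finset (Fin 4)) :
    component (latD α) x K = ∑ μ ∈ K, (shuffleSign {μ} (K.erase μ) : R) *
      (component α (x + dirVec N {μ}) (K.erase μ) - component α x (K.erase μ)) := by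
  by_cases hK : K.card = r + 1
  · have hcond (μ : Fin 4) (T : Finset (Fin 4)) : μ ∉ T ∧ insert μ T = K ↔ μ ∈ K ∧ T = K.erase μ :=
      ⟨by rintro ⟨h, rfl⟩; simp [h], by rintro ⟨h, rfl⟩; simp [h]⟩
    rw [component, dif_pos hK]
    simp only [latD, ← component_coe α, hcond, ite_and, Finset.sum_ite_irrel, Finset.sum_const_zero]
    rw [← Finset.sum_filter, Finset.filter_univ_mem]
    refine Finset.sum_congr rfl fun μ _ => sum_dirs_ite_eq (f := fun T => (shuffleSign {μ} T : R) *
      (component α (x + dirVec N {μ}) T - component α x T)) (fun T hT => ?_) _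
    simp only [component_of_card_ne _ _ hT, sub_zero, mul_zero]
  · rw [component_of_card_ne _ _ hK]
    refine (Finset.sum_eq_zero fun μ hμ => ?_).symm
    have hr : (K.erase μ).card ≠ r := fun h => hK (by rw [← Finset.card_erase_add_one hμ, h])
    rw [component_of_card_ne _ _ hr, component_of_card_ne _ _ hr, sub_zero, mul_zero]

theorem component_latBdry (α : Form N Λ (r + 1) R) (x : Site N Λ) {S : Finset (Fin 4)}
    (hS : S.card = r) : component (latBdry α) x S = ∑ ν ∈ Sᶜ, (shuffleSign S {ν} : R) *
      (component α x (insert ν S) - component α (x - dirVec N {ν}) (insert ν S)) := by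
  rw [component, dif_pos hS]
  simp only [latBdry, ← component_coe α, ite_and, Finset.sum_ite_irrel, Finset.sum_const_zero]
  rw [← Finset.sum_filter, Finset.compl_eq_univ_sdiff, Finset.filter_notMem_eq_sdiff]
  refine Finset.sum_congr rfl fun ν _ => ?_
  simp only [eq_comm (a := insert ν S)]
  refine sum_dirs_ite_eq (f := fun T => (shuffleSign S {ν} : R) *
    (component α x T - component α (x - dirVec N {ν}) T)) (fun T hT => ?_) _
  simp only [component_of_card_ne _ _ hT, sub_zero, mul_zero]

theorem component_interior (μ : Fin 4) (α : Form N Λ (r + 1) R) (x : Site N Λ)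
    (S : Finset (Fin 4)) : component (interior μ α) x S =
      if μ ∈ S then 0 else (shuffleSign {μ} S : R) * component α x (insert μ S) := by
  by_cases hS : S.card = r
  · rw [component, dif_pos hS]
    simp only [interior, ← component_coe α, ite_and, Finset.sum_ite_irrel, Finset.sum_const_zero,
      ite_not, eq_comm (a := insert μ S)]
    congr 1
    refine sum_dirs_ite_eq (f := fun T => (shuffleSign {μ} S : R) * component α x T)
      (fun T hT => ?_) _
    rw [component_of_card_ne _ _ hT, mul_zero]
  · rw [component_of_card_ne _ _ hS]
    split_ifs with hμ
    · rfl
    · rw [component_of_card_ne _ _ (by rwa [Finset.card_insert_of_notMem hμ, ne_eq, add_left_inj]),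
        mul_zero]

theorem component_cup (α : Form N Λ p R) (β : Form N Λ q R) (x : Site N Λ) (K : Finset (Fin 4)) :
    component (cup α β) x K = ∑ I ∈ K.powerset, (shuffleSign I (K \ I) : R) *
      component α x I * component β (x + dirVec N I) (K \ I) := by
  by_cases hK : K.card = p + q
  · have hcond (I J : Finset (Fin 4)) : Disjoint I J ∧ I ∪ J = K ↔ I ∈ K.powerset ∧ J = K \ I := by
      rw [Finset.mem_powerset]
      exact ⟨by rintro ⟨h, rfl⟩; exact ⟨Finset.subset_union_left, h.sup_sdiff_cancel_left.symm⟩,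
        by rintro ⟨h, rfl⟩; exact ⟨Finset.disjoint_sdiff, Finset.union_sdiff_of_subset h⟩⟩
    rw [component, dif_pos hK]
    simp only [cup, ← component_coe α, ← component_coe β, hcond, ite_and, Finset.sum_ite_irrel,
      Finset.sum_const_zero]
    have hsum (I : Finset (Fin 4)) : (∑ J : Dirs q, if J.1 = K \ I then (shuffleSign I J.1 : R) *
        component α x I * component β (x + dirVec N I) J.1 else 0) = (shuffleSign I (K \ I) : R) *
          component α x I * component β (x + dirVec N I) (K \ I) :=
      sum_dirs_ite_eq (f := fun J => (shuffleSign I J : R) * component α x I *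
        component β (x + dirVec N I) J)
        (fun J hJ => by rw [component_of_card_ne _ _ hJ, mul_zero]) _
    simp only [hsum]
    rw [sum_dirs_eq_sum (f := fun I => if I ∈ K.powerset then (shuffleSign I (K \ I) : R) *
      component α x I * component β (x + dirVec N I) (K \ I) else 0)
      fun I hI => by simp only [component_of_card_ne _ _ hI, mul_zero, zero_mul, ite_self],
      ← Finset.sum_filter, Finset.filter_univ_mem]
  · rw [component_of_card_ne _ _ hK]
    refine (Finset.sum_eq_zero fun I hI => ?_).symm
    by_cases hIp : I.card = p
    · have hJ : (K \ I).card ≠ q := fun h => hK (by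
        rw [← hIp, ← h, add_comm, Finset.card_sdiff_add_card_eq_card (Finset.mem_powerset.1 hI)])
      rw [component_of_card_ne _ _ hJ, mul_zero]
    · rw [component_of_card_ne _ _ hIp, mul_zero, zero_mul]

end Components

section ExteriorCalculus

variable {N : ℕ} {Λ : LatticeKind} {R : Type} [CommRing R] {p q r : ℕ}

theorem latD_latD (α : Form N Λ r R) : latD (latD α) = 0 := by
  refine form_ext fun x K _ => ?_
  simp only [component_latD, Finset.mul_sum, ← Finset.sum_sub_distrib, ← mul_sub]
  rw [show component (0 : Form N Λ (r + 1 + 1) R) x K = 0 by simp [component]]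
  refine sum_sum_erase_eq_zero K fun μ hμ ν hν hμν => ?_
  have hsign : shuffleSign {μ} (K.erase μ) * shuffleSign {ν} ((K.erase μ).erase ν) =
      -(shuffleSign {ν} (K.erase ν) * shuffleSign {μ} ((K.erase μ).erase ν)) := by
    nth_rw 1 [← Finset.insert_erase (Finset.mem_erase.2 ⟨hμν.symm, hν⟩)]
    rw [← Finset.insert_erase (Finset.mem_erase.2 ⟨hμν, hμ⟩), Finset.erase_right_comm (a := ν),
      shuffleSign_insert_right _ (Finset.notMem_erase _ _),
      shuffleSign_insert_right _ (by simp), shuffleSign_singleton_singleton hμν]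
    ring
  replace hsign := congrArg (Int.cast (R := R)) hsign
  push_cast at hsign
  rw [Finset.erase_right_comm (a := ν), add_right_comm x (dirVec N {ν})]
  linear_combination (component α (x + dirVec N {μ} + dirVec N {ν}) ((K.erase μ).erase ν) -
    component α (x + dirVec N {μ}) ((K.erase μ).erase ν) -
    (component α (x + dirVec N {ν}) ((K.erase μ).erase ν) -
    component α x ((K.erase μ).erase ν))) * hsign

theorem latD_interior_add_interior_latD (μ : Fin 4) (α : Form N Λ (r + 1) R) :
    latD (interior μ α) + interior μ (latD α) = fun c => α (c.1 + dirVec N {μ}, c.2) - α c := by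
  refine form_ext fun x S hS => ?_
  trans component α (x + dirVec N {μ}) S - component α x S
  swap
  · simp only [component, hS, dif_pos]
  trans component (latD (interior μ α)) x S + component (interior μ (latD α)) x S
  · simp only [component, hS, dif_pos, Pi.add_apply]
  simp only [component_latD, component_interior]
  by_cases hμ : μ ∈ S
  · rw [Finset.sum_eq_single_of_mem μ hμ fun ν _ hν => by simp [hμ, hν.symm], if_pos hμ]
    have hsign := congrArg (Int.cast (R := R)) (shuffleSign_mul_self {μ} (S.erase μ))
    push_cast at hsign
    simp only [Finset.notMem_erase, if_false, Finset.insert_erase hμ]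
    linear_combination (component α (x + dirVec N {μ}) S - component α x S) * hsign
  rw [if_neg hμ, Finset.sum_insert hμ, Finset.erase_insert hμ, mul_add, Finset.mul_sum,
    add_left_comm, ← Finset.sum_add_distrib, Finset.sum_eq_zero, add_zero]
  · have hsign := congrArg (Int.cast (R := R)) (shuffleSign_mul_self {μ} S)
    push_cast at hsign
    linear_combination (component α (x + dirVec N {μ}) S - component α x S) * hsign
  · intro ν hν
    have hμν : μ ≠ ν := fun h => hμ (h ▸ hν)
    have hsign : shuffleSign {μ} S * shuffleSign {ν} (insert μ (S.erase ν)) =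
        -(shuffleSign {ν} (S.erase ν) * shuffleSign {μ} (S.erase ν)) := by
      nth_rw 1 [← Finset.insert_erase hν]
      rw [shuffleSign_insert_right _ (Finset.notMem_erase _ _),
        shuffleSign_insert_right _ (by simp [hμ]), shuffleSign_singleton_singleton hμν]
      linear_combination -shuffleSign {ν} (S.erase ν) * shuffleSign {μ} (S.erase ν) *
        shuffleSign_mul_self {ν} {μ}
    replace hsign := congrArg (Int.cast (R := R)) hsign
    push_cast at hsign
    rw [if_neg (by simp [hμ]), if_neg (by simp [hμ]), Finset.erase_insert_of_ne hμν]
    linear_combination (component α (x + dirVec N {ν}) (insert μ (S.erase ν)) -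
      component α x (insert μ (S.erase ν))) * hsign

variable [NeZero N]

theorem sum_add_right_eq (Λ : LatticeKind) (v : Fin 4 → ZMod N) (f : Site N Λ → R) :
    ∑ x, f (x + v) = ∑ x, f x :=
  Equiv.sum_comp (Equiv.addRight v) f

theorem latSum_eq_sum_component (ω : Form N Λ 4 R) :
    latSum ω = ∑ x, component ω x Finset.univ := by
  have huniv : ∀ T : Dirs 4, T = ⟨Finset.univ, rfl⟩ := by decide
  rw [latSum, Fintype.sum_prod_type]
  refine Finset.sum_congr rfl fun x _ => ?_
  rw [Fintype.sum_eq_single _ fun T hT => absurd (huniv T) hT]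
  exact (component_coe ω x _).symm

theorem latSum_latD (α : Form N Λ 3 R) : latSum (latD α) = 0 := by
  simp only [latSum_eq_sum_component, component_latD]
  rw [Finset.sum_comm]
  refine Finset.sum_eq_zero fun μ _ => ?_
  rw [← Finset.mul_sum, Finset.sum_sub_distrib,
    sum_add_right_eq Λ _ fun x => component α x (Finset.univ.erase μ), sub_self, mul_zero]

theorem dotForm_latBdry (α : Form N Λ (r + 1) R) (β : Form N Λ r R) :
    dotForm (latBdry α) β = (-1) ^ (r + 1) * dotForm α (latD β) := by
  simp only [dotForm, latBdry, latD, Finset.sum_mul, Finset.mul_sum, Fintype.sum_prod_type]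
  simp only [Finset.sum_comm (s := (Finset.univ : Finset (Site N Λ)))]
  rw [Finset.sum_comm (s := (Finset.univ : Finset (Dirs (r + 1)))), Finset.sum_comm]
  refine Finset.sum_congr rfl fun ν _ => ?_
  rw [Finset.sum_comm]
  refine Finset.sum_congr rfl fun T _ => Finset.sum_congr rfl fun S _ => ?_
  split_ifs with h
  swap
  · simp only [zero_mul, mul_zero, Finset.sum_const_zero]
  have hsign := congrArg (Int.cast (R := R)) (shuffleSign_singleton_comm h.1)
  rw [S.2] at hsign
  push_cast at hsign
  have hshift : ∑ x, α (x - dirVec N {ν}, T) * β (x, S) =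
      ∑ x, α (x, T) * β (x + dirVec N {ν}, S) := by
    simpa only [add_sub_cancel_right] using
      (sum_add_right_eq _ (dirVec N {ν}) fun x => α (x - dirVec N {ν}, T) * β (x, S)).symm
  simp only [hsign, mul_sub, sub_mul, Finset.sum_sub_distrib, mul_assoc, mul_left_comm (α _),
    ← Finset.mul_sum, hshift]
  ring

end ExteriorCalculus

section Star

variable {N : ℕ} {Λ : LatticeKind} {R : Type} [CommRing R] {p q r : ℕ}

/-- The order of the two factors of a cup product, `∑ₓ α ∪ β` or `∑ₓ β ∪ α`. The loop `W_d` goes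
with the first order and `W̃_d` with the second one. -/
inductive CupOrder
  | forward
  | reversed

/-- The opposite order. -/
def CupOrder.swap : CupOrder → CupOrder
  | .forward => .reversed
  | .reversed => .forward

/-- `1` or `-1` according to the order, the sign of the `∪₁`-term in `Q` and `Q̃`. -/
def CupOrder.sign : CupOrder → ℤ
  | .forward => 1
  | .reversed => -1

theorem CupOrder.swap_swap (o : CupOrder) : o.swap.swap = o := by cases o <;> rfl

theorem CupOrder.sign_swap (o : CupOrder) : o.swap.sign = -o.sign := by cases o <;> rfl

/-- The Hodge star adapted to the cup product: `⋆β` represents the functional `α ↦ ∑ₓ α ∪ β`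
or `α ↦ ∑ₓ β ∪ α` with respect to the scalar product. The degree `p` of `⋆β` is meant to be
`4 - q`. -/
def starForm : CupOrder → Form N Λ q R → Form N Λ p R
  | .forward, β, c =>
    (shuffleSign c.2.1 c.2.1ᶜ : R) * component β (c.1 + dirVec N c.2.1) c.2.1ᶜ
  | .reversed, β, c =>
    (shuffleSign c.2.1ᶜ c.2.1 : R) * component β (c.1 - dirVec N c.2.1ᶜ) c.2.1ᶜ

theorem card_compl_ne (h : p + q = 4) {S : Finset (Fin 4)} (hS : S.card ≠ p) : Sᶜ.card ≠ q := by
  have := Finset.card_add_card_compl S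
  simp only [Fintype.card_fin] at this
  lia

theorem component_starForm_forward (h : p + q = 4) (β : Form N Λ q R) (x : Site N Λ)
    (S : Finset (Fin 4)) : component (starForm .forward β : Form N Λ p R) x S =
      (shuffleSign S Sᶜ : R) * component β (x + dirVec N S) Sᶜ := by
  by_cases hS : S.card = p
  · exact dif_pos hS
  · rw [component_of_card_ne _ _ hS, component_of_card_ne _ _ (card_compl_ne h hS), mul_zero]

theorem component_starForm_reversed (h : p + q = 4) (β : Form N Λ q R) (x : Site N Λ)
    (S : Finset (Fin 4)) : component (starForm .reversed β : Form N Λ p R) x S =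
      (shuffleSign Sᶜ S : R) * component β (x - dirVec N Sᶜ) Sᶜ := by
  by_cases hS : S.card = p
  · exact dif_pos hS
  · rw [component_of_card_ne _ _ hS, component_of_card_ne _ _ (card_compl_ne h hS), mul_zero]

theorem starForm_swap_starForm (h : p + q = 4) (o : CupOrder) (β : Form N Λ q R) :
    starForm o.swap (starForm o β : Form N Λ p R) = β := by
  have hqp : q + p = 4 := by rw [add_comm, h]
  have hsign (S T : Finset (Fin 4)) : (shuffleSign S T * shuffleSign S T : R) = 1 := by
    exact_mod_cast congrArg (Int.cast (R := R)) (shuffleSign_mul_self S T)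
  refine form_ext fun x S _ => ?_
  cases o
  · rw [CupOrder.swap, component_starForm_reversed hqp, component_starForm_forward h, compl_compl,
      ← mul_assoc, hsign, one_mul, sub_add_cancel]
  · rw [CupOrder.swap, component_starForm_forward hqp, component_starForm_reversed h, compl_compl,
      ← mul_assoc, hsign, one_mul, add_sub_cancel_right]

theorem latBdry_starForm (h : p + q = 3) (o : CupOrder) (β : Form N Λ q R) :
    latBdry (starForm o β : Form N Λ (p + 1) R) = (o.sign : R) • starForm o (latD β) := by
  refine form_ext fun x S hS => ?_
  trans o.sign * component (starForm o (latD β) : Form N Λ p R) x S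
  swap
  · simp only [component, hS, dif_pos, Pi.smul_apply, smul_eq_mul]
  rw [component_latBdry _ _ hS]
  have hcompl (ν : Fin 4) (hν : ν ∈ Sᶜ) :
      ν ∉ S ∧ ∃ T, ν ∉ T ∧ Sᶜ = insert ν T ∧ (insert ν S)ᶜ = T :=
    ⟨Finset.mem_compl.1 hν, Sᶜ.erase ν, Finset.notMem_erase _ _,
      (Finset.insert_erase hν).symm, Finset.compl_insert⟩
  cases o
  · rw [component_starForm_forward (by lia), component_latD, Finset.mul_sum, Finset.mul_sum]
    refine Finset.sum_congr rfl fun ν hν => ?_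
    obtain ⟨hνS, T, hνT, hST, hT⟩ := hcompl ν hν
    rw [component_starForm_forward (by lia), component_starForm_forward (by lia), hT, hST,
      Finset.erase_insert hνT, shuffleSign_insert_right _ hνT, shuffleSign_insert_left hνS,
      dirVec_insert N hνS, ← add_assoc, ← add_assoc, sub_add_cancel, add_right_comm x]
    simp only [CupOrder.sign]
    push_cast
    ring
  · rw [component_starForm_reversed (by lia), component_latD, Finset.mul_sum, Finset.mul_sum]
    refine Finset.sum_congr rfl fun ν hν => ?_
    obtain ⟨hνS, T, hνT, hST, hT⟩ := hcompl ν hν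
    have hcard : T.card + S.card = 3 := by
      have := Finset.card_add_card_compl S
      simp only [hST, Finset.card_insert_of_notMem hνT, Fintype.card_fin] at this
      lia
    have hpow : (-1 : R) ^ T.card * (-1) ^ S.card = -1 := by
      rw [← pow_add, hcard, Odd.neg_one_pow (by decide)]
    rw [component_starForm_reversed (by lia), component_starForm_reversed (by lia), hT, hST,
      Finset.erase_insert hνT, shuffleSign_insert_right _ hνS, shuffleSign_insert_left hνT,
      dirVec_insert N hνT, ← sub_sub, sub_right_comm x, sub_add_cancel,
      shuffleSign_singleton_comm hνS, shuffleSign_singleton_comm hνT]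
    simp only [CupOrder.sign]
    push_cast
    linear_combination (shuffleSign {ν} S * shuffleSign {ν} T * shuffleSign T S *
      (component β (x - dirVec N T) T - component β (x - dirVec N T - dirVec N {ν}) T) : R) * hpow

variable [NeZero N]

theorem dotForm_comm (α β : Form N Λ r R) : dotForm α β = dotForm β α := dotProduct_comm α β

theorem dotForm_eq_sum_component (α β : Form N Λ r R) :
    dotForm α β = ∑ x, ∑ S, component α x S * component β x S := by
  rw [dotForm, Fintype.sum_prod_type]
  refine Finset.sum_congr rfl fun x _ => ?_
  rw [← sum_dirs_eq_sum (r := r) fun S hS => by rw [component_of_card_ne _ _ hS, zero_mul]]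
  simp only [component_coe]

theorem sum_component_cup (h : p + q = 4) (α : Form N Λ p R) (β : Form N Λ q R) :
    ∑ x, component (cup α β) x Finset.univ = dotForm α (starForm .forward β) := by
  simp only [dotForm_eq_sum_component, component_cup, component_starForm_forward h,
    Finset.powerset_univ, ← Finset.compl_eq_univ_sdiff, mul_assoc, mul_left_comm]

theorem dotForm_starForm_forward (h : p + q = 4) (α : Form N Λ p R) (β : Form N Λ q R) :
    dotForm α (starForm .forward β) = dotForm β (starForm .reversed α) := by
  simp only [dotForm_eq_sum_component, component_starForm_forward h,
    component_starForm_reversed (add_comm p q ▸ h : q + p = 4)]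
  rw [Finset.sum_comm, Finset.sum_comm (s := Finset.univ (α := Site N Λ)),
    ← Equiv.sum_comp compl_involutive.toPerm]
  refine Finset.sum_congr rfl fun S _ => ?_
  rw [← sum_add_right_eq Λ (dirVec N Sᶜ) fun x => component β x S * _]
  simp only [Function.Involutive.coe_toPerm, compl_compl, add_sub_cancel_right]
  exact Finset.sum_congr rfl fun x _ => by ring

theorem dotForm_starForm_comm (h : p + q = 4) (o : CupOrder) (α : Form N Λ p R)
    (β : Form N Λ q R) : dotForm α (starForm o β) = dotForm β (starForm o.swap α) := by
  cases o
  · exact dotForm_starForm_forward h α β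
  · exact (dotForm_starForm_forward (add_comm p q ▸ h) β α).symm

theorem dotForm_starForm_starForm (h : p + q = 4) (o : CupOrder) (α β : Form N Λ q R) :
    dotForm (starForm o α : Form N Λ p R) (starForm o β) = dotForm α β := by
  rw [dotForm_starForm_comm h, starForm_swap_starForm h, dotForm_comm]

end Star

section Linearity

variable {N : ℕ} {Λ : LatticeKind} {R : Type} [CommRing R] {p q r : ℕ}

theorem component_add (α β : Form N Λ r R) (x : Site N Λ) (S : Finset (Fin 4)) :
    component (α + β) x S = component α x S + component β x S := by
  unfold component
  split_ifs <;> simp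

theorem component_smul (a : R) (α : Form N Λ r R) (x : Site N Λ) (S : Finset (Fin 4)) :
    component (a • α) x S = a * component α x S := by
  unfold component
  split_ifs <;> simp

/-- The exterior derivative as a linear map. -/
def latDₗ : Form N Λ r R →ₗ[R] Form N Λ (r + 1) R where
  toFun := latD
  map_add' α β := form_ext fun x S _ => by
    simp only [component_latD, component_add, add_sub_add_comm, mul_add, Finset.sum_add_distrib]
  map_smul' a α := form_ext fun x S _ => by
    simp only [component_latD, component_smul, ← mul_sub, mul_left_comm _ a, ← Finset.mul_sum,
      RingHom.id_apply]

/-- The boundary operator as a linear map. -/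
def latBdryₗ : Form N Λ (r + 1) R →ₗ[R] Form N Λ r R where
  toFun := latBdry
  map_add' α β := form_ext fun x S hS => by
    simp only [component_latBdry _ _ hS, component_add, add_sub_add_comm, mul_add,
      Finset.sum_add_distrib]
  map_smul' a α := form_ext fun x S hS => by
    simp only [component_latBdry _ _ hS, component_smul, ← mul_sub, mul_left_comm _ a,
      ← Finset.mul_sum, RingHom.id_apply]

/-- The interior product as a linear map. -/
def interiorₗ (μ : Fin 4) : Form N Λ (r + 1) R →ₗ[R] Form N Λ r R where
  toFun := interior μ
  map_add' α β := form_ext fun x S _ => by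
    simp only [component_interior, component_add, mul_add, ite_add_ite, add_zero]
  map_smul' a α := form_ext fun x S _ => by
    simp only [component_interior, component_smul, mul_left_comm _ a, mul_ite, mul_zero,
      RingHom.id_apply]

/-- The parity transformation as a linear map. -/
def parityₗ (μ : Fin 4) : Form N Λ r R →ₗ[R] Form N Λ r R where
  toFun := parity μ
  map_add' _ _ := funext fun _ => mul_add _ _ _
  map_smul' _ _ := funext fun _ => mul_left_comm _ _ _

theorem latDₗ_apply (α : Form N Λ r R) : latDₗ α = latD α := rfl

theorem latBdryₗ_apply (α : Form N Λ (r + 1) R) : latBdryₗ α = latBdry α := rfl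

/-- The map that adjoins the direction `μ` to the cells of a form, with the sign it carries in the
definition of `∪₁`. -/
def adjoinDirₗ (μ : Fin 4) : Form N Λ r R →ₗ[R] Form N Λ (r + 1) R where
  toFun ω c := ∑ T : Dirs r, if μ ∉ T.1 ∧ insert μ T.1 = c.2.1 then
    (-1) ^ ((T.1.filter (fun i => i < μ)).card + 1) * ω (c.1, T) else 0
  map_add' α β := funext fun c => by
    simp only [Pi.add_apply, mul_add, ← Finset.sum_add_distrib, ite_add_ite, add_zero]
  map_smul' a α := funext fun c => by
    simp only [Pi.smul_apply, smul_eq_mul, mul_left_comm _ a, Finset.mul_sum, mul_ite, mul_zero,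
      RingHom.id_apply]

/-- The cup product as a bilinear map. -/
def cupₗ : Form N Λ p R →ₗ[R] Form N Λ q R →ₗ[R] Form N Λ (p + q) R :=
  LinearMap.mk₂ R cup
    (fun α α' β => form_ext fun x S _ => by
      simp only [component_cup, component_add, mul_add, add_mul, Finset.sum_add_distrib])
    (fun a α β => form_ext fun x S _ => by
      simp only [component_cup, component_smul, mul_left_comm _ a, mul_assoc, Finset.mul_sum])
    (fun α β β' => form_ext fun x S _ => by
      simp only [component_cup, component_add, mul_add, Finset.sum_add_distrib])
    (fun a α β => form_ext fun x S _ => by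
      simp only [component_cup, component_smul, mul_left_comm _ a, Finset.mul_sum])

theorem cupₗ_apply (α : Form N Λ p R) (β : Form N Λ q R) : cupₗ α β = cup α β := rfl

/-- The higher cup product as a bilinear map. -/
def cupOneₗ : Form N Λ (p + 1) R →ₗ[R] Form N Λ (q + 1) R →ₗ[R] Form N Λ (p + q + 1) R :=
  ((-1 : R) ^ (q + 1)) • ∑ μ,
    (cupₗ.compl₁₂ (parityₗ μ ∘ₗ interiorₗ μ) (parityₗ μ ∘ₗ interiorₗ μ)).compr₂
      (adjoinDirₗ μ ∘ₗ parityₗ μ)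

theorem cupOneₗ_apply (α : Form N Λ (p + 1) R) (β : Form N Λ (q + 1) R) :
    cupOneₗ α β = cupOne α β := by
  funext c
  simp only [cupOneₗ, LinearMap.smul_apply, LinearMap.sum_apply, Pi.smul_apply, Finset.sum_apply,
    smul_eq_mul]
  rfl

/-- The Hodge star as a linear map. -/
def starFormₗ (o : CupOrder) : Form N Λ q R →ₗ[R] Form N Λ p R where
  toFun := starForm o
  map_add' α β := by
    cases o <;> exact funext fun c => by simp only [starForm, component_add, mul_add, Pi.add_apply]
  map_smul' a α := by
    cases o <;> exact funext fun c => by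
      simp only [starForm, component_smul, mul_left_comm _ a, Pi.smul_apply, smul_eq_mul,
        RingHom.id_apply]

theorem starFormₗ_apply (o : CupOrder) (β : Form N Λ q R) :
    (starFormₗ o β : Form N Λ p R) = starForm o β := rfl

variable [NeZero N]

/-- The lattice sum as a linear map. -/
def latSumₗ : Form N Λ 4 R →ₗ[R] R where
  toFun := latSum
  map_add' _ _ := Finset.sum_add_distrib
  map_smul' _ _ := (Finset.mul_sum _ _ _).symm

theorem latSumₗ_apply (ω : Form N Λ 4 R) : latSumₗ ω = latSum ω := rfl

/-- The scalar product as a bilinear map. -/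
def dotFormₗ : Form N Λ r R →ₗ[R] Form N Λ r R →ₗ[R] R :=
  LinearMap.mk₂ R dotForm add_dotProduct smul_dotProduct dotProduct_add
    fun a α β => dotProduct_smul a α β

theorem dotFormₗ_apply (α β : Form N Λ r R) : dotFormₗ α β = dotForm α β := rfl

end Linearity

section CellEnumeration

/-- The set of directions `{i}`. -/
abbrev dir1 (i : Fin 4) : Dirs 1 := ⟨{i}, Finset.card_singleton i⟩

/-- The set of directions `{i, j}`. -/
abbrev dir2 (i j : Fin 4) (h : i ≠ j := by decide) : Dirs 2 := ⟨{i, j}, Finset.card_pair h⟩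

/-- The set of directions `{i, j, k}`. -/
abbrev dir3 (i j k : Fin 4) (hij : i ≠ j := by decide) (hik : i ≠ k := by decide)
    (hjk : j ≠ k := by decide) : Dirs 3 :=
  ⟨{i, j, k}, Finset.card_eq_three.2 ⟨i, j, k, hij, hik, hjk, rfl⟩⟩

variable {M : Type*} [AddCommMonoid M]

theorem sum_dirs_one (f : Dirs 1 → M) : ∑ T, f T = ∑ i, f (dir1 i) :=
  (Fintype.sum_bijective dir1 (by decide) _ _ fun _ => rfl).symm

theorem sum_dirs_two (f : Dirs 2 → M) :
    ∑ T, f T = f (dir2 0 1) + (f (dir2 0 2) + (f (dir2 0 3) +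
      (f (dir2 1 2) + (f (dir2 1 3) + f (dir2 2 3))))) := by
  have huniv : (Finset.univ : Finset (Dirs 2)) =
      {dir2 0 1, dir2 0 2, dir2 0 3, dir2 1 2, dir2 1 3, dir2 2 3} := by decide
  rw [huniv]
  repeat rw [Finset.sum_insert (by decide)]
  rw [Finset.sum_singleton]

theorem sum_dirs_three (f : Dirs 3 → M) :
    ∑ T, f T = f (dir3 0 1 2) + (f (dir3 0 1 3) + (f (dir3 0 2 3) + f (dir3 1 2 3))) := by
  have huniv : (Finset.univ : Finset (Dirs 3)) =
      {dir3 0 1 2, dir3 0 1 3, dir3 0 2 3, dir3 1 2 3} := by decide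
  rw [huniv]
  repeat rw [Finset.sum_insert (by decide)]
  rw [Finset.sum_singleton]

end CellEnumeration

section HigherCupProduct

variable {N : ℕ} {Λ : LatticeKind} {R : Type} [CommRing R] {p q : ℕ}

theorem reflectSite_reflectSite_sub_add (μ : Fin 4) (x : Site N Λ) (S T : Finset (Fin 4)) :
    reflectSite μ (reflectSite μ x - dirVec N (S.filter (fun i => μ ≤ i)) +
        dirVec N (T.filter (fun i => i < μ)) : Site N Λ) =
      x + dirVec N (S.filter (fun i => μ ≤ i)) + dirVec N (T.filter (fun i => i < μ)) := by
  funext i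
  by_cases hi : i < μ
  · cases Λ <;> simp [reflectSite, dirVec, hi, not_le.2 hi]
  · cases Λ <;> simp [reflectSite, dirVec, hi] <;> ring

theorem dirVec_eq_filter_add_filter (μ : Fin 4) (S : Finset (Fin 4)) :
    dirVec N S = dirVec N (S.filter (fun i => μ ≤ i)) + dirVec N (S.filter (fun i => i < μ)) := by
  rw [← dirVec_union N (Finset.disjoint_filter.2 fun i _ => not_lt.2), ← Finset.filter_or]
  simp only [le_or_gt, Finset.filter_true]

theorem parity_cup_parity (μ : Fin 4) (α : Form N Λ p R) (β : Form N Λ q R)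
    (c : Cell N Λ (p + q)) :
    parity μ (cup (parity μ α) (parity μ β)) c = ∑ I : Dirs p, ∑ J : Dirs q,
      if Disjoint I.1 J.1 ∧ I.1 ∪ J.1 = c.2.1 then
        (shuffleSign I.1 J.1 : R) * α (c.1 + dirVec N (J.1.filter (fun i => μ ≤ i)), I) *
          β (c.1 + dirVec N (I.1.filter (fun i => i < μ)), J)
      else 0 := by
  obtain ⟨x, K, hK⟩ := c
  simp only [parity, cup, Finset.mul_sum]
  refine Finset.sum_congr rfl fun I _ => Finset.sum_congr rfl fun J _ => ?_
  rw [mul_ite, mul_zero]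
  refine if_ctx_congr Iff.rfl (fun h => ?_) fun _ => rfl
  obtain ⟨hIJ, rfl⟩ := h
  have hdisj : Disjoint (I.1.filter (fun i => μ ≤ i)) (J.1.filter (fun i => μ ≤ i)) :=
    Finset.disjoint_filter_filter hIJ
  have hα : reflectSite μ (reflectSite μ x - dirVec N ((I.1 ∪ J.1).filter (fun i => μ ≤ i))) -
      dirVec N (I.1.filter (fun i => μ ≤ i)) =
        (x + dirVec N (J.1.filter (fun i => μ ≤ i)) : Site N Λ) := by
    have h := reflectSite_reflectSite_sub_add μ x (I.1 ∪ J.1) ∅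
    rw [Finset.filter_empty, dirVec_empty, add_zero, add_zero] at h
    rw [h, Finset.filter_union, dirVec_union N hdisj]
    abel
  have hβ : reflectSite μ (reflectSite μ x - dirVec N ((I.1 ∪ J.1).filter (fun i => μ ≤ i)) +
      dirVec N I.1) - dirVec N (J.1.filter (fun i => μ ≤ i)) =
        (x + dirVec N (I.1.filter (fun i => i < μ)) : Site N Λ) := by
    have hcancel (a b c d : Site N Λ) : a - (b + c) + (b + d) = a - c + d := by abel
    have h := reflectSite_reflectSite_sub_add μ x J.1 I.1
    rw [Finset.filter_union, dirVec_union N hdisj, dirVec_eq_filter_add_filter μ I.1,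
      hcancel, h]
    abel
  have hsq (n : ℕ) : ((-1 : R) ^ n) ^ 2 = 1 := by
    rw [← pow_mul, mul_comm, pow_mul, neg_one_sq, one_pow]
  rw [hα, hβ, Finset.filter_union, Finset.card_union_of_disjoint hdisj, pow_add]
  linear_combination (shuffleSign I.1 J.1 : R) * α (x + dirVec N (J.1.filter (fun i => μ ≤ i)), I) *
    β (x + dirVec N (I.1.filter (fun i => i < μ)), J) *
      (((-1) ^ (J.1.filter (fun i => μ ≤ i)).card) ^ 2 *
        hsq (I.1.filter (fun i => μ ≤ i)).card + hsq (J.1.filter (fun i => μ ≤ i)).card)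

theorem cupOne_apply (α : Form N Λ (p + 1) R) (β : Form N Λ (q + 1) R)
    (c : Cell N Λ (p + q + 1)) :
    cupOne α β c = (-1) ^ (q + 1) * ∑ μ : Fin 4, ∑ T : Dirs (p + q),
      if μ ∉ T.1 ∧ insert μ T.1 = c.2.1 then
        (-1) ^ ((T.1.filter (fun i => i < μ)).card + 1) *
          ∑ I : Dirs p, ∑ J : Dirs q,
            if Disjoint I.1 J.1 ∧ I.1 ∪ J.1 = T.1 then
              (shuffleSign I.1 J.1 : R) *
                interior μ α (c.1 + dirVec N (J.1.filter (fun i => μ ≤ i)), I) *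
                interior μ β (c.1 + dirVec N (I.1.filter (fun i => i < μ)), J)
            else 0
      else 0 := by
  simp only [cupOne, parity_cup_parity]

set_option maxHeartbeats 2000000 in
-- The identity is expanded into its several hundred terms.
theorem cupOne_latD (α β : Form N Λ 2 R) : cupOne α (latD β) =
    (cup α β - cup β α - cupOne (latD α) β + latD (cupOne α β) : Form N Λ 4 R) := by
  funext ⟨x, K⟩
  obtain rfl : K = ⟨{0, 1, 2, 3}, rfl⟩ := by revert K; decide
  simp only [Pi.add_apply, Pi.sub_apply]
  simp (decide := true) only [cup, cupOne_apply, latD, interior, sum_dirs_one, sum_dirs_two,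
    sum_dirs_three, if_true, if_false, Fin.sum_univ_four, Finset.filter_singleton,
    Finset.filter_insert]
  simp (decide := true) [shuffleSign, dirVec_empty, dirVec_insert, add_assoc (G := Site N Λ),
    add_comm (G := Site N Λ)]
  ring

theorem latSum_cupOne_latD [NeZero N] {α : Form N Λ 2 R} (hα : latD α = 0) (β : Form N Λ 2 R) :
    latSum (cupOne α (latD β)) = latSum (cup α β) - latSum (cup β α) := by
  have hzero : cupOne (latD α) β = 0 := by
    rw [hα, ← cupOneₗ_apply, map_zero, LinearMap.zero_apply]
  rw [cupOne_latD, hzero, sub_zero]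
  have := map_add (latSumₗ (N := N) (Λ := Λ) (R := R)) (cup α β - cup β α) (latD (cupOne α β))
  exact this.trans (by
    rw [map_sub]
    exact add_eq_left.2 (latSum_latD _))

end HigherCupProduct

section RealForm

variable {N : ℕ} {Λ : LatticeKind} {p q r : ℕ}

theorem realForm_latD (α : Form N Λ r ℤ) : realForm (latD α) = latD (realForm α) := by
  funext c
  simp [latD, realForm, apply_ite (Int.cast : ℤ → ℝ)]

theorem latD_realForm_eq_zero {α : Form N Λ r ℤ} (hα : latD α = 0) : latD (realForm α) = 0 := by
  rw [← realForm_latD, hα]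
  exact funext fun _ => Int.cast_zero

theorem realForm_cup (α : Form N Λ p ℤ) (β : Form N Λ q ℤ) :
    realForm (cup α β) = cup (realForm α) (realForm β) := by
  funext c
  simp [cup, realForm, apply_ite (Int.cast : ℤ → ℝ)]

theorem realForm_add (α β : Form N Λ r ℤ) : realForm (α + β) = realForm α + realForm β := by
  funext c
  simp [realForm]

theorem realForm_smul (a : ℤ) (α : Form N Λ r ℤ) : realForm (a • α) = (a : ℝ) • realForm α := by
  funext c
  simp [realForm]

theorem realForm_neg (α : Form N Λ r ℤ) : realForm (-α) = -realForm α := by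
  funext c
  simp [realForm]

theorem realForm_injective :
    Function.Injective (realForm : Form N Λ r ℤ → Form N Λ r ℝ) := fun _ _ h =>
  funext fun c => Int.cast_injective (congrFun h c)

theorem latSum_realForm [NeZero N] (ω : Form N Λ 4 ℤ) : latSum (realForm ω) = latSum ω := by
  simp [latSum, realForm]

end RealForm

section Pairing

variable {N : ℕ} {Λ : LatticeKind} {R : Type} [CommRing R] {p q : ℕ}

theorem starForm_latBdry (h : p + q = 3) (o : CupOrder) (β : Form N Λ (q + 1) R) :
    (starForm o (latBdry β) : Form N Λ (p + 1) R) = (-o.sign : R) • latD (starForm o β) := by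
  have hcancel {r s : ℕ} (hrs : r + s = 4) (η : Form N Λ r R) :
      starForm o (starForm o.swap η : Form N Λ s R) = η := by
    simpa only [CupOrder.swap_swap] using starForm_swap_starForm (by lia) o.swap η
  obtain ⟨η, rfl⟩ : ∃ η : Form N Λ p R, starForm o.swap η = β :=
    ⟨starForm o β, starForm_swap_starForm (by lia) o β⟩
  rw [latBdry_starForm (add_comm p q ▸ h), hcancel (by lia), ← starFormₗ_apply, map_smul,
    starFormₗ_apply, hcancel (by lia), CupOrder.sign_swap, Int.cast_neg]

variable [NeZero N]

theorem dotForm_latD_starForm (h : p + q = 3) (o : CupOrder) (A : Form N Λ p R)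
    (α : Form N Λ q R) : dotForm (latD A) (starForm o α) =
      (-1) ^ (p + 1) * o.sign * dotForm A (starForm o (latD α)) := by
  have hparts : dotForm (latBdry (starForm o α)) A = (-1) ^ (p + 1) * dotForm (starForm o α)
      (latD A) := dotForm_latBdry _ _
  rw [latBdry_starForm h, ← dotFormₗ_apply, LinearMap.map_smul₂, dotFormₗ_apply, smul_eq_mul]
    at hparts
  have hsign : ((-1 : R) ^ (p + 1)) * (-1) ^ (p + 1) = 1 := by rw [← mul_pow]; simp
  rw [dotForm_comm, dotForm_comm A]
  linear_combination -dotForm (starForm o α) (latD A) * hsign - (-1) ^ (p + 1) * hparts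

theorem dotForm_latD_starForm_eq_zero (h : p + q = 3) (o : CupOrder) (A : Form N Λ p R)
    {α : Form N Λ q R} (hα : latD α = 0) : dotForm (latD A) (starForm o α) = 0 := by
  rw [dotForm_latD_starForm h, hα, ← starFormₗ_apply, map_zero, ← dotFormₗ_apply, map_zero,
    mul_zero]

theorem latSum_cup_two (α β : Form N Λ 2 R) :
    latSum (cup α β) = dotForm α (starForm .forward β) :=
  (latSum_eq_sum_component _).trans (sum_component_cup rfl α β)

theorem latSum_cup_one_three (α : Form N Λ 1 R) (β : Form N Λ 3 R) :
    latSum (cup α β) = dotForm α (starForm .forward β) :=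
  (latSum_eq_sum_component _).trans (sum_component_cup rfl α β)

theorem latSum_cup_three_one (α : Form N Λ 3 R) (β : Form N Λ 1 R) :
    latSum (cup α β) = dotForm α (starForm .forward β) :=
  (latSum_eq_sum_component _).trans (sum_component_cup rfl α β)

theorem latSum_cup_add_cupOne (o : CupOrder) {G : Form N Λ 2 R} (hG : latD G = 0)
    (f : Form N Λ 2 R) :
    latSum (cup (G + f) (G + f)) + o.sign * latSum (cupOne (G + f) (latD f)) =
      latSum (cup G G) + latSum (cup f f) + 2 * dotForm G (starForm o f) +
        o.sign * latSum (cupOne f (latD f)) := by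
  have hcup : latSum (cup (G + f) (G + f)) = latSum (cup G G) + latSum (cup G f) +
      latSum (cup f G) + latSum (cup f f) := by
    simp only [← latSumₗ_apply, ← cupₗ_apply, map_add, LinearMap.add_apply]
    ring
  have hcupOne : latSum (cupOne (G + f) (latD f)) =
      latSum (cupOne G (latD f)) + latSum (cupOne f (latD f)) := by
    simp only [← latSumₗ_apply, ← cupOneₗ_apply, map_add, LinearMap.add_apply]
  rw [hcup, hcupOne, latSum_cupOne_latD hG]
  cases o
  · rw [← latSum_cup_two]
    simp only [CupOrder.sign, Int.cast_one]
    ring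
  · rw [dotForm_starForm_comm rfl, CupOrder.swap, ← latSum_cup_two]
    simp only [CupOrder.sign, Int.cast_neg, Int.cast_one]
    ring

end Pairing

section ConstantForms

variable {N : ℕ} {Λ : LatticeKind} {R : Type} [CommRing R] {r : ℕ}

/-- The `r`-form with constant components `h`. -/
def constForm (N : ℕ) (Λ : LatticeKind) (h : Dirs r → R) : Form N Λ r R := fun c => h c.2

/-- The wedge product of two constant `2`-forms, as a multiple of the volume form. -/
def wedge (h k : Dirs 2 → R) : R :=
  (h (dir2 0 1) * k (dir2 2 3) + h (dir2 2 3) * k (dir2 0 1)) -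
    (h (dir2 0 2) * k (dir2 1 3) + h (dir2 1 3) * k (dir2 0 2)) +
    (h (dir2 0 3) * k (dir2 1 2) + h (dir2 1 2) * k (dir2 0 3))

theorem latD_constForm (h : Dirs r → R) : latD (constForm N Λ h) = 0 := by
  funext c
  simp only [latD, constForm, sub_self, mul_zero, ite_self, Finset.sum_const_zero, Pi.zero_apply]

variable [NeZero N]

theorem card_site : (Fintype.card (Site N Λ) : R) = (N : R) ^ 4 := by
  simp [ZMod.card]

theorem dotForm_constForm_constForm (h k : Dirs r → R) :
    dotForm (constForm N Λ h) (constForm N Λ k) = (N : R) ^ 4 * ∑ I, h I * k I := by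
  simp only [dotForm, Fintype.sum_prod_type, constForm, Finset.sum_const, Finset.card_univ,
    nsmul_eq_mul, card_site]

theorem dotForm_constForm_starForm (o : CupOrder) (h k : Dirs 2 → R) :
    dotForm (constForm N Λ h) (starForm o (constForm N Λ k)) = (N : R) ^ 4 * wedge h k := by
  have hstar : (starForm o (constForm N Λ k) : Form N Λ 2 R) = constForm N Λ fun I =>
      (shuffleSign I.1 I.1ᶜ : R) * component (constForm N Λ k) (0 : Site N Λ) I.1ᶜ := by
    cases o
    · rfl
    · have hsign : ∀ I : Dirs 2, shuffleSign I.1ᶜ I.1 = shuffleSign I.1 I.1ᶜ := by decide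
      exact funext fun c => by rw [starForm, hsign]; rfl
  rw [hstar, dotForm_constForm_constForm, sum_dirs_two]
  have hcomponent (I : Finset (Fin 4)) (J : Dirs 2) (hIJ : Iᶜ = J.1) :
      component (constForm N Λ k) (0 : Site N Λ) Iᶜ = k J := by
    rw [hIJ, component_coe, constForm]
  rw [hcomponent _ (dir2 2 3) (by decide), hcomponent _ (dir2 1 3) (by decide),
    hcomponent _ (dir2 1 2) (by decide), hcomponent _ (dir2 0 3) (by decide),
    hcomponent _ (dir2 0 2) (by decide), hcomponent _ (dir2 0 1) (by decide),
    show shuffleSign {0, 1} {0, 1}ᶜ = 1 by decide, show shuffleSign {0, 2} {0, 2}ᶜ = -1 by decide,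
    show shuffleSign {0, 3} {0, 3}ᶜ = 1 by decide, show shuffleSign {1, 2} {1, 2}ᶜ = 1 by decide,
    show shuffleSign {1, 3} {1, 3}ᶜ = -1 by decide, show shuffleSign {2, 3} {2, 3}ᶜ = 1 by decide,
    wedge]
  push_cast
  ring

theorem sum_latD (A : Form N Λ r R) (I : Dirs (r + 1)) : ∑ x, latD A (x, I) = 0 := by
  simp only [← component_coe, component_latD]
  rw [Finset.sum_comm]
  refine Finset.sum_eq_zero fun μ _ => ?_
  rw [← Finset.mul_sum, Finset.sum_sub_distrib,
    sum_add_right_eq Λ _ fun x => component A x (I.1.erase μ), sub_self, mul_zero]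

theorem dotForm_latD_constForm (A : Form N Λ r R) (h : Dirs (r + 1) → R) :
    dotForm (latD A) (constForm N Λ h) = 0 := by
  simp only [dotForm, Fintype.sum_prod_type, constForm]
  rw [Finset.sum_comm]
  refine Finset.sum_eq_zero fun I _ => ?_
  rw [← Finset.sum_mul, sum_latD, zero_mul]

end ConstantForms

section Translation

variable {N : ℕ} {Λ Λ' : LatticeKind} {R : Type} [CommRing R] {p q r : ℕ}

/-- The translate by `v` of a form, as a form on the lattice `Λ'`. -/
def translate (Λ' : LatticeKind) (v : Fin 4 → ZMod N) (α : Form N Λ r R) : Form N Λ' r R :=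
  fun c => α (c.1 + v, c.2)

theorem latD_translate (v : Fin 4 → ZMod N) (α : Form N Λ r R) :
    latD (translate Λ' v α) = translate Λ' v (latD α) := by
  funext c
  simp only [latD, translate, add_right_comm]

theorem latD_translate_eq_zero (v : Fin 4 → ZMod N) {α : Form N Λ r R} (hα : latD α = 0) :
    latD (translate Λ' v α) = 0 := by
  rw [latD_translate, hα]
  rfl

theorem latBdry_translate (v : Fin 4 → ZMod N) (α : Form N Λ (r + 1) R) :
    latBdry (translate Λ' v α) = translate Λ' v (latBdry α) := by
  funext c
  simp only [latBdry, translate, sub_add_eq_add_sub]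

theorem cup_translate (v : Fin 4 → ZMod N) (α : Form N Λ p R) (β : Form N Λ q R) :
    cup (translate Λ' v α) (translate Λ' v β) = translate Λ' v (cup α β) := by
  funext c
  simp only [cup, translate, add_right_comm]

theorem starForm_translate (v : Fin 4 → ZMod N) (o : CupOrder) (β : Form N Λ q R) :
    (starForm o (translate Λ' v β) : Form N Λ' p R) = translate Λ' v (starForm o β) := by
  funext ⟨x, I⟩
  cases o
  · simp only [starForm, translate, component, add_right_comm]
  · simp only [starForm, translate, component, sub_add_eq_add_sub]

theorem interior_translate (μ : Fin 4) (v : Fin 4 → ZMod N) (α : Form N Λ (r + 1) R) :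
    interior μ (translate Λ' v α) = translate Λ' v (interior μ α) := rfl

theorem cupOne_translate (v : Fin 4 → ZMod N) (α : Form N Λ (p + 1) R)
    (β : Form N Λ (q + 1) R) :
    cupOne (translate Λ' v α) (translate Λ' v β) = translate Λ' v (cupOne α β) := by
  funext c
  simp only [cupOne_apply, interior_translate, translate, add_right_comm]

theorem realForm_translate (v : Fin 4 → ZMod N) (α : Form N Λ r ℤ) :
    realForm (translate Λ' v α) = translate Λ' v (realForm α) := rfl

theorem sum_translate [NeZero N] (v : Fin 4 → ZMod N) (α : Form N Λ r R) :
    ∑ c, translate Λ' v α c = ∑ c, α c := by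
  rw [Fintype.sum_prod_type_right, Fintype.sum_prod_type_right]
  exact Finset.sum_congr rfl fun I _ => sum_add_right_eq Λ v fun x => α (x, I)

theorem latSum_translate [NeZero N] (v : Fin 4 → ZMod N) (ω : Form N Λ 4 R) :
    latSum (translate Λ' v ω) = latSum ω := sum_translate v ω

theorem dotForm_translate [NeZero N] (v : Fin 4 → ZMod N) (α β : Form N Λ r R) :
    dotForm (translate Λ' v α) (translate Λ' v β) = dotForm α β :=
  sum_translate v (α * β)

omit [CommRing R] in
theorem translate_add (v w : Fin 4 → ZMod N) (α : Form N Λ r R) :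
    translate Λ (v + w) α = translate Λ v (translate Λ w α) := by
  funext c
  simp only [translate, add_assoc]

theorem translate_dirVec_sub_self (μ : Fin 4) {α : Form N Λ (r + 1) R} (hα : latD α = 0) :
    translate Λ (dirVec N {μ}) α - α = latD (interior μ α) := by
  have hinterior : interior μ (0 : Form N Λ (r + 2) R) = 0 := map_zero (interiorₗ μ)
  have hcartan := latD_interior_add_interior_latD μ α
  rw [hα, hinterior, add_zero] at hcartan
  exact hcartan.symm

/-- The translations that change every closed `r+1`-form by an exact one. -/
def exactTranslations (N : ℕ) (Λ : LatticeKind) (R : Type) [CommRing R] (r : ℕ) :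
    AddSubmonoid (Fin 4 → ZMod N) where
  carrier := {v | ∀ α : Form N Λ (r + 1) R, latD α = 0 →
    translate Λ v α - α ∈ LinearMap.range (latDₗ (N := N) (Λ := Λ) (R := R) (r := r))}
  zero_mem' α _ := by
    have hzero : translate Λ 0 α = α := funext fun c => by simp only [translate, add_zero]
    rw [hzero, sub_self]
    exact zero_mem _
  add_mem' {v w} hv hw α hα := by
    rw [translate_add, ← sub_add_sub_cancel]
    exact add_mem (hv _ (latD_translate_eq_zero w hα)) (hw α hα)

theorem translate_sub_mem_range [NeZero N] (v : Fin 4 → ZMod N) {α : Form N Λ (r + 1) R}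
    (hα : latD α = 0) : translate Λ v α - α ∈ LinearMap.range (latDₗ (r := r)) := by
  suffices v ∈ exactTranslations N Λ R r from this α hα
  have hv : v = ∑ μ, (v μ).val • dirVec N {μ} := by
    funext i
    rw [Finset.sum_apply]
    simp only [Pi.smul_apply, dirVec, Finset.mem_singleton, nsmul_eq_mul, ZMod.natCast_zmod_val,
      mul_ite, mul_one, mul_zero, Finset.sum_ite_eq, Finset.mem_univ, if_true]
  rw [hv]
  exact sum_mem fun μ _ => nsmul_mem
    (fun α hα => ⟨interior μ α, (translate_dirVec_sub_self μ hα).symm⟩) _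

end Translation

section Cohomology

variable {N : ℕ} [NeZero N] {Λ : LatticeKind} {r : ℕ}

/-- The averages over the lattice of the components of a form. -/
def average (α : Form N Λ r ℝ) : Dirs r → ℝ := fun I => (∑ x, α (x, I)) / (N : ℝ) ^ 4

/-- Averaging the translates of a closed form does not change its cohomology class. -/
theorem exists_eq_latD_add_average {α : Form N Λ (r + 1) ℝ} (hα : latD α = 0) :
    ∃ A : Form N Λ r ℝ, α = latD A + constForm N Λ (average α) := by
  have hN : (N : ℝ) ≠ 0 := Nat.cast_ne_zero.2 (NeZero.ne N)
  obtain ⟨A, hA⟩ : ∑ v, (translate Λ v α - α) ∈ LinearMap.range (latDₗ (r := r)) :=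
    sum_mem fun v _ => translate_sub_mem_range v hα
  have htranslates : ∑ v, (translate Λ v α - α) =
      (N : ℝ) ^ 4 • (constForm N Λ (average α) - α) := by
    funext ⟨x, I⟩
    have hshift : ∑ v : Fin 4 → ZMod N, α (x + v, I) = ∑ y, α (y, I) := by
      simpa only [add_comm] using sum_add_right_eq Λ x fun y => α (y, I)
    simp only [Finset.sum_apply, Pi.sub_apply, translate, Finset.sum_sub_distrib, hshift,
      Finset.sum_const, Finset.card_univ, nsmul_eq_mul, card_site (Λ := Λ), Pi.smul_apply,
      smul_eq_mul, constForm, average]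
    field_simp
  refine ⟨-((N : ℝ) ^ 4)⁻¹ • A, ?_⟩
  rw [← latDₗ_apply, map_smul, hA, htranslates, neg_smul, inv_smul_smul₀ (pow_ne_zero 4 hN)]
  abel

/-- The coordinate plane through the origin spanned by the directions in `I`. -/
def plane (N : ℕ) [NeZero N] (I : Finset (Fin 4)) : Finset (Fin 4 → ZMod N) :=
  Fintype.piFinset fun j => if j ∈ I then Finset.univ else {0}

theorem mem_plane {I : Finset (Fin 4)} {s : Fin 4 → ZMod N} :
    s ∈ plane N I ↔ ∀ j, j ∉ I → s j = 0 := by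
  rw [plane, Fintype.mem_piFinset]
  refine forall_congr' fun j => ?_
  by_cases h : j ∈ I <;> simp [h]

theorem card_plane (I : Finset (Fin 4)) : (plane N I).card = N ^ I.card := by
  simp [plane, Fintype.card_piFinset, apply_ite Finset.card, ZMod.card, Finset.prod_ite_mem]

theorem sum_plane_shift {M : Type*} [AddCommMonoid M] {I : Finset (Fin 4)} {i : Fin 4}
    (hi : i ∈ I) (f : (Fin 4 → ZMod N) → M) :
    ∑ s ∈ plane N I, f (s + dirVec N {i}) = ∑ s ∈ plane N I, f s := by
  have hdirVec (j : Fin 4) (hj : j ∉ I) : dirVec N {i} j = 0 :=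
    if_neg fun h => hj (by rwa [Finset.mem_singleton.1 h])
  refine Finset.sum_equiv (Equiv.addRight (dirVec N {i})) (fun s => ?_) fun s _ => rfl
  simp only [mem_plane, Equiv.coe_addRight, Pi.add_apply]
  exact forall₂_congr fun j hj => by rw [hdirVec j hj, add_zero]

variable {R : Type} [CommRing R]

theorem sum_plane_latD (A : Form N Λ r R) (I : Dirs (r + 1)) :
    ∑ s ∈ plane N I.1, latD A (s, I) = 0 := by
  simp only [← component_coe, component_latD]
  rw [Finset.sum_comm]
  refine Finset.sum_eq_zero fun μ hμ => ?_
  rw [← Finset.mul_sum, Finset.sum_sub_distrib,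
    sum_plane_shift hμ fun s => component A s (I.1.erase μ), sub_self, mul_zero]

/-- The periods of a form over the coordinate planes through the origin. -/
def period (n : Form N Λ r R) : Dirs r → R := fun I => ∑ s ∈ plane N I.1, n (s, I)

theorem period_add (n n' : Form N Λ r R) : period (n + n') = period n + period n' :=
  funext fun _ => Finset.sum_add_distrib

theorem sum_plane_eq_period {n : Form N Λ (r + 1) R} (hn : latD n = 0) (x : Site N Λ)
    (I : Dirs (r + 1)) : ∑ s ∈ plane N I.1, n (s + x, I) = period n I := by
  obtain ⟨A, hA⟩ := translate_sub_mem_range x hn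
  have hsum := sum_plane_latD A I
  rw [← latDₗ_apply, hA] at hsum
  simp only [Pi.sub_apply, translate, Finset.sum_sub_distrib] at hsum
  exact sub_eq_zero.1 hsum

theorem card_plane_mul_sum_eq_period {n : Form N Λ (r + 1) R} (hn : latD n = 0)
    (I : Dirs (r + 1)) : (N : R) ^ (r + 1) * ∑ x, n (x, I) = (N : R) ^ 4 * period n I :=
  calc (N : R) ^ (r + 1) * ∑ x, n (x, I)
      = ∑ s ∈ plane N I.1, ∑ x : Site N Λ, n (x + s, I) := by
        simp only [sum_add_right_eq Λ _ fun x => n (x, I), Finset.sum_const, card_plane, I.2,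
          nsmul_eq_mul, Nat.cast_pow]
    _ = ∑ x : Site N Λ, ∑ s ∈ plane N I.1, n (s + x, I) := by
        rw [Finset.sum_comm]
        simp only [add_comm]
    _ = (N : R) ^ 4 * period n I := by
        simp only [sum_plane_eq_period hn, Finset.sum_const, Finset.card_univ, nsmul_eq_mul,
          card_site (Λ := Λ)]

theorem average_realForm {n : Form N Λ (r + 1) ℤ} (hn : latD n = 0) (I : Dirs (r + 1)) :
    average (realForm n) I = period n I / (N : ℝ) ^ (r + 1) := by
  have hN : (N : ℝ) ≠ 0 := Nat.cast_ne_zero.2 (NeZero.ne N)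
  have hsum := congrArg (Int.cast (R := ℝ)) (card_plane_mul_sum_eq_period hn I)
  push_cast at hsum
  rw [average, div_eq_div_iff (pow_ne_zero _ hN) (pow_ne_zero _ hN)]
  simp only [realForm]
  linear_combination hsum

/-- A closed form with the periods `m`: the cells along `I` that carry `m I` are those over the
origin of the plane `I`. -/
def fluxForm (N : ℕ) (Λ : LatticeKind) (m : Dirs r → R) : Form N Λ r R := fun c =>
  if ∀ i ∈ c.2.1, c.1 i = 0 then m c.2 else 0

omit [NeZero N] in
theorem latD_fluxForm (m : Dirs r → R) : latD (fluxForm N Λ m) = 0 := by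
  funext c
  rw [latD, Pi.zero_apply]
  refine Finset.sum_eq_zero fun μ _ => Finset.sum_eq_zero fun T _ => ?_
  split_ifs with hμ
  swap
  · rfl
  have hshift : fluxForm N Λ m (c.1 + dirVec N {μ}, T) = fluxForm N Λ m (c.1, T) := by
    simp only [fluxForm]
    congr 1
    refine propext (forall₂_congr fun i hi => ?_)
    have hiμ : i ≠ μ := fun h => hμ.1 (h ▸ hi)
    simp [dirVec, hiμ]
  rw [hshift, sub_self, mul_zero]

theorem period_fluxForm (m : Dirs r → R) : period (fluxForm N Λ m) = m := by
  funext I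
  rw [period, Finset.sum_eq_single_of_mem 0 (mem_plane.2 fun _ _ => rfl)]
  · exact if_pos fun _ _ => rfl
  · refine fun s hs hs0 => if_neg fun h => hs0 (funext fun i => ?_)
    by_cases hi : i ∈ I.1
    · exact h i hi
    · exact mem_plane.1 hs i hi

end Cohomology

section Torus

/-- The normalized measure `dA / 2π` on `[-π, π)`. -/
def angleMeasure : Measure ℝ :=
  ENNReal.ofReal (1 / (2 * Real.pi)) • volume.restrict (Set.Ico (-Real.pi) Real.pi)

instance : IsProbabilityMeasure angleMeasure := by
  constructor
  rw [angleMeasure, Measure.smul_apply, Measure.restrict_apply_univ, Real.volume_Ico, smul_eq_mul,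
    ← ENNReal.ofReal_mul (by positivity), ENNReal.ofReal_eq_one]
  field_simp
  ring

theorem gaugeMeasure_eq (N : ℕ) [NeZero N] (Λ : LatticeKind) (r : ℕ) :
    gaugeMeasure N Λ r = Measure.pi fun _ => angleMeasure := rfl

instance (N : ℕ) [NeZero N] (Λ : LatticeKind) (r : ℕ) :
    IsProbabilityMeasure (gaugeMeasure N Λ r) := by
  rw [gaugeMeasure_eq]
  infer_instance

theorem angleMeasure_eq_Ioc : angleMeasure =
    ENNReal.ofReal (1 / (2 * Real.pi)) • volume.restrict (Set.Ioc (-Real.pi) Real.pi) := by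
  rw [angleMeasure, restrict_Ico_eq_restrict_Ioc]

theorem measurePreserving_neg_angleMeasure :
    MeasurePreserving (fun a : ℝ => -a) angleMeasure angleMeasure := by
  refine ⟨measurable_neg, ?_⟩
  have hneg := (Measure.measurePreserving_neg (volume : Measure ℝ)).restrict_preimage
    (measurableSet_Ioc (a := -Real.pi) (b := Real.pi))
  have hpreimage : (Neg.neg ⁻¹' Set.Ioc (-Real.pi) Real.pi : Set ℝ) =
      Set.Ico (-Real.pi) Real.pi := by
    ext x
    exact ⟨fun ⟨h, h'⟩ => ⟨neg_le.1 h', neg_lt_neg_iff.1 h⟩,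
      fun ⟨h, h'⟩ => ⟨neg_lt_neg h', neg_le.1 h⟩⟩
  rw [hpreimage] at hneg
  conv_rhs => rw [angleMeasure_eq_Ioc]
  rw [angleMeasure, Measure.map_smul]
  congr 1
  exact hneg.map_eq

instance : Fact (0 < 2 * Real.pi) := ⟨Real.two_pi_pos⟩

/-- Addition of `b` modulo `2π`, with values in `(-π, π]`. -/
def addMod (b x : ℝ) : ℝ :=
  (AddCircle.equivIoc (2 * Real.pi) (-Real.pi) ((x + b : ℝ) : AddCircle (2 * Real.pi)) : ℝ)

theorem exists_addMod_eq (b x : ℝ) : ∃ k : ℤ, addMod b x = x + b + 2 * Real.pi * k := by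
  have hcoe : ((addMod b x : ℝ) : AddCircle (2 * Real.pi)) = ((x + b : ℝ) : AddCircle _) :=
    AddCircle.coe_equivIoc
  rw [← sub_eq_zero, ← AddCircle.coe_sub, AddCircle.coe_eq_zero_iff] at hcoe
  obtain ⟨k, hk⟩ := hcoe
  rw [zsmul_eq_mul] at hk
  exact ⟨k, by linarith⟩

theorem measurePreserving_addMod (b : ℝ) :
    MeasurePreserving (addMod b) angleMeasure angleMeasure := by
  have hcoe : MeasurePreserving
      (Subtype.val : Set.Ioc (-Real.pi) (-Real.pi + 2 * Real.pi) → ℝ)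
      (Measure.comap Subtype.val volume)
      (volume.restrict (Set.Ioc (-Real.pi) (-Real.pi + 2 * Real.pi))) :=
    ⟨measurable_subtype_coe, map_comap_subtype_coe measurableSet_Ioc _⟩
  have hcomp : MeasurePreserving (addMod b) _ _ :=
    (hcoe.comp (AddCircle.measurePreserving_equivIoc (T := 2 * Real.pi) (a := -Real.pi))).comp
      ((measurePreserving_add_right volume (b : AddCircle (2 * Real.pi))).comp
        (AddCircle.measurePreserving_mk (2 * Real.pi) (-Real.pi)))
  rw [show -Real.pi + 2 * Real.pi = Real.pi by ring] at hcomp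
  rw [angleMeasure_eq_Ioc]
  exact ⟨hcomp.measurable, by rw [Measure.map_smul, hcomp.map_eq]⟩

theorem integral_angleMeasure_exp (k : ℤ) :
    ∫ a, Complex.exp (-(Complex.I * (k * a : ℝ))) ∂angleMeasure = if k = 0 then 1 else 0 := by
  split_ifs with hk
  · simp [hk]
  have hIk : (-(Complex.I * k) : ℂ) ≠ 0 := by simp [hk]
  have hexp (a : ℝ) : Complex.exp (-(Complex.I * (k * a : ℝ))) =
      Complex.exp ((-(Complex.I * k) : ℂ) * a) := by
    congr 1
    push_cast
    ring
  have hperiod : Complex.exp (-(Complex.I * k) * (Real.pi : ℝ)) =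
      Complex.exp (-(Complex.I * k) * ((-Real.pi : ℝ) : ℂ)) := by
    rw [Complex.exp_eq_exp_iff_exists_int]
    exact ⟨-k, by push_cast; ring⟩
  simp only [hexp]
  rw [angleMeasure_eq_Ioc, integral_smul_measure,
    ← intervalIntegral.integral_of_le (by linarith [Real.pi_pos]), integral_exp_mul_complex hIk,
    hperiod, sub_self, zero_div, smul_zero]

variable {ι : Type*} [Fintype ι]

theorem lintegral_add_of_periodic {Ψ : (ι → ℝ) → ENNReal} (hΨ : Measurable Ψ)
    (hper : ∀ (A : ι → ℝ) (k : ι → ℤ), Ψ (fun i => A i + 2 * Real.pi * k i) = Ψ A)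
    (B : ι → ℝ) :
    ∫⁻ A, Ψ (A + B) ∂(Measure.pi fun _ => angleMeasure) =
      ∫⁻ A, Ψ A ∂(Measure.pi fun _ => angleMeasure) := by
  rw [← (measurePreserving_pi _ _ fun i => measurePreserving_addMod (B i)).lintegral_comp hΨ]
  refine lintegral_congr fun A => ?_
  choose k hk using fun i => exists_addMod_eq (B i) (A i)
  simp only [hk]
  exact (hper (A + B) k).symm

theorem integral_pi_angleMeasure_exp (k : ι → ℤ) :
    ∫ A : ι → ℝ, Complex.exp (-(Complex.I * (∑ i, k i * A i : ℝ)))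
      ∂(Measure.pi fun _ => angleMeasure) = if k = 0 then 1 else 0 := by
  have hprod (A : ι → ℝ) : Complex.exp (-(Complex.I * (∑ i, k i * A i : ℝ))) =
      ∏ i, Complex.exp (-(Complex.I * (k i * A i : ℝ))) := by
    rw [← Complex.exp_sum, Finset.sum_neg_distrib, ← Finset.mul_sum, Complex.ofReal_sum]
  simp only [hprod]
  rw [integral_fintype_prod_eq_prod (fun i a => Complex.exp (-(Complex.I * (k i * a : ℝ))))]
  simp only [integral_angleMeasure_exp]
  split_ifs with hk
  · simp [hk]
  · obtain ⟨i, hi⟩ := Function.ne_iff.1 hk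
    exact Finset.prod_eq_zero (Finset.mem_univ i) (if_neg hi)

end Torus

section Summation

theorem summable_pi_prod {ι X : Type*} [Fintype ι] {f : X → ℝ} (hf0 : ∀ x, 0 ≤ f x)
    (hf : Summable f) : Summable fun n : ι → X => ∏ i, f (n i) := by
  classical
  refine summable_of_sum_le (c := ∏ _i : ι, ∑' x, f x)
    (fun n => Finset.prod_nonneg fun i _ => hf0 _) fun s => ?_
  calc ∑ n ∈ s, ∏ i, f (n i)
      ≤ ∑ n ∈ Fintype.piFinset fun i => s.image fun n => n i, ∏ i, f (n i) := by
        refine Finset.sum_le_sum_of_subset_of_nonneg (fun n hn => ?_)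
          fun n _ _ => Finset.prod_nonneg fun i _ => hf0 _
        exact Fintype.mem_piFinset.2 fun i => Finset.mem_image_of_mem (fun n => n i) hn
    _ = ∏ i, ∑ x ∈ s.image (fun n => n i), f x := (Finset.prod_univ_sum _ _).symm
    _ ≤ ∏ _i : ι, ∑' x, f x :=
        Finset.prod_le_prod (fun i _ => Finset.sum_nonneg fun x _ => hf0 x)
          fun i _ => hf.sum_le_tsum _ fun x _ => hf0 x

theorem summable_exp_neg_mul_sq {c : ℝ} (hc : 0 < c) :
    Summable fun k : ℤ => Real.exp (-(c * (k : ℝ) ^ 2)) := by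
  refine (summable_pow_mul_jacobiTheta₂_term_bound 0 (T := c / Real.pi) (by positivity) 0).congr
    fun k => ?_
  rw [pow_zero, one_mul]
  congr 1
  field_simp
  ring

theorem summable_exp_neg_mul_sum_sq {ι : Type*} [Fintype ι] {c : ℝ} (hc : 0 < c) :
    Summable fun n : ι → ℤ => Real.exp (-(c * ∑ i, (n i : ℝ) ^ 2)) := by
  refine (summable_pi_prod (ι := ι) (fun k => (Real.exp_pos _).le)
    (summable_exp_neg_mul_sq hc)).congr fun n => ?_
  rw [← Real.exp_sum, Finset.mul_sum, Finset.sum_neg_distrib]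

theorem integral_tsum_of_norm_le {X ι E : Type*} [MeasurableSpace X] [Countable ι]
    [NormedAddCommGroup E] [NormedSpace ℝ E] [CompleteSpace E] {μ : Measure X}
    [IsFiniteMeasure μ] {w : ι → X → E} {b : ι → ℝ} (hw : ∀ i, AEStronglyMeasurable (w i) μ)
    (hwb : ∀ i, ∀ᵐ x ∂μ, ‖w i x‖ ≤ b i) (hb : Summable b) :
    ∫ x, ∑' i, w i x ∂μ = ∑' i, ∫ x, w i x ∂μ := by
  refine (hasSum_integral_of_dominated_convergence (fun i _ => b i) hw hwb
    (.of_forall fun _ => hb) (integrable_const _) ?_).tsum_eq.symm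
  filter_upwards [ae_all_iff.2 hwb] with x hx
  exact (Summable.of_norm_bounded hb hx).hasSum

end Summation

section Poisson

theorem intCast_units_sq (s : ℤˣ) : ((s : ℤ) : ℂ) ^ 2 = 1 := by
  rcases Int.units_eq_one_or s with rfl | rfl <;> simp

/-- The two Poisson-dual variables are oriented so that the dual frequency carries the sign `-s`,
which makes the two sides of the identity of the same shape. -/
theorem tsum_exp_shifted (s : ℤˣ) {a : ℝ} (ha : 0 < a) (w ξ : ℂ) :
    ∑' n : ℤ, Complex.exp (-Real.pi * a * (n + w) ^ 2
        - 2 * Real.pi * Complex.I * s * ξ * (n + w)) =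
      1 / (a : ℂ) ^ (1 / 2 : ℂ) * ∑' k : ℤ, Complex.exp (-Real.pi / a * (k - ξ) ^ 2
        - 2 * Real.pi * Complex.I * s * k * w) := by
  have ha' : (a : ℂ) ≠ 0 := Complex.ofReal_ne_zero.2 ha.ne'
  have hs : (s : ℂ) ^ 2 = 1 := intCast_units_sq s
  set b : ℂ := -a * w - Complex.I * s * ξ with hb
  set E : ℂ := Complex.exp (-Real.pi * a * w ^ 2 - 2 * Real.pi * Complex.I * s * ξ * w) with hE
  have hleft (n : ℤ) : Complex.exp (-Real.pi * a * (n + w) ^ 2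
      - 2 * Real.pi * Complex.I * s * ξ * (n + w)) =
      E * Complex.exp (-Real.pi * a * n ^ 2 + 2 * Real.pi * b * n) := by
    rw [hE, ← Complex.exp_add]
    congr 1
    rw [hb]
    ring
  have hright (k : ℤ) : Complex.exp (-Real.pi / a * (k - ξ) ^ 2
      - 2 * Real.pi * Complex.I * s * k * w) =
      E * Complex.exp (-Real.pi / a * ((Units.mulLeft (-s) k : ℤ) + Complex.I * b) ^ 2) := by
    have hI : Complex.I * b = s * ξ - Complex.I * a * w := by
      linear_combination (-s * ξ) * Complex.I_sq + Complex.I * hb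
    rw [hE, ← Complex.exp_add, hI, Units.mulLeft_apply]
    congr 1
    push_cast
    field_simp
    linear_combination ((k - ξ) ^ 2 : ℂ) * hs + (a ^ 2 * w ^ 2 : ℂ) * Complex.I_sq
  simp only [hleft, hright, tsum_mul_left]
  rw [Complex.tsum_exp_neg_quadratic (by simpa using ha) b,
    (Units.mulLeft (-s)).tsum_eq fun k : ℤ =>
      Complex.exp (-Real.pi / a * (k + Complex.I * b) ^ 2)]
  ring

theorem sq_add_sq_le_mul_quadratic {A B : ℝ} (hA : 0 < A) (hB : 0 < B) (t x y : ℝ) :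
    x ^ 2 + y ^ 2 ≤ ((1 + 2 * t ^ 2) / A + 2 / B) * (A * x ^ 2 + B * (y - t * x) ^ 2) := by
  have hxy : x ^ 2 + y ^ 2 ≤ (1 + 2 * t ^ 2) * x ^ 2 + 2 * (y - t * x) ^ 2 := by
    nlinarith [sq_nonneg (y - 2 * t * x)]
  have hcross : 0 ≤ (1 + 2 * t ^ 2) / A * (B * (y - t * x) ^ 2) + 2 / B * (A * x ^ 2) := by
    positivity
  have hexpand : ((1 + 2 * t ^ 2) / A + 2 / B) * (A * x ^ 2 + B * (y - t * x) ^ 2) =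
      (1 + 2 * t ^ 2) * x ^ 2 + 2 * (y - t * x) ^ 2 +
        ((1 + 2 * t ^ 2) / A * (B * (y - t * x) ^ 2) + 2 / B * (A * x ^ 2)) := by
    field_simp
    ring
  linarith

theorem summable_exp_neg_quadratic {A B : ℝ} (hA : 0 < A) (hB : 0 < B) (t u v : ℝ) :
    Summable fun p : ℤ × ℤ =>
      Real.exp (-(A * (p.1 + u) ^ 2 + B * (p.2 + v - t * (p.1 + u)) ^ 2)) := by
  set K := (1 + 2 * t ^ 2) / A + 2 / B
  have hK : 0 < K := by positivity
  have hsq (m w : ℝ) : m ^ 2 / 2 - w ^ 2 ≤ (m + w) ^ 2 := by nlinarith [sq_nonneg (m + 2 * w)]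
  have hgauss := summable_exp_neg_mul_sq (c := 1 / (2 * K)) (by positivity)
  refine .of_nonneg_of_le (fun _ => (Real.exp_pos _).le) (fun p => ?_)
    ((hgauss.mul_of_nonneg hgauss (fun _ => (Real.exp_pos _).le)
      fun _ => (Real.exp_pos _).le).mul_left (Real.exp ((u ^ 2 + v ^ 2) / K)))
  rw [← Real.exp_add, ← Real.exp_add, Real.exp_le_exp]
  have hlower : (((p.1 : ℝ) ^ 2 + (p.2 : ℝ) ^ 2) / 2 - (u ^ 2 + v ^ 2)) / K ≤
      A * (p.1 + u) ^ 2 + B * (p.2 + v - t * (p.1 + u)) ^ 2 := by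
    rw [div_le_iff₀' hK]
    linarith [hsq p.1 u, hsq p.2 v, sq_add_sq_le_mul_quadratic hA hB t (p.1 + u) (p.2 + v)]
  have hsplit : (((p.1 : ℝ) ^ 2 + (p.2 : ℝ) ^ 2) / 2 - (u ^ 2 + v ^ 2)) / K =
      1 / (2 * K) * (p.1 : ℝ) ^ 2 + 1 / (2 * K) * (p.2 : ℝ) ^ 2 - (u ^ 2 + v ^ 2) / K := by
    field_simp
  linarith

theorem norm_exp_neg_sub_I_mul (x y : ℝ) :
    ‖Complex.exp (-(x : ℂ) - Complex.I * y)‖ = Real.exp (-x) := by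
  simp [Complex.norm_exp]

/-- The summand of the theta series of two complementary fluxes `m + P * a` and `n + P * b`, whose
planes have shuffle sign `s`. -/
def pairTerm (s : ℤˣ) (β θ Q P a b : ℝ) (p : ℤ × ℤ) : ℂ :=
  Complex.exp (-(2 * Real.pi ^ 2 * β * ((p.1 + P * a) ^ 2 + (p.2 + P * b) ^ 2) : ℝ)
    - Complex.I * (s * (θ * ((p.1 + P * a) * (p.2 + P * b))
      + 2 * Real.pi * Q * ((p.1 + P * a) * b + (p.2 + P * b) * a)) : ℝ))

/-- The theta series of a pair of complementary fluxes. -/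
def pairSum (s : ℤˣ) (β θ Q P a b : ℝ) : ℂ :=
  ∑' p, pairTerm s β θ Q P a b p

/-- The summand of the theta series after Poisson summation over the second flux only. -/
def mixedTerm (s : ℤˣ) (β θ Q P a b : ℝ) (p : ℤ × ℤ) : ℂ :=
  Complex.exp (-(2 * Real.pi ^ 2 * β * (p.1 + P * a) ^ 2
      + 1 / (2 * β) * (p.2 + -(Q * a) - θ / (2 * Real.pi) * (p.1 + P * a)) ^ 2 : ℝ)
    - Complex.I * (2 * Real.pi * s * b * (Q * (p.1 + P * a) + p.2 * P) : ℝ))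

theorem summable_pairTerm (s : ℤˣ) {β : ℝ} (hβ : 0 < β) (θ Q P a b : ℝ) :
    Summable (pairTerm s β θ Q P a b) := by
  have hA : 0 < 2 * Real.pi ^ 2 * β := by positivity
  refine .of_norm ((summable_exp_neg_quadratic hA hA 0 (P * a) (P * b)).congr fun p => ?_)
  rw [pairTerm, norm_exp_neg_sub_I_mul]
  congr 1
  ring

theorem summable_mixedTerm (s : ℤˣ) {β : ℝ} (hβ : 0 < β) (θ Q P a b : ℝ) :
    Summable (mixedTerm s β θ Q P a b) := by
  refine .of_norm ((summable_exp_neg_quadratic (A := 2 * Real.pi ^ 2 * β) (B := 1 / (2 * β))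
    (by positivity) (by positivity) (θ / (2 * Real.pi)) (P * a) (-(Q * a))).congr fun p => ?_)
  rw [mixedTerm, norm_exp_neg_sub_I_mul]

theorem tsum_pairTerm_eq_tsum_mixedTerm (s : ℤˣ) {β : ℝ} (hβ : 0 < β) (θ Q P a b : ℝ) (m : ℤ) :
    ∑' n : ℤ, pairTerm s β θ Q P a b (m, n) =
      1 / ((2 * Real.pi * β : ℝ) : ℂ) ^ (1 / 2 : ℂ) *
        ∑' k : ℤ, mixedTerm s β θ Q P a b (m, k) := by
  have hpi : (Real.pi : ℂ) ≠ 0 := Complex.ofReal_ne_zero.2 Real.pi_ne_zero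
  have hβ' : (β : ℂ) ≠ 0 := Complex.ofReal_ne_zero.2 hβ.ne'
  set x : ℝ := m + P * a with hx
  set E : ℂ := Complex.exp (-(2 * Real.pi ^ 2 * β * x ^ 2 : ℝ)
    - Complex.I * (2 * Real.pi * s * Q * x * b : ℝ)) with hE
  have hpair (n : ℤ) : pairTerm s β θ Q P a b (m, n) = E *
      Complex.exp (-Real.pi * (2 * Real.pi * β : ℝ) * (n + (P * b : ℝ)) ^ 2
        - 2 * Real.pi * Complex.I * s * (Q * a + θ * x / (2 * Real.pi) : ℝ)
          * (n + (P * b : ℝ))) := by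
    rw [hE, ← Complex.exp_add, pairTerm, ← hx]
    congr 1
    push_cast
    field_simp
    ring
  have hmixed (k : ℤ) : mixedTerm s β θ Q P a b (m, k) = E *
      Complex.exp (-Real.pi / (2 * Real.pi * β : ℝ) *
        (k - (Q * a + θ * x / (2 * Real.pi) : ℝ)) ^ 2
        - 2 * Real.pi * Complex.I * s * k * (P * b : ℝ)) := by
    rw [hE, ← Complex.exp_add, mixedTerm, ← hx]
    congr 1
    push_cast
    field_simp
    ring
  simp only [hpair, hmixed, tsum_mul_left]
  rw [tsum_exp_shifted s (by positivity)]
  ring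

theorem pairSum_eq_tsum_mixedTerm (s : ℤˣ) {β : ℝ} (hβ : 0 < β) (θ Q P a b : ℝ) :
    pairSum s β θ Q P a b =
      1 / ((2 * Real.pi * β : ℝ) : ℂ) ^ (1 / 2 : ℂ) * ∑' p, mixedTerm s β θ Q P a b p := by
  rw [pairSum, (summable_pairTerm s hβ θ Q P a b).tsum_prod,
    (summable_mixedTerm s hβ θ Q P a b).tsum_prod, ← tsum_mul_left]
  exact tsum_congr (tsum_pairTerm_eq_tsum_mixedTerm s hβ θ Q P a b)

-- After one Poisson summation all summands are positive, although those of `pairSum` are not.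
theorem pairSum_zero_zero_ne_zero (s : ℤˣ) {β : ℝ} (hβ : 0 < β) (θ a b : ℝ) :
    pairSum s β θ 0 0 a b ≠ 0 := by
  rw [pairSum_eq_tsum_mixedTerm s hβ]
  refine mul_ne_zero (one_div_ne_zero ?_) ?_
  · rw [Complex.cpow_ne_zero_iff]
    exact .inl (Complex.ofReal_ne_zero.2 (by positivity))
  · have hmixed (p : ℤ × ℤ) : mixedTerm s β θ 0 0 a b p =
        (Real.exp (-(2 * Real.pi ^ 2 * β * (p.1 + 0) ^ 2
          + 1 / (2 * β) * (p.2 + 0 - θ / (2 * Real.pi) * (p.1 + 0)) ^ 2)) : ℝ) := by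
      rw [mixedTerm, Complex.ofReal_exp]
      simp
    rw [tsum_congr hmixed, ← Complex.ofReal_tsum, Complex.ofReal_ne_zero]
    exact ((summable_exp_neg_quadratic (by positivity) (by positivity) _ 0 0).tsum_pos
      (fun p => (Real.exp_pos _).le) (0, 0) (Real.exp_pos _)).ne'

end Poisson

section CouplingDuality

/-- The common denominator of the dual couplings. -/
def couplingNorm (β θ : ℝ) : ℝ :=
  (2 * Real.pi * β) ^ 2 + (θ / (2 * Real.pi)) ^ 2

theorem couplingNorm_pos {β : ℝ} (hβ : 0 < β) (θ : ℝ) : 0 < couplingNorm β θ := by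
  rw [couplingNorm]
  positivity

theorem betaDual_eq (β θ : ℝ) : betaDual β θ = β / couplingNorm β θ :=
  rfl

theorem thetaDual_eq (β θ : ℝ) : thetaDual β θ = -θ / couplingNorm β θ :=
  rfl

theorem betaDual_pos {β : ℝ} (hβ : 0 < β) (θ : ℝ) : 0 < betaDual β θ :=
  div_pos hβ (couplingNorm_pos hβ θ)

theorem dual_exponent (s : ℤˣ) {β : ℝ} (hβ : 0 < β) (θ : ℝ) (y z : ℂ) :
    -Real.pi / (couplingNorm β θ / (2 * Real.pi * β) : ℝ) *
        (z - Complex.I * (s * θ / (4 * Real.pi ^ 2 * β)) * y) ^ 2 - y ^ 2 / (2 * β) =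
      -(2 * Real.pi ^ 2 * betaDual β θ * (y ^ 2 + z ^ 2))
        - Complex.I * (s * thetaDual β θ * (y * z)) := by
  have hpi : (Real.pi : ℂ) ≠ 0 := Complex.ofReal_ne_zero.2 Real.pi_ne_zero
  have hβ' : (β : ℂ) ≠ 0 := Complex.ofReal_ne_zero.2 hβ.ne'
  have hD : (couplingNorm β θ : ℂ) ≠ 0 := Complex.ofReal_ne_zero.2 (couplingNorm_pos hβ θ).ne'
  have hDdef : 4 * Real.pi ^ 2 * (couplingNorm β θ : ℂ) = 16 * Real.pi ^ 4 * β ^ 2 + θ ^ 2 := by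
    rw [couplingNorm]
    push_cast
    field_simp
    ring
  have hs : (s : ℂ) ^ 2 = 1 := intCast_units_sq s
  rw [betaDual_eq, thetaDual_eq]
  push_cast
  field_simp
  linear_combination -4 * y ^ 2 * hDdef - 4 * θ ^ 2 * y ^ 2 * (s ^ 2 * Complex.I_sq - hs)

theorem tsum_mixedTerm_eq_tsum_pairTerm_dual (s : ℤˣ) {β : ℝ} (hβ : 0 < β) (θ Q P a b : ℝ)
    (k : ℤ) :
    ∑' m : ℤ, mixedTerm s β θ Q P a b (m, k) =
      1 / ((couplingNorm β θ / (2 * Real.pi * β) : ℝ) : ℂ) ^ (1 / 2 : ℂ) *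
        Complex.exp (-(Complex.I * (4 * Real.pi * s * Q * P * a * b : ℝ))) *
        ∑' j : ℤ, pairTerm s (betaDual β θ) (thetaDual β θ) P (-Q) a b (k, j) := by
  have hpi : (Real.pi : ℂ) ≠ 0 := Complex.ofReal_ne_zero.2 Real.pi_ne_zero
  have hβ' : (β : ℂ) ≠ 0 := Complex.ofReal_ne_zero.2 hβ.ne'
  have hD := couplingNorm_pos hβ θ
  have hs : (s : ℂ) ^ 2 = 1 := intCast_units_sq s
  set y : ℝ := k - Q * a with hy
  set ξ : ℂ := Q * b + Complex.I * (s * θ / (4 * Real.pi ^ 2 * β)) * y with hξ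
  set E : ℂ := Complex.exp (-(y ^ 2 / (2 * β) : ℝ)
    - Complex.I * (2 * Real.pi * s * b * k * P : ℝ)) with hE
  have hmixed (m : ℤ) : mixedTerm s β θ Q P a b (m, k) = E *
      Complex.exp (-Real.pi * (couplingNorm β θ / (2 * Real.pi * β) : ℝ) * (m + (P * a : ℝ)) ^ 2
        - 2 * Real.pi * Complex.I * s * ξ * (m + (P * a : ℝ))) := by
    rw [hE, ← Complex.exp_add, mixedTerm, couplingNorm, hξ, ← sub_eq_add_neg, ← hy]
    congr 1
    push_cast
    field_simp
    linear_combination (16 * Real.pi * y * (m + P * a) * θ : ℂ) * (s ^ 2 * Complex.I_sq - hs)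
  have hpair (j : ℤ) : Complex.exp (-(Complex.I * (4 * Real.pi * s * Q * P * a * b : ℝ))) *
      pairTerm s (betaDual β θ) (thetaDual β θ) P (-Q) a b (k, j) = E *
      Complex.exp (-Real.pi / (couplingNorm β θ / (2 * Real.pi * β) : ℝ) * (j - ξ) ^ 2
        - 2 * Real.pi * Complex.I * s * j * (P * a : ℝ)) := by
    have hexp := dual_exponent s hβ θ y (j - Q * b)
    rw [hE, ← Complex.exp_add, pairTerm, ← Complex.exp_add]
    congr 1
    rw [hξ, ← sub_sub]
    have hyc : (y : ℂ) = k - Q * a := by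
      rw [hy]
      push_cast
      ring
    push_cast at hexp ⊢
    rw [hyc] at hexp ⊢
    linear_combination -hexp
  rw [mul_assoc, ← tsum_mul_left, tsum_congr hpair, tsum_congr hmixed, tsum_mul_left,
    tsum_mul_left, tsum_exp_shifted s (by positivity)]
  ring

/-- The constant of the two Poisson summations over a pair of complementary fluxes. -/
def pairConst (β θ : ℝ) : ℂ :=
  1 / ((2 * Real.pi * β : ℝ) : ℂ) ^ (1 / 2 : ℂ) *
    (1 / ((couplingNorm β θ / (2 * Real.pi * β) : ℝ) : ℂ) ^ (1 / 2 : ℂ))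

theorem pairSum_dual (s : ℤˣ) {β : ℝ} (hβ : 0 < β) (θ Q P a b : ℝ) :
    pairSum s β θ Q P a b =
      pairConst β θ * Complex.exp (-(Complex.I * (4 * Real.pi * s * Q * P * a * b : ℝ))) *
        pairSum s (betaDual β θ) (thetaDual β θ) P (-Q) a b := by
  have hswap : Summable fun p : ℤ × ℤ => mixedTerm s β θ Q P a b (p.2, p.1) :=
    (Equiv.prodComm ℤ ℤ).summable_iff.2 (summable_mixedTerm s hβ θ Q P a b)
  rw [pairSum_eq_tsum_mixedTerm s hβ, pairSum,
    ← (Equiv.prodComm ℤ ℤ).tsum_eq (mixedTerm s β θ Q P a b)]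
  simp only [Equiv.prodComm_apply, Prod.swap]
  rw [hswap.tsum_prod,
    (summable_pairTerm s (betaDual_pos hβ θ) (thetaDual β θ) P (-Q) a b).tsum_prod,
    tsum_congr (tsum_mixedTerm_eq_tsum_pairTerm_dual s hβ θ Q P a b), tsum_mul_left, pairConst]
  ring

end CouplingDuality

section FluxSum

/-- The six fluxes of a constant `2`-form, grouped in pairs of complementary planes. -/
def fluxEquiv (X : Type*) : (Dirs 2 → X) ≃ (X × X) × ((X × X) × (X × X)) where
  toFun m := ((m (dir2 0 1), m (dir2 2 3)), ((m (dir2 0 2), m (dir2 1 3)),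
    (m (dir2 0 3), m (dir2 1 2))))
  invFun p I := if I = dir2 0 1 then p.1.1 else if I = dir2 2 3 then p.1.2 else
    if I = dir2 0 2 then p.2.1.1 else if I = dir2 1 3 then p.2.1.2 else
    if I = dir2 0 3 then p.2.2.1 else p.2.2.2
  left_inv m := by
    have hcases : ∀ I : Dirs 2, I = dir2 0 1 ∨ I = dir2 2 3 ∨ I = dir2 0 2 ∨ I = dir2 1 3 ∨
        I = dir2 0 3 ∨ I = dir2 1 2 := by decide
    funext I
    rcases hcases I with rfl | rfl | rfl | rfl | rfl | rfl <;> simp (decide := true)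
  right_inv p := by
    simp (decide := true)

/-- The flux of `m + P * η`, for an integral flux `m` and the background flux `η` of a current
of charge `P`. -/
def shiftedFlux (P : ℝ) (η : Dirs 2 → ℝ) (m : Dirs 2 → ℤ) : Dirs 2 → ℝ :=
  fun I => m I + P * η I

/-- The summand of the theta series over all fluxes: the weight of a constant field strength of
flux `m + P * η`, coupled to a background of charge `Q`. -/
def fluxTerm (β θ Q P : ℝ) (η : Dirs 2 → ℝ) (m : Dirs 2 → ℤ) : ℂ :=
  Complex.exp (-(2 * Real.pi ^ 2 * β * ∑ I, shiftedFlux P η m I ^ 2 : ℝ)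
    - Complex.I * (θ / 2 * wedge (shiftedFlux P η m) (shiftedFlux P η m)
      + 2 * Real.pi * Q * wedge (shiftedFlux P η m) η : ℝ))

/-- The theta series over all fluxes. -/
def fluxSum (β θ Q P : ℝ) (η : Dirs 2 → ℝ) : ℂ :=
  ∑' m, fluxTerm β θ Q P η m

theorem fluxTerm_eq_mul_pairTerm (β θ Q P : ℝ) (η : Dirs 2 → ℝ) (m : Dirs 2 → ℤ) :
    fluxTerm β θ Q P η m =
      pairTerm 1 β θ Q P (η (dir2 0 1)) (η (dir2 2 3)) (m (dir2 0 1), m (dir2 2 3)) *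
      (pairTerm (-1) β θ Q P (η (dir2 0 2)) (η (dir2 1 3)) (m (dir2 0 2), m (dir2 1 3)) *
        pairTerm 1 β θ Q P (η (dir2 0 3)) (η (dir2 1 2)) (m (dir2 0 3), m (dir2 1 2))) := by
  simp only [fluxTerm, pairTerm, ← Complex.exp_add, wedge, sum_dirs_two, shiftedFlux]
  congr 1
  push_cast
  ring

theorem fluxSum_eq_mul_pairSum {β : ℝ} (hβ : 0 < β) (θ Q P : ℝ) (η : Dirs 2 → ℝ) :
    fluxSum β θ Q P η = pairSum 1 β θ Q P (η (dir2 0 1)) (η (dir2 2 3)) *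
      (pairSum (-1) β θ Q P (η (dir2 0 2)) (η (dir2 1 3)) *
        pairSum 1 β θ Q P (η (dir2 0 3)) (η (dir2 1 2))) := by
  have h01 := (summable_pairTerm 1 hβ θ Q P (η (dir2 0 1)) (η (dir2 2 3))).norm
  have h02 := (summable_pairTerm (-1) hβ θ Q P (η (dir2 0 2)) (η (dir2 1 3))).norm
  have h03 := (summable_pairTerm 1 hβ θ Q P (η (dir2 0 3)) (η (dir2 1 2))).norm
  simp only [pairSum]
  rw [tsum_mul_tsum_of_summable_norm h02 h03, tsum_mul_tsum_of_summable_norm h01 (h02.mul_norm h03),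
    ← (fluxEquiv ℤ).tsum_eq, fluxSum]
  exact tsum_congr fun m => fluxTerm_eq_mul_pairTerm β θ Q P η m

theorem fluxSum_zero_zero_ne_zero {β : ℝ} (hβ : 0 < β) (θ : ℝ) (η : Dirs 2 → ℝ) :
    fluxSum β θ 0 0 η ≠ 0 := by
  rw [fluxSum_eq_mul_pairSum hβ]
  exact mul_ne_zero (pairSum_zero_zero_ne_zero _ hβ θ _ _)
    (mul_ne_zero (pairSum_zero_zero_ne_zero _ hβ θ _ _) (pairSum_zero_zero_ne_zero _ hβ θ _ _))

theorem fluxSum_dual {β : ℝ} (hβ : 0 < β) (θ Q P : ℝ) (η : Dirs 2 → ℝ) :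
    fluxSum β θ Q P η = pairConst β θ ^ 3 *
      Complex.exp (-(Complex.I * (2 * Real.pi * Q * P * wedge η η : ℝ))) *
        fluxSum (betaDual β θ) (thetaDual β θ) P (-Q) η := by
  have hphase : Complex.exp (-(Complex.I * (2 * Real.pi * Q * P * wedge η η : ℝ))) =
      Complex.exp (-(Complex.I * (4 * Real.pi * (1 : ℤˣ) * Q * P * η (dir2 0 1) *
        η (dir2 2 3) : ℝ))) *
      Complex.exp (-(Complex.I * (4 * Real.pi * (-1 : ℤˣ) * Q * P * η (dir2 0 2) *
        η (dir2 1 3) : ℝ))) *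
      Complex.exp (-(Complex.I * (4 * Real.pi * (1 : ℤˣ) * Q * P * η (dir2 0 3) *
        η (dir2 1 2) : ℝ))) := by
    rw [← Complex.exp_add, ← Complex.exp_add, wedge]
    congr 1
    push_cast
    ring
  rw [fluxSum_eq_mul_pairSum hβ, fluxSum_eq_mul_pairSum (betaDual_pos hβ θ), pairSum_dual 1 hβ,
    pairSum_dual (-1) hβ, pairSum_dual 1 hβ, hphase]
  ring

end FluxSum

section Continuity

variable {N : ℕ} [NeZero N] {Λ : LatticeKind} {X : Type*} [TopologicalSpace X]

@[fun_prop]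
theorem continuous_latD {r : ℕ} : Continuous (latD : Form N Λ r ℝ → Form N Λ (r + 1) ℝ) :=
  (latDₗ : Form N Λ r ℝ →ₗ[ℝ] Form N Λ (r + 1) ℝ).continuous_of_finiteDimensional

@[fun_prop]
theorem continuous_latSum : Continuous (latSum : Form N Λ 4 ℝ → ℝ) :=
  (latSumₗ : Form N Λ 4 ℝ →ₗ[ℝ] ℝ).continuous_of_finiteDimensional

@[fun_prop]
theorem continuous_dotForm {r : ℕ} {f g : X → Form N Λ r ℝ}
    (hf : Continuous f) (hg : Continuous g) : Continuous fun x => dotForm (f x) (g x) := by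
  unfold dotForm
  fun_prop

@[fun_prop]
theorem continuous_cup {p q : ℕ} {f : X → Form N Λ p ℝ} {g : X → Form N Λ q ℝ}
    (hf : Continuous f) (hg : Continuous g) : Continuous fun x => cup (f x) (g x) :=
  ((cupₗ (R := ℝ)).toContinuousBilinearMap.continuous.comp hf).clm_apply hg

@[fun_prop]
theorem continuous_cupOne {p q : ℕ} {f : X → Form N Λ (p + 1) ℝ} {g : X → Form N Λ (q + 1) ℝ}
    (hf : Continuous f) (hg : Continuous g) : Continuous fun x => cupOne (f x) (g x) := by
  simp only [← cupOneₗ_apply]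
  exact ((cupOneₗ (R := ℝ)).toContinuousBilinearMap.continuous.comp hf).clm_apply hg

@[fun_prop]
theorem continuous_starForm {p q : ℕ} (o : CupOrder) :
    Continuous (starForm o : Form N Λ q ℝ → Form N Λ p ℝ) :=
  (starFormₗ o : Form N Λ q ℝ →ₗ[ℝ] Form N Λ p ℝ).continuous_of_finiteDimensional

@[fun_prop]
theorem continuous_fieldStrength (n : Form N Λ 2 ℤ) :
    Continuous fun A : Form N Λ 1 ℝ => fieldStrength A n := by
  unfold fieldStrength
  fun_prop

end Continuity

section Gaussian

variable {V : Type*} [NormedAddCommGroup V] [InnerProductSpace ℝ V] [FiniteDimensional ℝ V]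
  [MeasurableSpace V] [BorelSpace V]

/-- The integral of `exp (-(β / 2) ‖v‖²)` with respect to a translation invariant measure `μ`. -/
def gaussConst (μ : Measure V) [μ.IsAddLeftInvariant] [IsFiniteMeasureOnCompacts μ] (β : ℝ) : ℂ :=
  (μ.addHaarScalarFactor volume : ℝ) *
    (Real.pi / (β / 2 : ℝ)) ^ (Module.finrank ℝ V / 2 : ℂ)

variable {μ : Measure V} [μ.IsAddLeftInvariant] [IsFiniteMeasureOnCompacts μ] {β : ℝ}

theorem gaussConst_ne_zero (hμ : μ ≠ 0) (hβ : 0 < β) : gaussConst μ β ≠ 0 := by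
  have hfactor : μ.addHaarScalarFactor volume ≠ 0 := fun h => hμ <| by
    rw [μ.isAddLeftInvariant_eq_smul volume, h, zero_smul]
  have hbase : (Real.pi / (β / 2 : ℝ) : ℂ) ≠ 0 := by
    exact_mod_cast div_ne_zero Real.pi_ne_zero (half_pos hβ).ne'
  exact mul_ne_zero (by exact_mod_cast hfactor)
    (by simp only [ne_eq, Complex.cpow_eq_zero_iff, hbase, false_and, not_false_eq_true])

theorem integral_exp_neg_norm_sq_sub_inner (hβ : 0 < β) (κ : ℝ) (j : V) :
    ∫ v, Complex.exp (-(β / 2 * ‖v‖ ^ 2 : ℝ) - Complex.I * (κ * inner ℝ v j : ℝ)) ∂μ =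
      gaussConst μ β * Complex.exp (-(κ ^ 2 / (2 * β) * ‖j‖ ^ 2 : ℝ)) := by
  have hβ' : (β : ℂ) ≠ 0 := Complex.ofReal_ne_zero.2 hβ.ne'
  have hvolume := GaussianFourier.integral_cexp_neg_mul_sq_norm_add (V := V) (b := (β / 2 : ℝ))
    (by simpa using hβ) (-(Complex.I * κ)) j
  have hexponent (v : V) :
      (-(β / 2 * ‖v‖ ^ 2 : ℝ) - Complex.I * (κ * inner ℝ v j : ℝ) : ℂ) =
        -((β / 2 : ℝ) : ℂ) * ‖v‖ ^ 2 + -(Complex.I * κ) * (inner ℝ j v : ℝ) := by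
    rw [real_inner_comm]
    push_cast
    ring
  simp only [hexponent]
  conv_lhs => rw [μ.isAddLeftInvariant_eq_smul volume, integral_smul_nnreal_measure]
  rw [hvolume, NNReal.smul_def, Complex.real_smul, gaussConst, mul_assoc]
  congr 3
  push_cast
  rw [neg_sq, mul_pow, Complex.I_sq]
  field_simp
  ring

end Gaussian

section ExactFields

variable {N : ℕ} {Λ : LatticeKind}

/-- The integer `2`-forms that are exact as real forms. -/
def exactInt (N : ℕ) (Λ : LatticeKind) : AddSubgroup (Form N Λ 2 ℤ) where
  carrier := {n | ∃ A : Form N Λ 1 ℝ, realForm n = latD A}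
  zero_mem' := ⟨0, by rw [← latDₗ_apply, map_zero]; exact funext fun _ => Int.cast_zero⟩
  add_mem' := by
    rintro a b ⟨A, hA⟩ ⟨B, hB⟩
    exact ⟨A + B, by rw [realForm_add, hA, hB]; simp only [← latDₗ_apply, map_add]⟩
  neg_mem' := by
    rintro a ⟨A, hA⟩
    exact ⟨-A, by rw [realForm_neg, hA]; simp only [← latDₗ_apply, map_neg]⟩

theorem latD_mem_exactInt (k : Form N Λ 1 ℤ) : latD k ∈ exactInt N Λ :=
  ⟨realForm k, realForm_latD k⟩

/-- A real potential of an exact integer form. -/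
def potential (n : exactInt N Λ) : Form N Λ 1 ℝ := n.2.choose

theorem latD_potential (n : exactInt N Λ) : latD (potential n) = realForm (n : Form N Λ 2 ℤ) :=
  n.2.choose_spec.symm

/-- The space of exact real `2`-forms, with the scalar product of forms. -/
def exactSpace (N : ℕ) (Λ : LatticeKind) :
    Submodule ℝ (EuclideanSpace ℝ (Cell N Λ 2)) :=
  LinearMap.range ((WithLp.linearEquiv 2 ℝ (Form N Λ 2 ℝ)).symm.toLinearMap ∘ₗ
    latDₗ (N := N) (Λ := Λ) (r := 1))

/-- The exterior derivative as a map onto the space of exact forms. -/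
def exactMap (N : ℕ) (Λ : LatticeKind) : Form N Λ 1 ℝ →ₗ[ℝ] exactSpace N Λ :=
  LinearMap.rangeRestrict _

theorem coe_exactMap (A : Form N Λ 1 ℝ) :
    (exactMap N Λ A : EuclideanSpace ℝ (Cell N Λ 2)) = WithLp.toLp 2 (latD A) := rfl

theorem exactMap_surjective : Function.Surjective (exactMap N Λ) :=
  LinearMap.surjective_rangeRestrict _

/-- The field strength `dA + 2πn` of an exact `n`, as an element of the space of exact forms. -/
def exactField (n : exactInt N Λ) (A : Form N Λ 1 ℝ) : exactSpace N Λ :=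
  exactMap N Λ (A + (2 * Real.pi) • potential n)

theorem coe_exactField (n : exactInt N Λ) (A : Form N Λ 1 ℝ) :
    (exactField n A : EuclideanSpace ℝ (Cell N Λ 2)) = WithLp.toLp 2 (fieldStrength A n) := by
  rw [exactField, coe_exactMap, fieldStrength, ← latD_potential]
  simp only [← latDₗ_apply, map_add, map_smul]

theorem exactField_add (n : exactInt N Λ) (A B : Form N Λ 1 ℝ) :
    exactField n (A + B) = exactMap N Λ B + exactField n A := by
  rw [exactField, exactField, ← map_add, add_right_comm, add_comm]

theorem exactField_add_two_pi (n : exactInt N Λ) (A : Form N Λ 1 ℝ) (k : Form N Λ 1 ℤ) :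
    exactField n (fun c => A c + 2 * Real.pi * k c) =
      exactField (n + ⟨latD k, latD_mem_exactInt k⟩) A := by
  apply Subtype.ext
  rw [coe_exactField, coe_exactField]
  change WithLp.toLp 2 (fieldStrength (A + (2 * Real.pi) • realForm k) n) =
    WithLp.toLp 2 (fieldStrength A (n + latD k))
  rw [fieldStrength, fieldStrength, realForm_add, realForm_latD]
  simp only [← latDₗ_apply, map_add, map_smul, smul_add]
  congr 1
  abel

variable [NeZero N]

theorem inner_toLp {r : ℕ} (α β : Form N Λ r ℝ) :
    inner ℝ (WithLp.toLp 2 α : EuclideanSpace ℝ (Cell N Λ r)) (WithLp.toLp 2 β) =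
      dotForm α β := by
  rw [PiLp.inner_apply]
  exact Finset.sum_congr rfl fun c _ => mul_comm _ _

theorem measurable_exactField (n : exactInt N Λ) : Measurable (exactField n) :=
  (LinearMap.continuous_of_finiteDimensional (exactMap N Λ)).measurable.comp
    (measurable_id.add_const _)

theorem norm_sq_exactField (n : exactInt N Λ) (A : Form N Λ 1 ℝ) :
    ‖exactField n A‖ ^ 2 = dotForm (fieldStrength A n) (fieldStrength A n) := by
  rw [← real_inner_self_eq_norm_sq, Submodule.coe_inner, coe_exactField, inner_toLp]

/-- The joint distribution of the exact fields `dA + 2πn`, over all exact `n` and all `A` with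
values in `[-π, π)`: a translation invariant measure, since `[-π, π)` is a fundamental domain
of `2πℤ`. -/
def exactMeasure (N : ℕ) [NeZero N] (Λ : LatticeKind) : Measure (exactSpace N Λ) :=
  Measure.sum fun n : exactInt N Λ => (gaugeMeasure N Λ 1).map (exactField n)

theorem lintegral_exactMeasure {f : exactSpace N Λ → ENNReal} (hf : Measurable f) :
    ∫⁻ E, f E ∂(exactMeasure N Λ) =
      ∫⁻ A, ∑' n : exactInt N Λ, f (exactField n A) ∂(gaugeMeasure N Λ 1) := by
  have hcomp (n : exactInt N Λ) :
      AEMeasurable (fun A => f (exactField n A)) (gaugeMeasure N Λ 1) :=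
    (hf.comp (measurable_exactField n)).aemeasurable
  rw [exactMeasure, lintegral_sum_measure, lintegral_tsum hcomp]
  exact tsum_congr fun n => lintegral_map hf (measurable_exactField n)

instance : (exactMeasure N Λ).IsAddLeftInvariant := by
  refine ⟨fun e => ?_⟩
  obtain ⟨B, rfl⟩ := exactMap_surjective e
  refine Measure.ext_of_lintegral _ fun f hf => ?_
  have hshift := lintegral_exactMeasure (hf.comp (measurable_const_add (exactMap N Λ B)))
  simp only [Function.comp_def, ← exactField_add] at hshift
  rw [lintegral_map hf (measurable_const_add _), hshift, lintegral_exactMeasure hf]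
  refine lintegral_add_of_periodic (Ψ := fun A => ∑' n : exactInt N Λ, f (exactField n A))
    (Measurable.tsum fun n => hf.comp (measurable_exactField n)) (fun A k => ?_) B
  simp only [exactField_add_two_pi]
  exact (Equiv.addRight (⟨latD k, latD_mem_exactInt k⟩ : exactInt N Λ)).tsum_eq
    fun n => f (exactField n A)

theorem exactMeasure_ne_zero : exactMeasure N Λ ≠ 0 := by
  rw [exactMeasure, Ne, Measure.sum_eq_zero, not_forall]
  exact ⟨0, by
    rw [Measure.map_eq_zero_iff (measurable_exactField 0).aemeasurable]
    exact IsProbabilityMeasure.ne_zero _⟩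

end ExactFields

section ExactGaussian

variable {N : ℕ} [NeZero N] {Λ : LatticeKind}

theorem ae_abs_le_pi (r : ℕ) : ∀ᵐ A ∂(gaugeMeasure N Λ r), ∀ c, |A c| ≤ Real.pi := by
  rw [gaugeMeasure_eq, ae_all_iff]
  intro c
  have hangle : ∀ᵐ a ∂angleMeasure, |a| ≤ Real.pi := by
    refine Measure.ae_smul_measure ?_ _
    rw [ae_restrict_iff' measurableSet_Ico]
    exact Filter.Eventually.of_forall fun a ha => abs_le.2 ⟨ha.1, ha.2.le⟩
  exact (measurePreserving_eval (fun _ : Cell N Λ r => angleMeasure) c).quasiMeasurePreserving.ae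
    hangle

theorem exists_dotForm_latD_le (r : ℕ) : ∃ C, ∀ A : Form N Λ r ℝ, (∀ c, |A c| ≤ Real.pi) →
    dotForm (latD A) (latD A) ≤ C := by
  obtain ⟨C, hC⟩ := (isCompact_Icc (a := fun _ : Cell N Λ r => -Real.pi)
    (b := fun _ => Real.pi)).bddAbove_image
      (continuous_dotForm continuous_latD continuous_latD).continuousOn
  exact ⟨C, fun A hA => hC ⟨A, ⟨fun c => (abs_le.1 (hA c)).1, fun c => (abs_le.1 (hA c)).2⟩, rfl⟩⟩

theorem exists_summable_exp_fieldStrength_le {β : ℝ} (hβ : 0 < β) :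
    ∃ g : Form N Λ 2 ℤ → ℝ, Summable g ∧ ∀ A : Form N Λ 1 ℝ, (∀ c, |A c| ≤ Real.pi) → ∀ n,
      Real.exp (-(β / 2 * dotForm (fieldStrength A n) (fieldStrength A n))) ≤ g n := by
  obtain ⟨C, hC⟩ := exists_dotForm_latD_le (N := N) (Λ := Λ) 1
  refine ⟨fun n => Real.exp (β / 2 * C) * Real.exp (-(β * Real.pi ^ 2 * ∑ c, (n c : ℝ) ^ 2)),
    (summable_exp_neg_mul_sum_sq (by positivity)).mul_left _, fun A hA n => ?_⟩
  beta_reduce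
  rw [← Real.exp_add, Real.exp_le_exp]
  have hfield : 2 * Real.pi ^ 2 * ∑ c, (n c : ℝ) ^ 2 - dotForm (latD A) (latD A)
      ≤ dotForm (fieldStrength A n) (fieldStrength A n) := by
    rw [dotForm, dotForm, Finset.mul_sum, ← Finset.sum_sub_distrib]
    refine Finset.sum_le_sum fun c _ => ?_
    simp only [fieldStrength, realForm, Pi.add_apply, Pi.smul_apply, smul_eq_mul]
    nlinarith [sq_nonneg (2 * Real.pi * n c + 2 * latD A c)]
  nlinarith [hC A hA]

theorem lintegral_exp_exactMeasure_lt_top {β : ℝ} (hβ : 0 < β) :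
    ∫⁻ E, ENNReal.ofReal (Real.exp (-(β / 2 * ‖E‖ ^ 2))) ∂(exactMeasure N Λ) < ⊤ := by
  obtain ⟨g, hg, hle⟩ := exists_summable_exp_fieldStrength_le (N := N) (Λ := Λ) hβ
  have hg0 (n) : 0 ≤ g n :=
    (Real.exp_pos _).le.trans (hle 0 (fun c => by simpa using Real.pi_pos.le) n)
  rw [lintegral_exactMeasure (by fun_prop)]
  calc ∫⁻ A, ∑' n : exactInt N Λ, ENNReal.ofReal (Real.exp (-(β / 2 * ‖exactField n A‖ ^ 2)))
        ∂(gaugeMeasure N Λ 1)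
      ≤ ∫⁻ _, ∑' n : exactInt N Λ, ENNReal.ofReal (g n) ∂(gaugeMeasure N Λ 1) := by
        refine lintegral_mono_ae ?_
        filter_upwards [ae_abs_le_pi (N := N) (Λ := Λ) 1] with A hA
        refine ENNReal.tsum_le_tsum fun n => ENNReal.ofReal_le_ofReal ?_
        rw [norm_sq_exactField]
        exact hle A hA n
    _ = ENNReal.ofReal (∑' n : exactInt N Λ, g n) := by
        rw [lintegral_const, measure_univ, mul_one,
          ENNReal.ofReal_tsum_of_nonneg (f := fun n : exactInt N Λ => g n) (fun n => hg0 n)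
            (hg.subtype _)]
    _ < ⊤ := ENNReal.ofReal_lt_top

instance : IsFiniteMeasureOnCompacts (exactMeasure N Λ) := by
  refine ⟨fun K hK => ?_⟩
  obtain ⟨R, hR⟩ := hK.isBounded.exists_norm_le
  have hmarkov : ENNReal.ofReal (Real.exp (-(R ^ 2))) * exactMeasure N Λ K < ⊤ := by
    refine lt_of_le_of_lt ?_ (lintegral_exp_exactMeasure_lt_top (N := N) (Λ := Λ) two_pos)
    rw [← setLIntegral_const]
    refine (setLIntegral_mono' hK.measurableSet fun E hE => ENNReal.ofReal_le_ofReal ?_).trans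
      (setLIntegral_le_lintegral _ _)
    rw [Real.exp_le_exp]
    linarith [pow_le_pow_left₀ (norm_nonneg E) (hR E hE) 2]
  exact ENNReal.lt_top_of_mul_ne_top_right hmarkov.ne (by simp [Real.exp_pos])

theorem integrable_exp_exactMeasure {β : ℝ} (hβ : 0 < β) (κ : ℝ) (j : exactSpace N Λ) :
    Integrable (fun E => Complex.exp (-(β / 2 * ‖E‖ ^ 2 : ℝ) - Complex.I * (κ * inner ℝ E j : ℝ)))
      (exactMeasure N Λ) := by
  refine ⟨(by fun_prop : Continuous _).aestronglyMeasurable, ?_⟩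
  simp only [hasFiniteIntegral_iff_norm, norm_exp_neg_sub_I_mul]
  exact lintegral_exp_exactMeasure_lt_top hβ

theorem tsum_integral_comp_exactField {f : exactSpace N Λ → ℂ}
    (hf : Integrable f (exactMeasure N Λ)) (B : exactSpace N Λ) :
    ∑' n : exactInt N Λ, ∫ A, f (B + exactField n A) ∂(gaugeMeasure N Λ 1) =
      ∫ E, f E ∂(exactMeasure N Λ) := by
  have hshift : Integrable (fun E => f (B + E)) (exactMeasure N Λ) := hf.comp_add_left B
  rw [← integral_add_left_eq_self f B, exactMeasure, integral_sum_measure hshift]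
  refine tsum_congr fun n => ?_
  rw [integral_map (measurable_exactField n).aemeasurable]
  exact hshift.aestronglyMeasurable.mono_measure (Measure.le_sum _ n)

/-- A Gaussian weight for the field `E` with a linear phase `κ j·E`. -/
def gaussPhase (β κ : ℝ) (j E : Form N Λ 2 ℝ) : ℂ :=
  Complex.exp (-(β / 2 * dotForm E E : ℝ) - Complex.I * (κ * dotForm E j : ℝ))

theorem tsum_integral_gaussPhase {β : ℝ} (hβ : 0 < β) (κ : ℝ) (k B : Form N Λ 1 ℝ) :
    ∑' n : exactInt N Λ, ∫ A, gaussPhase β κ (latD k) (fieldStrength A n + latD B)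
      ∂(gaugeMeasure N Λ 1) =
    gaussConst (exactMeasure N Λ) β *
      Complex.exp (-(κ ^ 2 / (2 * β) * dotForm (latD k) (latD k) : ℝ)) := by
  have hshift (n : exactInt N Λ) (A : Form N Λ 1 ℝ) :
      ((exactMap N Λ B + exactField n A : exactSpace N Λ) : EuclideanSpace ℝ (Cell N Λ 2)) =
        WithLp.toLp 2 (fieldStrength A n + latD B) := by
    rw [Submodule.coe_add, coe_exactField, coe_exactMap, add_comm, WithLp.toLp_add]
  have hphase (n : exactInt N Λ) (A : Form N Λ 1 ℝ) :
      gaussPhase β κ (latD k) (fieldStrength A n + latD B) =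
        Complex.exp (-(β / 2 * ‖exactMap N Λ B + exactField n A‖ ^ 2 : ℝ) -
          Complex.I * (κ * inner ℝ (exactMap N Λ B + exactField n A) (exactMap N Λ k) : ℝ)) := by
    rw [gaussPhase, ← real_inner_self_eq_norm_sq, Submodule.coe_inner, Submodule.coe_inner,
      hshift, coe_exactMap, inner_toLp, inner_toLp]
  simp only [hphase]
  rw [tsum_integral_comp_exactField
      (integrable_exp_exactMeasure hβ κ (exactMap N Λ k)) (exactMap N Λ B),
    integral_exp_neg_norm_sq_sub_inner hβ, ← real_inner_self_eq_norm_sq, Submodule.coe_inner,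
    coe_exactMap, inner_toLp]

end ExactGaussian

section Flux

variable {N : ℕ} [NeZero N] {Λ Λ' : LatticeKind} {r : ℕ}

/-- The average flux of a form through the coordinate planes, which for a closed integer form is
its period. -/
def flux (α : Form N Λ r ℝ) : Dirs r → ℝ := fun I => (N : ℝ) ^ r * average α I

/-- The constant form with the fluxes `h`. -/
def uniformForm (N : ℕ) (Λ : LatticeKind) (h : Dirs r → ℝ) : Form N Λ r ℝ :=
  constForm N Λ fun I => h I / (N : ℝ) ^ r

omit [NeZero N] in
theorem latD_uniformForm (h : Dirs r → ℝ) : latD (uniformForm N Λ h) = 0 := latD_constForm _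

theorem flux_add (α β : Form N Λ r ℝ) : flux (α + β) = flux α + flux β := by
  funext I
  simp only [flux, average, Pi.add_apply, Finset.sum_add_distrib]
  ring

theorem flux_smul (a : ℝ) (α : Form N Λ r ℝ) : flux (a • α) = a • flux α := by
  funext I
  simp only [flux, average, Pi.smul_apply, smul_eq_mul, ← Finset.mul_sum]
  ring

theorem flux_latD (A : Form N Λ r ℝ) : flux (latD A) = 0 := by
  funext I
  simp only [flux, average, sum_latD, zero_div, mul_zero, Pi.zero_apply]

theorem flux_realForm {n : Form N Λ (r + 1) ℤ} (hn : latD n = 0) (I : Dirs (r + 1)) :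
    flux (realForm n) I = period n I := by
  rw [flux, average_realForm hn, mul_div_cancel₀]
  exact pow_ne_zero _ (NeZero.ne _)

theorem flux_translate (v : Fin 4 → ZMod N) (α : Form N Λ r ℝ) :
    flux (translate Λ' v α) = flux α := by
  funext I
  rw [flux, flux, average, average]
  congr 2
  exact sum_add_right_eq Λ v fun x => α (x, I)

theorem exists_eq_latD_add_uniformForm {α : Form N Λ (r + 1) ℝ} (hα : latD α = 0) :
    ∃ A : Form N Λ r ℝ, α = latD A + uniformForm N Λ (flux α) := by
  obtain ⟨A, hA⟩ := exists_eq_latD_add_average hα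
  refine ⟨A, hA.trans ?_⟩
  congr 2
  funext I
  exact (mul_div_cancel_left₀ _ (pow_ne_zero _ (NeZero.ne _))).symm

theorem dotForm_latD_add_uniformForm (A : Form N Λ 1 ℝ) (h : Dirs 2 → ℝ) :
    dotForm (latD A + uniformForm N Λ h) (latD A + uniformForm N Λ h) =
      dotForm (latD A) (latD A) + ∑ I, h I ^ 2 := by
  have hmixed : dotForm (latD A) (uniformForm N Λ h) = 0 := dotForm_latD_constForm _ _
  have hconst : dotForm (uniformForm N Λ h) (uniformForm N Λ h) = ∑ I, h I ^ 2 := by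
    have hN : (N : ℝ) ≠ 0 := NeZero.ne _
    rw [uniformForm, dotForm_constForm_constForm, Finset.mul_sum]
    refine Finset.sum_congr rfl fun I _ => ?_
    field_simp
  have hmixed' := (dotForm_comm _ _).trans hmixed
  simp only [← dotFormₗ_apply, map_add, LinearMap.add_apply] at hmixed hmixed' hconst ⊢
  rw [hmixed, hmixed', hconst, add_zero, zero_add]

theorem dotForm_uniformForm_starForm (o : CupOrder) (h k : Dirs 2 → ℝ) :
    dotForm (uniformForm N Λ h) (starForm o (uniformForm N Λ k)) = wedge h k := by
  have hN : (N : ℝ) ≠ 0 := NeZero.ne _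
  rw [uniformForm, uniformForm, dotForm_constForm_starForm]
  simp only [wedge]
  field_simp

theorem dotForm_starForm_of_latD_eq_zero (o : CupOrder) {α β : Form N Λ 2 ℝ}
    (hα : latD α = 0) (hβ : latD β = 0) :
    dotForm α (starForm o β) = wedge (flux α) (flux β) := by
  obtain ⟨A, hA⟩ := exists_eq_latD_add_uniformForm hα
  obtain ⟨B, hB⟩ := exists_eq_latD_add_uniformForm hβ
  have hleft : dotForm (latD A) (starForm o β) = 0 := dotForm_latD_starForm_eq_zero rfl o A hβ
  have hright : dotForm (uniformForm N Λ (flux α)) (starForm o (latD B)) = 0 := by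
    rw [dotForm_starForm_comm rfl]
    exact dotForm_latD_starForm_eq_zero rfl _ B (latD_uniformForm _)
  conv_lhs => rw [hA]
  rw [← dotFormₗ_apply, map_add, LinearMap.add_apply, dotFormₗ_apply, dotFormₗ_apply, hleft,
    zero_add, hB, ← starFormₗ_apply, map_add, ← dotFormₗ_apply, map_add]
  simp only [starFormₗ_apply, dotFormₗ_apply]
  rw [hright, zero_add, dotForm_uniformForm_starForm, ← hB]

end Flux

section Projection

variable {N : ℕ} [NeZero N] {Λ Λ' : LatticeKind}

theorem exists_projBdry_eq_latBdry (α : Form N Λ 2 ℝ) : ∃ q, projBdry α = latBdry q := by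
  have hspan : Submodule.span ℝ (Set.range fun q : Form N Λ 3 ℝ =>
        (WithLp.toLp 2 (latBdry q) : EuclideanSpace ℝ (Cell N Λ 2))) ≤
      LinearMap.range ((WithLp.linearEquiv 2 ℝ (Form N Λ 2 ℝ)).symm.toLinearMap ∘ₗ
        latBdryₗ (N := N) (Λ := Λ) (r := 2)) := by
    rw [Submodule.span_le]
    rintro _ ⟨q, rfl⟩
    exact ⟨q, rfl⟩
  obtain ⟨q, hq⟩ := hspan (Submodule.starProjection_apply_mem _ (WithLp.toLp 2 α))
  exact ⟨q, (congrArg WithLp.ofLp hq).symm⟩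

theorem eq_zero_of_dotForm_self {r : ℕ} {α : Form N Λ r ℝ} (h : dotForm α α = 0) : α = 0 :=
  dotProduct_self_eq_zero.1 h

theorem dotForm_projBdry_of_latD_eq_zero (α : Form N Λ 2 ℝ) {G : Form N Λ 2 ℝ}
    (hG : latD G = 0) : dotForm (projBdry α) G = 0 := by
  obtain ⟨q, hq⟩ := exists_projBdry_eq_latBdry α
  rw [hq, dotForm_latBdry, hG, ← dotFormₗ_apply, map_zero, mul_zero]

theorem latD_sub_projBdry (α : Form N Λ 2 ℝ) : latD (α - projBdry α) = 0 := by
  have horthogonal := Submodule.sub_starProjection_mem_orthogonal (K := Submodule.span ℝ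
    (Set.range fun q : Form N Λ 3 ℝ =>
      (WithLp.toLp 2 (latBdry q) : EuclideanSpace ℝ (Cell N Λ 2)))) (WithLp.toLp 2 α)
  refine eq_zero_of_dotForm_self ?_
  have hself := dotForm_latBdry (latD (α - projBdry α)) (α - projBdry α)
  rw [← inner_toLp] at hself
  rw [← neg_eq_zero, ← neg_one_mul, ← (Submodule.mem_orthogonal _ _).1 horthogonal _
    (Submodule.subset_span ⟨latD (α - projBdry α), rfl⟩)]
  exact (hself.trans (by norm_num)).symm

theorem latD_projBdry (α : Form N Λ 2 ℝ) : latD (projBdry α) = latD α := by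
  have h := latD_sub_projBdry α
  rw [← latDₗ_apply, map_sub, sub_eq_zero] at h
  exact h.symm

theorem projBdry_eq_of_latD_sub_eq_zero {α : Form N Λ 2 ℝ} (q : Form N Λ 3 ℝ)
    (h : latD (α - latBdry q) = 0) : projBdry α = latBdry q := by
  have hα := latD_projBdry α
  obtain ⟨q', hq'⟩ := exists_projBdry_eq_latBdry α
  have hclosed : latD (latBdry (q' - q)) = 0 := by
    rw [hq'] at hα
    simp only [← latDₗ_apply, ← latBdryₗ_apply, map_sub] at h hα ⊢
    rw [hα, h]
  have hzero : latBdry (q' - q) = 0 := eq_zero_of_dotForm_self <| by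
    rw [dotForm_latBdry, hclosed, ← dotFormₗ_apply, map_zero, mul_zero]
  rw [hq', ← sub_eq_zero]
  simpa only [← latBdryₗ_apply, map_sub] using hzero

theorem projBdry_translate (v : Fin 4 → ZMod N) (α : Form N Λ 2 ℝ) :
    projBdry (translate Λ' v α) = translate Λ' v (projBdry α) := by
  obtain ⟨q, hq⟩ := exists_projBdry_eq_latBdry α
  have hsub : translate Λ' v (α - projBdry α) =
      translate Λ' v α - latBdry (translate Λ' v q) := by
    rw [hq, latBdry_translate]
    rfl
  have hclosed : latD (translate Λ' v (α - projBdry α)) = 0 :=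
    latD_translate_eq_zero v (latD_sub_projBdry α)
  rw [hsub] at hclosed
  rw [projBdry_eq_of_latD_sub_eq_zero _ hclosed, latBdry_translate, hq]

theorem exists_starForm_projBdry_eq_latD (o : CupOrder) (α : Form N Λ 2 ℝ) :
    ∃ k : Form N Λ 1 ℝ, starForm o (projBdry α) = latD k := by
  obtain ⟨q, hq⟩ := exists_projBdry_eq_latBdry α
  refine ⟨(-o.sign : ℝ) • starForm o q, ?_⟩
  rw [hq, starForm_latBdry rfl, ← latDₗ_apply, ← latDₗ_apply, map_smul]

theorem dotForm_projBdry_starForm_projBdry (o : CupOrder) (α : Form N Λ 2 ℝ) :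
    dotForm (projBdry α) (starForm o (projBdry α)) = 0 := by
  obtain ⟨k, hk⟩ := exists_starForm_projBdry_eq_latD o α
  rw [hk, dotForm_projBdry_of_latD_eq_zero α (latD_latD k)]

theorem dotForm_constForm_starForm_projBdry (o : CupOrder) (h : Dirs 2 → ℝ)
    (α : Form N Λ 2 ℝ) : dotForm (constForm N Λ h) (starForm o (projBdry α)) = 0 := by
  obtain ⟨k, hk⟩ := exists_starForm_projBdry_eq_latD o α
  rw [hk, dotForm_comm, dotForm_latD_constForm]

theorem flux_projBdry (α : Form N Λ 2 ℝ) : flux (projBdry α) = 0 := by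
  funext I
  have h := dotForm_projBdry_of_latD_eq_zero α
    (latD_constForm (N := N) (Λ := Λ) (Pi.single I (1 : ℝ)))
  simp only [dotForm, Fintype.sum_prod_type, constForm, Pi.single_apply, mul_ite, mul_one,
    mul_zero, Finset.sum_ite_eq', Finset.mem_univ, if_true] at h
  rw [flux, average, h, zero_div, mul_zero, Pi.zero_apply]

theorem dotForm_starForm_projBdry_add (o : CupOrder) {G : Form N Λ 2 ℝ} (hG : latD G = 0)
    (α : Form N Λ 2 ℝ) :
    dotForm G (starForm o α) =
      wedge (flux G) (flux α) + dotForm G (starForm o (projBdry α)) := by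
  have hflux : flux α = flux (α - projBdry α) := by
    rw [sub_eq_add_neg, ← neg_one_smul ℝ, flux_add, flux_smul, flux_projBdry, smul_zero, add_zero]
  rw [hflux, ← dotForm_starForm_of_latD_eq_zero o hG (latD_sub_projBdry α), ← starFormₗ_apply,
    ← starFormₗ_apply, ← starFormₗ_apply, ← dotFormₗ_apply, ← dotFormₗ_apply, ← dotFormₗ_apply,
    ← map_add, ← map_add, sub_add_cancel]

theorem uNumber_translate (v : Fin 4 → ZMod N) (ℓ : Form N Λ 2 ℤ) :
    uNumber (translate Λ' v ℓ) = uNumber ℓ := by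
  rw [uNumber, realForm_translate, projBdry_translate, latD_translate, cupOne_translate,
    latSum_translate, uNumber]

end Projection

section Pontryagin

variable {N : ℕ} [NeZero N] {Λ Λ' : LatticeKind}

theorem pontryagin_translate (v : Fin 4 → ZMod N) (ℓ : Form N Λ 2 ℤ) :
    pontryagin (translate Λ' v ℓ) = pontryagin ℓ := by
  rw [pontryagin, latD_translate, cup_translate, cupOne_translate]
  exact latSum_translate v (cup ℓ ℓ + cupOne ℓ (latD ℓ))

theorem dotForm_starForm_realForm (o : CupOrder) (α β : Form N Λ 2 ℤ) :
    dotForm (realForm α) (starForm o (realForm β)) = (dotForm α (starForm o β) : ℤ) := by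
  cases o
  · rw [← latSum_cup_two, ← latSum_cup_two, ← realForm_cup, latSum_realForm]
  · rw [dotForm_starForm_comm rfl, dotForm_starForm_comm rfl _ α, CupOrder.swap, ← latSum_cup_two,
      ← latSum_cup_two, ← realForm_cup, latSum_realForm]

theorem latSum_cup_self_of_latD_eq_zero {n : Form N Λ 2 ℤ} (hn : latD n = 0) :
    latSum (cup n n) = wedge (period n) (period n) := by
  have hn' := latD_realForm_eq_zero hn
  have hreal := dotForm_starForm_of_latD_eq_zero .forward hn' hn'
  rw [dotForm_starForm_realForm, ← latSum_cup_two] at hreal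
  have hcast : ((latSum (cup n n) : ℤ) : ℝ) = (wedge (period n) (period n) : ℤ) := by
    simp only [hreal, wedge, flux_realForm hn, Int.cast_add, Int.cast_sub, Int.cast_mul]
  exact_mod_cast hcast

theorem even_wedge_self (h : Dirs 2 → ℤ) : Even (wedge h h) :=
  ⟨h (dir2 0 1) * h (dir2 2 3) - h (dir2 0 2) * h (dir2 1 3) + h (dir2 0 3) * h (dir2 1 2), by
    rw [wedge]; ring⟩

theorem exists_pontryagin_smul_add {n : Form N Λ 2 ℤ} (hn : latD n = 0) (q : ℤ)
    (ℓ : Form N Λ 2 ℤ) : ∃ z : ℤ, pontryagin (q • ℓ + n) = q ^ 2 * pontryagin ℓ + 2 * z := by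
  obtain ⟨y, hy⟩ := even_wedge_self (period n)
  rw [← latSum_cup_self_of_latD_eq_zero hn] at hy
  refine ⟨q * latSum (cup n ℓ) + y, ?_⟩
  have hd : latD (q • ℓ + n) = q • latD ℓ := by
    simp only [← latDₗ_apply, map_add, map_smul] at hn ⊢
    rw [hn, add_zero]
  have hcupOne := latSum_cupOne_latD hn ℓ
  simp only [pontryagin, hd]
  simp only [← latSumₗ_apply, ← cupₗ_apply, ← cupOneₗ_apply, map_add, LinearMap.add_apply,
    map_smul, LinearMap.smul_apply, smul_eq_mul] at hcupOne hy ⊢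
  rw [hcupOne, hy]
  ring

end Pontryagin

section Splitting

variable {N : ℕ} [NeZero N] {Λ : LatticeKind}

/-- The fluctuating part of a form, which is what remains when the uniform form with the same
fluxes is removed. -/
def fluctuation (G : Form N Λ 2 ℝ) : Form N Λ 2 ℝ := G - uniformForm N Λ (flux G)

theorem dotForm_self_eq_fluctuation_add_flux {G : Form N Λ 2 ℝ} (hG : latD G = 0) :
    dotForm G G = dotForm (fluctuation G) (fluctuation G) + ∑ I, flux G I ^ 2 := by
  obtain ⟨A, hA⟩ := exists_eq_latD_add_uniformForm hG
  have hfluctuation : fluctuation G = latD A := sub_eq_iff_eq_add.2 hA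
  rw [hfluctuation]
  conv_lhs => rw [hA]
  exact dotForm_latD_add_uniformForm A _

theorem dotForm_fluctuation_starForm_projBdry (o : CupOrder) (G α : Form N Λ 2 ℝ) :
    dotForm (fluctuation G) (starForm o (projBdry α)) = dotForm G (starForm o (projBdry α)) := by
  rw [fluctuation, ← dotFormₗ_apply, map_sub, LinearMap.sub_apply, dotFormₗ_apply, dotFormₗ_apply,
    uniformForm, dotForm_constForm_starForm_projBdry, sub_zero]

theorem dotForm_add_smul_projBdry {G : Form N Λ 2 ℝ} (hG : latD G = 0) (s : ℝ)
    (α : Form N Λ 2 ℝ) :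
    dotForm (G + s • projBdry α) (G + s • projBdry α) =
      dotForm G G + s ^ 2 * dotForm (projBdry α) (projBdry α) := by
  have hmixed := dotForm_projBdry_of_latD_eq_zero α hG
  have hmixed' := (dotForm_comm _ _).trans hmixed
  simp only [← dotFormₗ_apply, map_add, map_smul, LinearMap.add_apply, LinearMap.smul_apply,
    smul_eq_mul] at hmixed hmixed' ⊢
  rw [hmixed, hmixed']
  ring

theorem latSum_cup_add_cupOne_smul_projBdry (o : CupOrder) {G : Form N Λ 2 ℝ} (hG : latD G = 0)
    (s : ℝ) (ℓ : Form N Λ 2 ℤ) :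
    latSum (cup (G + s • projBdry (realForm ℓ)) (G + s • projBdry (realForm ℓ))) +
        o.sign * latSum (cupOne (G + s • projBdry (realForm ℓ))
          (latD (s • projBdry (realForm ℓ)))) =
      wedge (flux G) (flux G) + 2 * s * dotForm G (starForm o (projBdry (realForm ℓ))) +
        o.sign * s ^ 2 * uNumber ℓ := by
  rw [latSum_cup_add_cupOne o hG, latSum_cup_two, latSum_cup_two,
    dotForm_starForm_of_latD_eq_zero .forward hG hG]
  have hself := dotForm_projBdry_starForm_projBdry .forward (realForm ℓ)
  simp only [uNumber, ← dotFormₗ_apply, ← starFormₗ_apply, ← latSumₗ_apply, ← cupOneₗ_apply,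
    ← latDₗ_apply, map_smul, LinearMap.smul_apply, smul_eq_mul] at hself ⊢
  rw [hself]
  ring

/-- The topological charge of `W` for the forward and of `W̃` for the reversed cup product. -/
def charge (o : CupOrder) (A : Form N Λ 1 ℝ) (n : Form N Λ 2 ℤ) : ℝ :=
  1 / (8 * Real.pi ^ 2) * latSum (cup (fieldStrength A n) (fieldStrength A n)) +
    o.sign * (1 / (4 * Real.pi) * latSum (cupOne (fieldStrength A n) (latD (realForm n))))

/-- The Gaussian weight of the field strength with the phase `φ`. -/
def phaseWeight (β : ℝ) (φ : Form N Λ 1 ℝ → Form N Λ 2 ℤ → ℝ) (A : Form N Λ 1 ℝ)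
    (n : Form N Λ 2 ℤ) : ℂ :=
  Complex.exp (-(β / 2 * dotForm (fieldStrength A n) (fieldStrength A n) : ℝ)
    - Complex.I * (φ A n : ℝ))

/-- The phase that remains after the integration over the magnetic gauge field, for the electric
charge `qe` and the surface `ℓ`. -/
def surfacePhase (o : CupOrder) (θ : ℝ) (p qe : ℤ) (ℓ : Form N Λ 2 ℤ)
    (A : Form N Λ 1 ℝ) (n : Form N Λ 2 ℤ) : ℝ :=
  θ * charge o A n + p * Real.pi * pontryagin n +
    qe * dotForm (latD A) (starForm o (realForm ℓ))

/-- The closed part `ℓ - P_∂ ℓ` of a surface form. -/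
def closedPart (ℓ : Form N Λ 2 ℤ) : Form N Λ 2 ℝ := realForm ℓ - projBdry (realForm ℓ)

/-- The closed part of the field strength `dA + 2π (qℓ + n)`, where `n` is closed. -/
def closedField (ℓ : Form N Λ 2 ℤ) (q : ℤ) (A : Form N Λ 1 ℝ) (n : Form N Λ 2 ℤ) :
    Form N Λ 2 ℝ :=
  latD A + (2 * Real.pi * q) • closedPart ℓ + (2 * Real.pi) • realForm n

theorem fieldStrength_smul_add (ℓ : Form N Λ 2 ℤ) (q : ℤ) (A : Form N Λ 1 ℝ)
    (n : Form N Λ 2 ℤ) :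
    fieldStrength A (q • ℓ + n) =
      closedField ℓ q A n + (2 * Real.pi * q) • projBdry (realForm ℓ) := by
  rw [fieldStrength, closedField, closedPart, realForm_add, realForm_smul]
  module

theorem flux_closedPart (ℓ : Form N Λ 2 ℤ) : flux (closedPart ℓ) = flux (realForm ℓ) := by
  rw [closedPart, sub_eq_add_neg, ← neg_one_smul ℝ, flux_add, flux_smul, flux_projBdry, smul_zero,
    add_zero]

section Closed

variable (o : CupOrder) (ℓ : Form N Λ 2 ℤ) (q : ℤ) (A : Form N Λ 1 ℝ) {n : Form N Λ 2 ℤ}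

theorem latD_closedField (hn : latD n = 0) : latD (closedField ℓ q A n) = 0 := by
  have hn' : latD (realForm n) = 0 := latD_realForm_eq_zero hn
  have hℓ : latD (closedPart ℓ) = 0 := latD_sub_projBdry _
  rw [closedField, ← latDₗ_apply, map_add, map_add, map_smul, map_smul, latDₗ_apply, latDₗ_apply,
    latDₗ_apply, latD_latD, hℓ, hn', smul_zero, smul_zero, add_zero, add_zero]

theorem flux_closedField (hn : latD n = 0) :
    flux (closedField ℓ q A n) =
      (2 * Real.pi) • shiftedFlux q (flux (realForm ℓ)) (period n) := by
  rw [closedField, flux_add, flux_add, flux_smul, flux_smul, flux_latD, flux_closedPart]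
  funext I
  simp only [Pi.add_apply, Pi.smul_apply, Pi.zero_apply, smul_eq_mul, flux_realForm hn,
    shiftedFlux]
  ring

theorem charge_smul_add (hn : latD n = 0) :
    charge o A (q • ℓ + n) =
      1 / (8 * Real.pi ^ 2) * wedge (flux (closedField ℓ q A n)) (flux (closedField ℓ q A n)) +
        q / (2 * Real.pi) *
          dotForm (closedField ℓ q A n) (starForm o (projBdry (realForm ℓ))) +
        o.sign * q ^ 2 * uNumber ℓ / 2 := by
  have hG := latD_closedField ℓ q A hn
  have hn' : latD (realForm n) = 0 := latD_realForm_eq_zero hn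
  have hd : latD ((2 * Real.pi * q) • projBdry (realForm ℓ)) =
      (2 * Real.pi) • latD (realForm (q • ℓ + n)) := by
    rw [realForm_add, realForm_smul, ← latDₗ_apply, ← latDₗ_apply, map_add, map_smul, map_smul,
      latDₗ_apply, latDₗ_apply, latDₗ_apply, latD_projBdry, hn', add_zero, smul_smul]
  have hcup := latSum_cup_add_cupOne_smul_projBdry o hG (2 * Real.pi * q) ℓ
  rw [hd, ← fieldStrength_smul_add] at hcup
  simp only [← latSumₗ_apply, ← cupOneₗ_apply, map_smul, smul_eq_mul] at hcup
  simp only [latSumₗ_apply, cupOneₗ_apply] at hcup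
  have hpi := Real.pi_ne_zero
  rw [charge]
  field_simp
  linear_combination 8 * hcup

theorem dotForm_latD_starForm_smul_add (hn : latD n = 0) :
    dotForm (latD A) (starForm o (realForm ℓ)) =
      wedge (flux (closedField ℓ q A n)) (flux (realForm ℓ)) +
        dotForm (closedField ℓ q A n) (starForm o (projBdry (realForm ℓ))) -
        2 * Real.pi * q * dotForm (closedPart ℓ) (starForm o (realForm ℓ)) -
        2 * Real.pi * (dotForm n (starForm o ℓ) : ℤ) := by
  have hA : latD A = closedField ℓ q A n - (2 * Real.pi * q) • closedPart ℓ -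
      (2 * Real.pi) • realForm n := by
    rw [closedField]
    module
  rw [← dotForm_starForm_projBdry_add o (latD_closedField ℓ q A hn), hA,
    ← dotForm_starForm_realForm]
  simp only [← dotFormₗ_apply, map_sub, map_smul, LinearMap.sub_apply, LinearMap.smul_apply,
    smul_eq_mul]

theorem dotForm_fieldStrength_smul_add (hn : latD n = 0) :
    dotForm (fieldStrength A (q • ℓ + n)) (fieldStrength A (q • ℓ + n)) =
      dotForm (fluctuation (closedField ℓ q A n)) (fluctuation (closedField ℓ q A n)) +
        ∑ I, flux (closedField ℓ q A n) I ^ 2 +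
        (2 * Real.pi * q) ^ 2 * dotForm (projBdry (realForm ℓ)) (projBdry (realForm ℓ)) := by
  have hG := latD_closedField ℓ q A hn
  rw [fieldStrength_smul_add, dotForm_add_smul_projBdry hG,
    dotForm_self_eq_fluctuation_add_flux hG]

end Closed

/-- The factor of the weights that depends on the surface form `ℓ` only. -/
def surfaceFactor (o : CupOrder) (β θ : ℝ) (p qe q : ℤ) (ℓ : Form N Λ 2 ℤ) : ℂ :=
  Complex.exp (-(2 * Real.pi ^ 2 * β * q ^ 2 *
        dotForm (projBdry (realForm ℓ)) (projBdry (realForm ℓ)) : ℝ)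
    - Complex.I * (θ * (o.sign * q ^ 2 * uNumber ℓ / 2) : ℝ)
    - Complex.I * (p * Real.pi * (q ^ 2 * pontryagin ℓ) : ℝ)
    + Complex.I * (2 * Real.pi * qe * q *
      dotForm (closedPart ℓ) (starForm o (realForm ℓ)) : ℝ))

omit [NeZero N] in
theorem exp_sub_int_mul_two_pi (z : ℂ) (k : ℤ) :
    Complex.exp (z - Complex.I * (2 * Real.pi * k)) = Complex.exp z := by
  rw [Complex.exp_sub, show Complex.I * (2 * Real.pi * k) = k * (2 * Real.pi * Complex.I) by ring,
    Complex.exp_int_mul_two_pi_mul_I, div_one]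

theorem phaseWeight_surfacePhase_smul_add (o : CupOrder) (β θ : ℝ) (p qe q : ℤ) (ℓ : Form N Λ 2 ℤ)
    (A : Form N Λ 1 ℝ) {n : Form N Λ 2 ℤ} (hn : latD n = 0) :
    phaseWeight β (surfacePhase o θ p qe ℓ) A (q • ℓ + n) =
      surfaceFactor o β θ p qe q ℓ *
        fluxTerm β θ qe q (flux (realForm ℓ)) (period n) *
        gaussPhase β (qe + θ * q / (2 * Real.pi)) (starForm o (projBdry (realForm ℓ)))
          (fluctuation (closedField ℓ q A n)) := by
  obtain ⟨z, hz⟩ := exists_pontryagin_smul_add hn q ℓ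
  have hwedge (x y : Dirs 2 → ℝ) (s : ℝ) : wedge (s • x) y = s * wedge x y := by
    simp only [wedge, Pi.smul_apply, smul_eq_mul]
    ring
  have hwedge' (x : Dirs 2 → ℝ) (s : ℝ) : wedge (s • x) (s • x) = s ^ 2 * wedge x x := by
    simp only [wedge, Pi.smul_apply, smul_eq_mul]
    ring
  rw [phaseWeight, surfacePhase, dotForm_fieldStrength_smul_add ℓ q A hn,
    charge_smul_add o ℓ q A hn, hz, dotForm_latD_starForm_smul_add o ℓ q A hn, gaussPhase,
    dotForm_fluctuation_starForm_projBdry, flux_closedField ℓ q A hn, hwedge', hwedge,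
    surfaceFactor, fluxTerm, ← Complex.exp_add, ← Complex.exp_add,
    ← exp_sub_int_mul_two_pi _ (qe * dotForm n (starForm o ℓ) - p * z)]
  simp only [Pi.smul_apply, smul_eq_mul, mul_pow, ← Finset.mul_sum]
  congr 1
  push_cast
  field_simp
  ring

theorem exists_fluctuation_closedField_eq (ℓ : Form N Λ 2 ℤ) (q : ℤ) {n : Form N Λ 2 ℤ}
    (hn : latD n = 0) :
    ∃ B : Form N Λ 1 ℝ, ∀ (A : Form N Λ 1 ℝ) (k : exactInt N Λ),
      fluctuation (closedField ℓ q A (n + k)) = fieldStrength A k + latD B := by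
  obtain ⟨B, hB⟩ := exists_eq_latD_add_uniformForm (latD_closedField ℓ q 0 hn)
  refine ⟨B, fun A k => ?_⟩
  have hsplit : closedField ℓ q A (n + k) = fieldStrength A k + closedField ℓ q 0 n := by
    rw [closedField, closedField, fieldStrength, realForm_add, ← latDₗ_apply 0, map_zero]
    module
  have hflux : flux (closedField ℓ q A (n + k)) = flux (closedField ℓ q 0 n) := by
    rw [hsplit, fieldStrength, ← latD_potential, ← latDₗ_apply, ← latDₗ_apply, ← map_smul,
      ← map_add, latDₗ_apply, flux_add, flux_latD, zero_add]
  rw [fluctuation, hflux, hsplit, add_sub_assoc, sub_eq_iff_eq_add.2 hB]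

end Splitting

section MagneticField

variable {N : ℕ} [NeZero N] {Λ : LatticeKind}

theorem norm_phaseWeight (β : ℝ) (φ : Form N Λ 1 ℝ → Form N Λ 2 ℤ → ℝ) (A : Form N Λ 1 ℝ)
    (n : Form N Λ 2 ℤ) : ‖phaseWeight β φ A n‖ =
      Real.exp (-(β / 2 * dotForm (fieldStrength A n) (fieldStrength A n))) :=
  norm_exp_neg_sub_I_mul _ _

theorem continuous_phaseWeight {X : Type*} [TopologicalSpace X] (β : ℝ)
    {φ : X → Form N Λ 1 ℝ → Form N Λ 2 ℤ → ℝ} {A : X → Form N Λ 1 ℝ} {n : Form N Λ 2 ℤ}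
    (hA : Continuous A) (hφ : Continuous fun x => φ x (A x) n) :
    Continuous fun x => phaseWeight β (φ x) (A x) n := by
  have haction : Continuous fun x =>
      β / 2 * dotForm (fieldStrength (A x) n) (fieldStrength (A x) n) := by fun_prop
  exact Complex.continuous_exp.comp ((Complex.continuous_ofReal.comp haction).neg.sub
    (continuous_const.mul (Complex.continuous_ofReal.comp hφ)))

theorem pathIntegrable_phaseWeight {β : ℝ} (hβ : 0 < β)
    {φ : Form N Λ 3 ℝ → Form N Λ 1 ℝ → Form N Λ 2 ℤ → ℝ}
    (hφ : ∀ n, Continuous fun q : Form N Λ 1 ℝ × Form N Λ 3 ℝ => φ q.2 q.1 n) :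
    PathIntegrable fun A Am => phaseWeight β (φ Am) A := by
  obtain ⟨g, hg, hle⟩ := exists_summable_exp_fieldStrength_le (N := N) (Λ := Λ) hβ
  have hgi : Integrable g (Measure.count : Measure (Form N Λ 2 ℤ)) :=
    integrable_count_iff.2 hg.norm
  refine (hgi.comp_snd ((gaugeMeasure N Λ 1).prod (gaugeMeasure N Λ 3))).mono' ?_ ?_
  · exact (measurable_from_prod_countable_left fun n =>
      (continuous_phaseWeight β continuous_fst (hφ n)).measurable).aestronglyMeasurable
  · filter_upwards [Measure.quasiMeasurePreserving_fst.ae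
      (Measure.quasiMeasurePreserving_fst.ae (ae_abs_le_pi 1))] with q hq
    exact (norm_phaseWeight ..).trans_le (hle q.1.1 hq q.2)

theorem norm_integral_phaseWeight_le {β : ℝ} (φ : Form N Λ 1 ℝ → Form N Λ 2 ℤ → ℝ)
    {g : Form N Λ 2 ℤ → ℝ} (hle : ∀ A : Form N Λ 1 ℝ, (∀ c, |A c| ≤ Real.pi) → ∀ n,
      Real.exp (-(β / 2 * dotForm (fieldStrength A n) (fieldStrength A n))) ≤ g n)
    (n : Form N Λ 2 ℤ) : ‖∫ A, phaseWeight β φ A n ∂(gaugeMeasure N Λ 1)‖ ≤ g n := by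
  refine (norm_integral_le_of_norm_le_const (C := g n) ?_).trans (by simp)
  filter_upwards [ae_abs_le_pi 1] with A hA
  exact (norm_phaseWeight ..).trans_le (hle A hA n)

theorem summable_integral_phaseWeight {β : ℝ} (hβ : 0 < β)
    (φ : Form N Λ 1 ℝ → Form N Λ 2 ℤ → ℝ) :
    Summable fun n => ∫ A, phaseWeight β φ A n ∂(gaugeMeasure N Λ 1) := by
  obtain ⟨g, hg, hle⟩ := exists_summable_exp_fieldStrength_le (N := N) (Λ := Λ) hβ
  exact .of_norm_bounded hg (norm_integral_phaseWeight_le φ hle)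

/-- The weight `phaseWeight β φ` coupled to the magnetic gauge field, in the presence of the
magnetic current `j`. -/
def magneticWeight (β : ℝ) (φ : Form N Λ 1 ℝ → Form N Λ 2 ℤ → ℝ) (j : Form N Λ 3 ℤ)
    (A : Form N Λ 1 ℝ) (Am : Form N Λ 3 ℝ) (n : Form N Λ 2 ℤ) : ℂ :=
  phaseWeight β (fun A n => φ A n + dotForm (realForm (latD n - j)) Am) A n

theorem magneticWeight_eq_mul (β : ℝ) (φ : Form N Λ 1 ℝ → Form N Λ 2 ℤ → ℝ) (j : Form N Λ 3 ℤ)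
    (A : Form N Λ 1 ℝ) (Am : Form N Λ 3 ℝ) (n : Form N Λ 2 ℤ) :
    magneticWeight β φ j A Am n = phaseWeight β φ A n *
      Complex.exp (-(Complex.I * (dotForm (realForm (latD n - j)) Am : ℝ))) := by
  rw [magneticWeight, phaseWeight, phaseWeight, ← Complex.exp_add]
  congr 1
  push_cast
  ring

theorem integral_tsum_magneticWeight {β : ℝ} (hβ : 0 < β)
    (φ : Form N Λ 1 ℝ → Form N Λ 2 ℤ → ℝ) (j : Form N Λ 3 ℤ) {A : Form N Λ 1 ℝ}
    (hA : ∀ c, |A c| ≤ Real.pi) :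
    ∫ Am, ∑' n, magneticWeight β φ j A Am n ∂(gaugeMeasure N Λ 3) =
      ∑' n : {n : Form N Λ 2 ℤ // latD n = j}, phaseWeight β φ A n := by
  obtain ⟨g, hg, hle⟩ := exists_summable_exp_fieldStrength_le (N := N) (Λ := Λ) hβ
  have hfourier (n : Form N Λ 2 ℤ) :
      ∫ Am, Complex.exp (-(Complex.I * (dotForm (realForm (latD n - j)) Am : ℝ)))
        ∂(gaugeMeasure N Λ 3) = if latD n - j = 0 then 1 else 0 :=
    integral_pi_angleMeasure_exp (latD n - j)
  have hcontinuous (n : Form N Λ 2 ℤ) : Continuous fun Am => magneticWeight β φ j A Am n :=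
    continuous_phaseWeight β continuous_const (by fun_prop)
  rw [integral_tsum_of_norm_le (fun n => (hcontinuous n).aestronglyMeasurable)
    (fun n => .of_forall fun Am => (norm_phaseWeight ..).trans_le (hle A hA n)) hg]
  refine Eq.trans (tsum_congr fun n => ?_) (tsum_subtype {n | latD n = j} (phaseWeight β φ A)).symm
  simp only [magneticWeight_eq_mul]
  rw [integral_const_mul, hfourier]
  by_cases hn : latD n = j <;> simp [hn, sub_eq_zero]

theorem pathIntegral_magneticWeight {β : ℝ} (hβ : 0 < β)
    {φ : Form N Λ 1 ℝ → Form N Λ 2 ℤ → ℝ} (hφ : ∀ n, Continuous fun A => φ A n)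
    (j : Form N Λ 3 ℤ) :
    pathIntegral (magneticWeight β φ j) =
      ∑' n : {n : Form N Λ 2 ℤ // latD n = j}, ∫ A, phaseWeight β φ A n ∂(gaugeMeasure N Λ 1) := by
  obtain ⟨g, hg, hle⟩ := exists_summable_exp_fieldStrength_le (N := N) (Λ := Λ) hβ
  have hmagnetic : ∀ᵐ A ∂(gaugeMeasure N Λ 1),
      ∫ Am, ∑' n, magneticWeight β φ j A Am n ∂(gaugeMeasure N Λ 3) =
        ∑' n : {n : Form N Λ 2 ℤ // latD n = j}, phaseWeight β φ A n := by
    filter_upwards [ae_abs_le_pi 1] with A hA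
    exact integral_tsum_magneticWeight hβ φ j hA
  rw [pathIntegral, integral_congr_ae hmagnetic]
  refine integral_tsum_of_norm_le
    (fun n => (continuous_phaseWeight β continuous_id (hφ n)).aestronglyMeasurable) (fun n => ?_)
    (hg.subtype {n | latD n = j})
  filter_upwards [ae_abs_le_pi 1] with A hA
  exact (norm_phaseWeight ..).trans_le (hle A hA n)

end MagneticField

section Evaluation

variable {N : ℕ} [NeZero N] {Λ : LatticeKind}

omit [NeZero N] in
theorem latD_eq_zero_of_mem_exactInt {n : Form N Λ 2 ℤ} (hn : n ∈ exactInt N Λ) : latD n = 0 := by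
  obtain ⟨A, hA⟩ := hn
  refine realForm_injective ?_
  rw [realForm_latD, hA, latD_latD]
  funext c
  simp [realForm]

theorem mem_exactInt_iff_period_eq_zero {n : Form N Λ 2 ℤ} (hn : latD n = 0) :
    n ∈ exactInt N Λ ↔ period n = 0 := by
  refine ⟨fun ⟨A, hA⟩ => ?_, fun hperiod => ?_⟩
  · funext I
    have hflux := flux_realForm hn I
    rw [hA, flux_latD, Pi.zero_apply] at hflux
    exact_mod_cast hflux.symm
  · have hflux : flux (realForm n) = 0 := by
      funext I
      rw [flux_realForm hn, hperiod, Pi.zero_apply, Pi.zero_apply, Int.cast_zero]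
    obtain ⟨A, hA⟩ := exists_eq_latD_add_uniformForm (latD_realForm_eq_zero hn)
    refine ⟨A, hA.trans ?_⟩
    rw [hflux]
    funext c
    simp [uniformForm, constForm]

theorem sub_fluxForm_mem_exactInt {n : Form N Λ 2 ℤ} (hn : latD n = 0) :
    n - fluxForm N Λ (period n) ∈ exactInt N Λ := by
  have hclosed : latD (n - fluxForm N Λ (period n)) = 0 := by
    rw [← latDₗ_apply, map_sub, latDₗ_apply, latDₗ_apply, hn, latD_fluxForm, sub_zero]
  have hperiod := period_add (n - fluxForm N Λ (period n)) (fluxForm N Λ (period n))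
  rw [sub_add_cancel, period_fluxForm] at hperiod
  exact (mem_exactInt_iff_period_eq_zero hclosed).2 (right_eq_add.1 hperiod)

omit [NeZero N] in
theorem latD_fluxForm_add (m : Dirs 2 → ℤ) (k : exactInt N Λ) :
    latD (fluxForm N Λ m + (k : Form N Λ 2 ℤ)) = 0 := by
  rw [← latDₗ_apply, map_add, latDₗ_apply, latDₗ_apply, latD_fluxForm,
    latD_eq_zero_of_mem_exactInt k.2, add_zero]

theorem period_fluxForm_add (m : Dirs 2 → ℤ) (k : exactInt N Λ) :
    period (fluxForm N Λ m + (k : Form N Λ 2 ℤ)) = m := by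
  rw [period_add, period_fluxForm,
    (mem_exactInt_iff_period_eq_zero (latD_eq_zero_of_mem_exactInt k.2)).1 k.2, add_zero]

omit [NeZero N] in
theorem latD_sub_smul {q : ℤ} {ℓ n : Form N Λ 2 ℤ} (hn : latD n = q • latD ℓ) :
    latD (n - q • ℓ) = 0 := by
  rw [← latDₗ_apply, map_sub, map_smul, latDₗ_apply, latDₗ_apply, hn, sub_self]

/-- The integer forms `n` with `dn = q dℓ`, parametrized by the fluxes and an exact form. -/
def fluxDecomposition (q : ℤ) (ℓ : Form N Λ 2 ℤ) :
    (Dirs 2 → ℤ) × exactInt N Λ ≃ {n : Form N Λ 2 ℤ // latD n = q • latD ℓ} where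
  toFun a := ⟨q • ℓ + (fluxForm N Λ a.1 + a.2), by
    rw [← latDₗ_apply, map_add, map_smul, latDₗ_apply, latDₗ_apply, latD_fluxForm_add, add_zero]⟩
  invFun n := (period (n.1 - q • ℓ), ⟨_, sub_fluxForm_mem_exactInt (latD_sub_smul n.2)⟩)
  left_inv a := by
    refine Prod.ext ?_ (Subtype.ext ?_) <;>
      simp only [add_sub_cancel_left, period_fluxForm_add]
  right_inv n := Subtype.ext (by simp only [add_sub_cancel])

@[fun_prop]
theorem continuous_charge (o : CupOrder) (n : Form N Λ 2 ℤ) :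
    Continuous fun A : Form N Λ 1 ℝ => charge o A n := by
  unfold charge
  fun_prop

theorem continuous_surfacePhase (o : CupOrder) (θ : ℝ) (p qe : ℤ) (ℓ n : Form N Λ 2 ℤ) :
    Continuous fun A => surfacePhase o θ p qe ℓ A n := by
  unfold surfacePhase
  fun_prop

theorem tsum_integral_surfacePhase {β : ℝ} (hβ : 0 < β) (o : CupOrder) (θ : ℝ) (p qe q : ℤ)
    (ℓ : Form N Λ 2 ℤ) (m : Dirs 2 → ℤ) :
    ∑' k : exactInt N Λ, ∫ A, phaseWeight β (surfacePhase o θ p qe ℓ) A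
        (q • ℓ + (fluxForm N Λ m + k)) ∂(gaugeMeasure N Λ 1) =
      surfaceFactor o β θ p qe q ℓ * fluxTerm β θ qe q (flux (realForm ℓ)) m *
        (gaussConst (exactMeasure N Λ) β *
          Complex.exp (-((qe + θ * q / (2 * Real.pi)) ^ 2 / (2 * β) *
            dotForm (projBdry (realForm ℓ)) (projBdry (realForm ℓ)) : ℝ))) := by
  obtain ⟨a, ha⟩ := exists_starForm_projBdry_eq_latD o (realForm ℓ)
  obtain ⟨B, hB⟩ := exists_fluctuation_closedField_eq ℓ q (latD_fluxForm (N := N) (Λ := Λ) m)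
  simp only [phaseWeight_surfacePhase_smul_add o β θ p qe q ℓ _ (latD_fluxForm_add m _), hB,
    period_fluxForm_add, integral_const_mul, tsum_mul_left]
  rw [ha, tsum_integral_gaussPhase hβ, ← ha, dotForm_starForm_starForm rfl]

/-- The contribution of the surface `ℓ` to the path integral, apart from the sum over the fluxes:
`surfaceFactor` times the Fourier transform of the Gaussian on the exact forms. -/
def surfaceWeight (o : CupOrder) (β θ : ℝ) (p qe q : ℤ) (ℓ : Form N Λ 2 ℤ) : ℂ :=
  Complex.exp (-((qe + θ * q / (2 * Real.pi)) ^ 2 / (2 * β) *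
      dotForm (projBdry (realForm ℓ)) (projBdry (realForm ℓ)) : ℝ)) *
    surfaceFactor o β θ p qe q ℓ

theorem pathIntegral_surfacePhase {β : ℝ} (hβ : 0 < β) (o : CupOrder) (θ : ℝ) (p qe q : ℤ)
    (ℓ : Form N Λ 2 ℤ) :
    pathIntegral (magneticWeight β (surfacePhase o θ p qe ℓ) (q • latD ℓ)) =
      gaussConst (exactMeasure N Λ) β * surfaceWeight o β θ p qe q ℓ *
        fluxSum β θ qe q (flux (realForm ℓ)) := by
  have hsummable : Summable fun a : (Dirs 2 → ℤ) × exactInt N Λ =>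
      ∫ A, phaseWeight β (surfacePhase o θ p qe ℓ) A (fluxDecomposition q ℓ a)
        ∂(gaugeMeasure N Λ 1) :=
    (summable_integral_phaseWeight hβ _).comp_injective
      (Subtype.val_injective.comp (fluxDecomposition q ℓ).injective)
  rw [pathIntegral_magneticWeight hβ (continuous_surfacePhase o θ p qe ℓ),
    ← (fluxDecomposition q ℓ).tsum_eq, hsummable.tsum_prod, fluxSum, ← tsum_mul_left,
    surfaceWeight]
  refine tsum_congr fun m => (tsum_integral_surfacePhase hβ o θ p qe q ℓ m).trans ?_
  ring

end Evaluation

section Currents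

variable {N : ℕ} {Λ : LatticeKind}

theorem starForm_reversed_translate {R : Type} [CommRing R] (Λ' : LatticeKind) {p q : ℕ}
    (h : p + q = 4) (β : Form N Λ q R) :
    (starForm .reversed (translate Λ' (dirVec N Finset.univ) β) : Form N Λ' p R) =
      ((-1) ^ (p * q) : R) • translate Λ' 0 (starForm .forward β) := by
  funext ⟨x, I⟩
  have hI : dirVec N Finset.univ = dirVec N I.1 + dirVec N I.1ᶜ := by
    rw [← dirVec_union N disjoint_compl_right, Finset.union_compl]
  have hcard : I.1ᶜ.card = q := by
    have := Finset.card_add_card_compl I.1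
    simp only [I.2, Fintype.card_fin] at this
    lia
  have hsite : x - dirVec N I.1ᶜ + dirVec N Finset.univ = x + dirVec N I.1 := by
    rw [hI]
    abel
  simp only [starForm, translate, Pi.smul_apply, smul_eq_mul, component, add_zero, hsite,
    shuffleSign_comm (disjoint_compl_left (a := I.1)), hcard, I.2, mul_comm q p]
  push_cast
  ring

/-- The surface form on the dual lattice. -/
def dualSurface (ℓ : Form N .primal 2 ℤ) : Form N .dual 2 ℤ :=
  translate .dual (dirVec N Finset.univ) ℓ

theorem IsSurfaceForm.tangent_eq_neg_latBdry {γ : Contour N Λ} {ℓ : Form N Λ 2 ℤ}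
    (hℓ : IsSurfaceForm γ ℓ) :
    realForm γ.tangent = -latBdry (starForm .forward (realForm ℓ)) := by
  funext ⟨x, I⟩
  have hcard : I.1ᶜ.card = 3 := by
    rw [Finset.card_compl, Fintype.card_fin, I.2]
  rw [latBdry_starForm (q := 2) rfl, ← realForm_latD]
  simp only [starForm, component, dif_pos hcard, realForm, CupOrder.sign, Int.cast_one, one_smul,
    Pi.neg_apply]
  exact_mod_cast (neg_eq_iff_eq_neg.2 (hℓ x I ⟨I.1ᶜ, hcard⟩ disjoint_compl_right)).symm

theorem IsSurfaceForm.toDual_tangent_eq_neg_latBdry {γ : Contour N .primal}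
    {ℓ : Form N .primal 2 ℤ} (hℓ : IsSurfaceForm γ ℓ) :
    realForm γ.toDual.tangent = -latBdry (starForm .reversed (realForm (dualSurface ℓ))) := by
  rw [dualSurface, realForm_translate, starForm_reversed_translate .dual rfl,
    Even.neg_one_pow (by decide), one_smul, latBdry_translate]
  funext ⟨x, I⟩
  simp only [Pi.neg_apply, translate, add_zero]
  exact congrFun hℓ.tangent_eq_neg_latBdry (x, I)

end Currents

section LoopWeights

variable {N : ℕ} [NeZero N] {Λ : LatticeKind}

theorem topCharge_eq_charge (A : Form N Λ 1 ℝ) (n : Form N Λ 2 ℤ) :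
    topCharge A n = charge .forward A n := by
  rw [topCharge, charge, CupOrder.sign, Int.cast_one, one_mul]

theorem topChargeDual_eq_charge (A : Form N Λ 1 ℝ) (n : Form N Λ 2 ℤ) :
    topChargeDual A n = charge .reversed A n := by
  rw [topChargeDual, charge, CupOrder.sign, Int.cast_neg, Int.cast_one, neg_one_mul,
    sub_eq_add_neg]

theorem dotForm_latBdry_fieldStrength (A : Form N Λ 1 ℝ) (Am : Form N Λ 3 ℝ)
    (n : Form N Λ 2 ℤ) : 1 / (2 * Real.pi) * dotForm (latBdry Am) (fieldStrength A n) =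
      -dotForm (realForm (latD n)) Am := by
  have hpi := Real.pi_ne_zero
  have hdF : latD (fieldStrength A n) = (2 * Real.pi) • realForm (latD n) := by
    rw [fieldStrength, ← latDₗ_apply, map_add, map_smul, latDₗ_apply, latDₗ_apply, latD_latD,
      zero_add, realForm_latD]
  rw [dotForm_latBdry, hdF, dotForm_comm, ← dotFormₗ_apply, LinearMap.map_smul₂, dotFormₗ_apply,
    smul_eq_mul]
  field_simp
  norm_num

/-- The phase of the loop with current `t` and charges `qe` and `qm`, up to the sign. It is the
phase of `W_d` for the forward and of `W̃_d` for the reversed cup product. -/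
def loopPhase (o : CupOrder) (θ : ℝ) (p qe qm : ℤ) (t : Form N Λ 1 ℝ) (Am : Form N Λ 3 ℝ)
    (A : Form N Λ 1 ℝ) (n : Form N Λ 2 ℤ) : ℝ :=
  θ * charge o A n + p * Real.pi * pontryagin n + dotForm (realForm (latD n)) Am -
    qe * dotForm t A + o.sign * qm * dotForm t (starForm o Am)

theorem dyonicWeight_eq_phaseWeight (β θ : ℝ) (p qe qm : ℤ) (γ : Contour N Λ) (A : Form N Λ 1 ℝ)
    (Am : Form N Λ 3 ℝ) : dyonicWeight β θ p qe qm γ A Am =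
      phaseWeight β (loopPhase .forward θ p qe qm (realForm γ.tangent) Am) A := by
  funext n
  rw [dyonicWeight, phaseWeight, loopPhase, dotForm_latBdry_fieldStrength, topCharge_eq_charge,
    latSum_cup_one_three, CupOrder.sign, ← Complex.exp_add]
  congr 1
  push_cast
  ring

theorem dualDyonicWeight_eq_phaseWeight (β θ : ℝ) (p qe qm : ℤ) (γ : Contour N Λ)
    (A : Form N Λ 1 ℝ) (Am : Form N Λ 3 ℝ) : dualDyonicWeight β θ p qe qm γ A Am =
      phaseWeight β (loopPhase .reversed θ p qe qm (realForm γ.tangent) Am) A := by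
  funext n
  rw [dualDyonicWeight, phaseWeight, loopPhase, dotForm_latBdry_fieldStrength,
    topChargeDual_eq_charge, latSum_cup_three_one, dotForm_starForm_comm rfl, CupOrder.swap,
    CupOrder.sign, ← Complex.exp_add]
  congr 1
  push_cast
  ring

theorem partitionWeight_eq_magneticWeight (β θ : ℝ) :
    partitionWeight (N := N) (Λ := Λ) β θ =
      magneticWeight β (fun A n => θ * topChargeZero A n) 0 := by
  funext A Am n
  rw [partitionWeight, magneticWeight, phaseWeight, dotForm_latBdry_fieldStrength, sub_zero]
  congr 1
  push_cast
  ring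

theorem loopPhase_neg_latBdry (o : CupOrder) (θ : ℝ) (p qe qm : ℤ) (ℓ : Form N Λ 2 ℤ)
    (Am : Form N Λ 3 ℝ) (A : Form N Λ 1 ℝ) (n : Form N Λ 2 ℤ) :
    loopPhase o θ p qe qm (-latBdry (starForm o (realForm ℓ))) Am A n =
      surfacePhase o θ p qe ℓ A n + dotForm (realForm (latD n - qm • latD ℓ)) Am := by
  have helectric : dotForm (latBdry (starForm o (realForm ℓ))) A =
      dotForm (latD A) (starForm o (realForm ℓ)) := by
    rw [dotForm_latBdry, dotForm_comm]
    norm_num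
  have hmagnetic : o.sign * dotForm (latBdry (starForm o (realForm ℓ)) : Form N Λ 1 ℝ)
      (starForm o Am) = dotForm (realForm (latD ℓ)) Am := by
    have hsign : (o.sign * o.sign : ℝ) = 1 := by cases o <;> norm_num [CupOrder.sign]
    rw [latBdry_starForm (q := 2) rfl, ← dotFormₗ_apply, LinearMap.map_smul₂, dotFormₗ_apply,
      dotForm_starForm_starForm rfl, smul_eq_mul, ← mul_assoc, hsign, one_mul, realForm_latD]
  have hcurrent : dotForm (realForm (latD n - qm • latD ℓ)) Am =
      dotForm (realForm (latD n)) Am - qm * dotForm (realForm (latD ℓ)) Am := by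
    rw [sub_eq_add_neg, realForm_add, realForm_neg, realForm_smul, ← sub_eq_add_neg]
    simp only [← dotFormₗ_apply, map_sub, map_smul, LinearMap.sub_apply, LinearMap.smul_apply,
      smul_eq_mul]
  have hneg (α : Form N Λ 1 ℝ) : dotForm (-latBdry (starForm o (realForm ℓ))) α =
      -dotForm (latBdry (starForm o (realForm ℓ))) α := neg_dotProduct _ _
  rw [loopPhase, surfacePhase, hcurrent, hneg, hneg, helectric, ← hmagnetic]
  ring

theorem dyonicWeight_eq_magneticWeight {γ : Contour N Λ} {ℓ : Form N Λ 2 ℤ}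
    (h : realForm γ.tangent = -latBdry (starForm .forward (realForm ℓ))) (β θ : ℝ)
    (p qe qm : ℤ) : dyonicWeight β θ p qe qm γ =
      magneticWeight β (surfacePhase .forward θ p qe ℓ) (qm • latD ℓ) := by
  funext A Am n
  simp only [dyonicWeight_eq_phaseWeight, magneticWeight, phaseWeight, h, loopPhase_neg_latBdry]

theorem dualDyonicWeight_eq_magneticWeight {γ : Contour N Λ} {ℓ : Form N Λ 2 ℤ}
    (h : realForm γ.tangent = -latBdry (starForm .reversed (realForm ℓ))) (β θ : ℝ)
    (p qe qm : ℤ) : dualDyonicWeight β θ p qe qm γ =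
      magneticWeight β (surfacePhase .reversed θ p qe ℓ) (qm • latD ℓ) := by
  funext A Am n
  simp only [dualDyonicWeight_eq_phaseWeight, magneticWeight, phaseWeight, h,
    loopPhase_neg_latBdry]

end LoopWeights

section Partition

variable {N : ℕ} [NeZero N] {Λ : LatticeKind}

theorem continuous_topChargeZero (n : Form N Λ 2 ℤ) :
    Continuous fun A : Form N Λ 1 ℝ => topChargeZero A n := by
  unfold topChargeZero
  fun_prop

theorem surfacePhase_zero_of_latD_eq_zero (o : CupOrder) (θ : ℝ) (A : Form N Λ 1 ℝ)
    {n : Form N Λ 2 ℤ} (hn : latD n = 0) :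
    surfacePhase o θ 0 0 0 A n = θ * topChargeZero A n := by
  rw [surfacePhase, charge, topChargeZero, latD_realForm_eq_zero hn, ← cupOneₗ_apply, map_zero,
    ← latSumₗ_apply 0, map_zero]
  push_cast
  ring

omit [NeZero N] in
theorem fluxSum_zero_zero (β θ : ℝ) (η : Dirs 2 → ℝ) :
    fluxSum β θ 0 0 η = fluxSum β θ 0 0 0 := by
  have hshift (m : Dirs 2 → ℤ) : shiftedFlux 0 η m = shiftedFlux 0 0 m := by
    funext I
    simp only [shiftedFlux, zero_mul]
  simp [fluxSum, fluxTerm, hshift]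

theorem partitionFunction_eq_gaussConst_mul_fluxSum {β : ℝ} (hβ : 0 < β) (θ : ℝ) :
    partitionFunction N Λ β θ = gaussConst (exactMeasure N Λ) β * fluxSum β θ 0 0 0 := by
  have hsurface : partitionFunction N Λ β θ = pathIntegral (magneticWeight β
      (surfacePhase .forward θ 0 0 (0 : Form N Λ 2 ℤ)) ((0 : ℤ) • latD (0 : Form N Λ 2 ℤ))) := by
    rw [partitionFunction, partitionWeight_eq_magneticWeight,
      pathIntegral_magneticWeight hβ fun n => (continuous_topChargeZero n).const_mul θ,
      pathIntegral_magneticWeight hβ (continuous_surfacePhase .forward θ 0 0 0), zero_smul]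
    refine tsum_congr fun n => integral_congr_ae (.of_forall fun A => ?_)
    change phaseWeight _ _ _ _ = phaseWeight _ _ _ _
    rw [phaseWeight, phaseWeight, surfacePhase_zero_of_latD_eq_zero _ _ _ n.2]
  rw [hsurface, pathIntegral_surfacePhase hβ, Int.cast_zero, fluxSum_zero_zero _ _ (flux _)]
  simp [surfaceWeight, surfaceFactor]

theorem partitionFunction_ne_zero {β : ℝ} (hβ : 0 < β) (θ : ℝ) :
    partitionFunction N Λ β θ ≠ 0 := by
  rw [partitionFunction_eq_gaussConst_mul_fluxSum hβ]
  exact mul_ne_zero (gaussConst_ne_zero exactMeasure_ne_zero hβ)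
    (fluxSum_zero_zero_ne_zero hβ θ 0)

theorem pathIntegral_surfacePhase_div_partitionFunction {β : ℝ} (hβ : 0 < β) (o : CupOrder)
    (θ : ℝ) (p qe q : ℤ) (ℓ : Form N Λ 2 ℤ) :
    pathIntegral (magneticWeight β (surfacePhase o θ p qe ℓ) (q • latD ℓ)) /
        partitionFunction N Λ β θ =
      surfaceWeight o β θ p qe q ℓ * fluxSum β θ qe q (flux (realForm ℓ)) /
        fluxSum β θ 0 0 0 := by
  have hconst := gaussConst_ne_zero (exactMeasure_ne_zero (N := N) (Λ := Λ)) hβ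
  have hsum := fluxSum_zero_zero_ne_zero hβ θ 0
  rw [pathIntegral_surfacePhase hβ, partitionFunction_eq_gaussConst_mul_fluxSum hβ]
  field_simp

end Partition

section Convergence

variable {N : ℕ} [NeZero N] {Λ : LatticeKind}

theorem continuous_loopPhase (o : CupOrder) (θ : ℝ) (p qe qm : ℤ) (t : Form N Λ 1 ℝ)
    (n : Form N Λ 2 ℤ) : Continuous fun q : Form N Λ 1 ℝ × Form N Λ 3 ℝ =>
      loopPhase o θ p qe qm t q.2 q.1 n := by
  unfold loopPhase
  fun_prop

theorem pathIntegrable_dyonicWeight {β : ℝ} (hβ : 0 < β) (θ : ℝ) (p qe qm : ℤ)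
    (γ : Contour N Λ) : PathIntegrable (dyonicWeight β θ p qe qm γ) := by
  have hweight := funext₂ (dyonicWeight_eq_phaseWeight β θ p qe qm γ)
  rw [hweight]
  exact pathIntegrable_phaseWeight hβ (continuous_loopPhase .forward θ p qe qm _)

theorem pathIntegrable_dualDyonicWeight {β : ℝ} (hβ : 0 < β) (θ : ℝ) (p qe qm : ℤ)
    (γ : Contour N Λ) : PathIntegrable (dualDyonicWeight β θ p qe qm γ) := by
  have hweight := funext₂ (dualDyonicWeight_eq_phaseWeight β θ p qe qm γ)
  rw [hweight]
  exact pathIntegrable_phaseWeight hβ (continuous_loopPhase .reversed θ p qe qm _)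

theorem pathIntegrable_partitionWeight {β : ℝ} (hβ : 0 < β) (θ : ℝ) :
    PathIntegrable (partitionWeight (N := N) (Λ := Λ) β θ) := by
  rw [partitionWeight_eq_magneticWeight]
  exact pathIntegrable_phaseWeight hβ fun n =>
    (((continuous_topChargeZero n).comp continuous_fst).const_mul θ).add (by fun_prop)

end Convergence

section ChargeConjugation

variable {N : ℕ} [NeZero N] {Λ : LatticeKind}

theorem measurePreserving_neg_gaugeMeasure (r : ℕ) :
    MeasurePreserving (MeasurableEquiv.neg (Form N Λ r ℝ)) (gaugeMeasure N Λ r)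
      (gaugeMeasure N Λ r) :=
  measurePreserving_pi (fun _ => angleMeasure) (fun _ => angleMeasure) fun _ =>
    measurePreserving_neg_angleMeasure

theorem pathIntegral_neg (w : Form N Λ 1 ℝ → Form N Λ 3 ℝ → Form N Λ 2 ℤ → ℂ) :
    pathIntegral (fun A Am n => w (-A) (-Am) (-n)) = pathIntegral w := by
  have hsum (A : Form N Λ 1 ℝ) (Am : Form N Λ 3 ℝ) : ∑' n, w A Am (-n) = ∑' n, w A Am n :=
    (Equiv.neg (Form N Λ 2 ℤ)).tsum_eq (w A Am)
  have hmagnetic (A : Form N Λ 1 ℝ) : ∫ Am, ∑' n, w A (-Am) n ∂(gaugeMeasure N Λ 3) =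
      ∫ Am, ∑' n, w A Am n ∂(gaugeMeasure N Λ 3) :=
    (measurePreserving_neg_gaugeMeasure 3).integral_comp' fun Am => ∑' n, w A Am n
  simp only [pathIntegral, hsum, hmagnetic]
  exact (measurePreserving_neg_gaugeMeasure 1).integral_comp'
    fun A => ∫ Am, ∑' n, w A Am n ∂(gaugeMeasure N Λ 3)

omit [NeZero N] in
theorem fieldStrength_neg (A : Form N Λ 1 ℝ) (n : Form N Λ 2 ℤ) :
    fieldStrength (-A) (-n) = -fieldStrength A n := by
  rw [fieldStrength, fieldStrength, realForm_neg, ← latDₗ_apply, map_neg, latDₗ_apply, smul_neg,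
    neg_add]

theorem charge_neg (o : CupOrder) (A : Form N Λ 1 ℝ) (n : Form N Λ 2 ℤ) :
    charge o (-A) (-n) = charge o A n := by
  simp only [charge, fieldStrength_neg, realForm_neg, ← latDₗ_apply, ← cupₗ_apply,
    ← cupOneₗ_apply, map_neg, LinearMap.neg_apply, neg_neg]

theorem pontryagin_neg (n : Form N Λ 2 ℤ) : pontryagin (-n) = pontryagin n := by
  simp only [pontryagin, ← latDₗ_apply, ← cupₗ_apply, ← cupOneₗ_apply, map_neg,
    LinearMap.neg_apply, neg_neg]

theorem phaseWeight_loopPhase_neg (o : CupOrder) (β θ : ℝ) (p qe qm : ℤ) (t : Form N Λ 1 ℝ)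
    (A : Form N Λ 1 ℝ) (Am : Form N Λ 3 ℝ) (n : Form N Λ 2 ℤ) :
    phaseWeight β (loopPhase o θ p qe qm t (-Am)) (-A) (-n) =
      phaseWeight β (loopPhase o θ p (-qe) (-qm) t Am) A n := by
  rw [phaseWeight, phaseWeight, loopPhase, loopPhase, fieldStrength_neg, charge_neg,
    pontryagin_neg]
  simp only [← latDₗ_apply, ← starFormₗ_apply, ← dotFormₗ_apply, realForm_neg, map_neg,
    LinearMap.neg_apply, neg_neg, Int.cast_neg, neg_mul, mul_neg]

theorem dyonicEV_neg (β θ : ℝ) (p qe qm : ℤ) (γ : Contour N Λ) :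
    dyonicEV β θ p qe qm γ = dyonicEV β θ p (-qe) (-qm) γ := by
  have hweight : (fun A Am n => dyonicWeight β θ p qe qm γ (-A) (-Am) (-n)) =
      dyonicWeight β θ p (-qe) (-qm) γ := by
    funext A Am n
    simp only [dyonicWeight_eq_phaseWeight, phaseWeight_loopPhase_neg]
  rw [dyonicEV, dyonicEV, ← pathIntegral_neg, hweight]

end ChargeConjugation

section Duality

variable {N : ℕ} [NeZero N] {Λ : LatticeKind}

theorem dotForm_closedPart_starForm_add (ℓ : Form N Λ 2 ℤ) :
    dotForm (closedPart ℓ) (starForm .forward (realForm ℓ)) +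
        dotForm (closedPart ℓ) (starForm .reversed (realForm ℓ)) =
      (latSum (cup ℓ ℓ) : ℤ) + wedge (flux (realForm ℓ)) (flux (realForm ℓ)) := by
  have hclosed : dotForm (closedPart ℓ) (starForm .reversed (closedPart ℓ)) =
      wedge (flux (realForm ℓ)) (flux (realForm ℓ)) := by
    have hd : latD (closedPart ℓ) = 0 := latD_sub_projBdry _
    rw [dotForm_starForm_of_latD_eq_zero .reversed hd hd, flux_closedPart]
  have hcup : ((latSum (cup ℓ ℓ) : ℤ) : ℝ) =
      dotForm (realForm ℓ) (starForm .forward (realForm ℓ)) := by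
    rw [latSum_cup_two, dotForm_starForm_realForm]
  have hprojBdry : dotForm (projBdry (realForm ℓ)) (starForm .forward (realForm ℓ)) =
      dotForm (closedPart ℓ) (starForm .reversed (projBdry (realForm ℓ))) := by
    rw [dotForm_starForm_comm rfl, CupOrder.swap, closedPart, ← dotFormₗ_apply (_ - _), map_sub,
      LinearMap.sub_apply, dotFormₗ_apply, dotFormₗ_apply, dotForm_projBdry_starForm_projBdry,
      sub_zero]
  have hsplit : realForm ℓ = closedPart ℓ + projBdry (realForm ℓ) := by
    rw [closedPart, sub_add_cancel]
  have hforward : dotForm (realForm ℓ) (starForm .forward (realForm ℓ)) =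
      dotForm (closedPart ℓ) (starForm .forward (realForm ℓ)) +
        dotForm (projBdry (realForm ℓ)) (starForm .forward (realForm ℓ)) := by
    simp only [← dotFormₗ_apply, ← LinearMap.add_apply, ← map_add, ← hsplit]
  have hreversed : dotForm (closedPart ℓ) (starForm .reversed (realForm ℓ)) =
      dotForm (closedPart ℓ) (starForm .reversed (closedPart ℓ)) +
        dotForm (closedPart ℓ) (starForm .reversed (projBdry (realForm ℓ))) := by
    simp only [← dotFormₗ_apply, ← starFormₗ_apply, ← map_add, ← hsplit]
  rw [hcup, hforward, hreversed, hclosed, hprojBdry]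
  ring

theorem coupling_identity {β : ℝ} (hβ : 0 < β) (θ a b : ℝ) :
    (a + θ * b / (2 * Real.pi)) ^ 2 / (2 * β) + 2 * Real.pi ^ 2 * β * b ^ 2 =
      (b + thetaDual β θ * -a / (2 * Real.pi)) ^ 2 / (2 * betaDual β θ) +
        2 * Real.pi ^ 2 * betaDual β θ * a ^ 2 := by
  have hpi := Real.pi_ne_zero
  have hnorm : 4 * Real.pi ^ 2 * couplingNorm β θ = (4 * Real.pi ^ 2 * β) ^ 2 + θ ^ 2 := by
    rw [couplingNorm]
    field_simp
    ring
  have hpos := (couplingNorm_pos hβ θ).ne'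
  rw [thetaDual_eq, betaDual_eq]
  generalize couplingNorm β θ = D at *
  field_simp
  linear_combination (a ^ 2 - b ^ 2 * D) * hnorm

/-- The phase that relates the expectation value of a dyonic loop with charges `qe` and `qm` to that
of the dual loop, for the surface `ℓ`. -/
def dualityPhase (β θ : ℝ) (p qe qm : ℤ) (ℓ : Form N Λ 2 ℤ) : ℂ :=
  Complex.exp (
    - Complex.I * θ * uNumber ℓ * (1 / 2) * (qm : ℂ) ^ 2
    - Complex.I * thetaDual β θ * uNumber ℓ * (1 / 2) * (qe : ℂ) ^ 2
    - Complex.I * p * Real.pi * (pontryagin ℓ : ℤ) * ((qm : ℂ) ^ 2 + (qe : ℂ) ^ 2))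

theorem surfaceWeight_translate (Λ' : LatticeKind) (v : Fin 4 → ZMod N) (o : CupOrder) (β θ : ℝ)
    (p qe q : ℤ) (ℓ : Form N Λ 2 ℤ) : surfaceWeight o β θ p qe q (translate Λ' v ℓ) =
      surfaceWeight o β θ p qe q ℓ := by
  have hclosed : closedPart (translate Λ' v ℓ) = translate Λ' v (closedPart ℓ) := by
    rw [closedPart, realForm_translate, projBdry_translate]
    rfl
  simp only [surfaceWeight, surfaceFactor, hclosed, realForm_translate, projBdry_translate,
    starForm_translate, dotForm_translate, uNumber_translate, pontryagin_translate]

theorem surfaceWeight_dual {β : ℝ} (hβ : 0 < β) (θ : ℝ) (p qe qm : ℤ) (ℓ : Form N Λ 2 ℤ) :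
    surfaceWeight .forward β θ p qe qm ℓ *
        Complex.exp (-(Complex.I * (2 * Real.pi * qe * qm *
          wedge (flux (realForm ℓ)) (flux (realForm ℓ)) : ℝ))) =
      surfaceWeight .reversed (betaDual β θ) (thetaDual β θ) p qm (-qe) ℓ *
        dualityPhase β θ p qe qm ℓ := by
  have hcoupling : (((qe : ℝ) + θ * qm / (2 * Real.pi)) ^ 2 / (2 * β) +
      2 * Real.pi ^ 2 * β * qm ^ 2 : ℂ) =
        (qm + thetaDual β θ * -qe / (2 * Real.pi)) ^ 2 / (2 * betaDual β θ) +
          2 * Real.pi ^ 2 * betaDual β θ * qe ^ 2 := by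
    exact_mod_cast coupling_identity hβ θ qe qm
  have hclosed := congrArg Complex.ofReal (dotForm_closedPart_starForm_add ℓ)
  simp only [surfaceWeight, surfaceFactor, dualityPhase, ← Complex.exp_add]
  rw [← exp_sub_int_mul_two_pi (_ + _ + _)
    (qe * qm * latSum (cup ℓ ℓ) + p * qe ^ 2 * pontryagin ℓ)]
  congr 1
  simp only [CupOrder.sign]
  push_cast at hcoupling hclosed ⊢
  linear_combination
    -((dotForm (projBdry (realForm ℓ)) (projBdry (realForm ℓ)) : ℝ) : ℂ) * hcoupling +
      2 * Complex.I * Real.pi * qe * qm * hclosed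

theorem dyonicEV_eq_dualDyonicEV_mul_dualityPhase {β : ℝ} (hβ : 0 < β) (θ : ℝ) (p qe qm : ℤ)
    {γ : Contour N .primal} {ℓ : Form N .primal 2 ℤ} (hℓ : IsSurfaceForm γ ℓ) :
    dyonicEV β θ p qe qm γ =
      dualDyonicEV (betaDual β θ) (thetaDual β θ) p qm (-qe) γ.toDual *
        dualityPhase β θ p qe qm ℓ := by
  have hflux : flux (realForm (dualSurface ℓ)) = flux (realForm ℓ) := by
    rw [dualSurface, realForm_translate, flux_translate]
  have hsurface : surfaceWeight .reversed (betaDual β θ) (thetaDual β θ) p qm (-qe)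
      (dualSurface ℓ) = surfaceWeight .reversed (betaDual β θ) (thetaDual β θ) p qm (-qe) ℓ :=
    surfaceWeight_translate ..
  have hdual := surfaceWeight_dual hβ θ p qe qm ℓ
  have hsum := fluxSum_zero_zero_ne_zero hβ θ 0
  have hvacuum : fluxSum β θ 0 0 0 =
      pairConst β θ ^ 3 * fluxSum (betaDual β θ) (thetaDual β θ) 0 0 0 := by
    simpa using fluxSum_dual hβ θ 0 0 0
  rw [hvacuum] at hsum
  rw [dyonicEV, dualDyonicEV, dyonicWeight_eq_magneticWeight hℓ.tangent_eq_neg_latBdry,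
    dualDyonicWeight_eq_magneticWeight hℓ.toDual_tangent_eq_neg_latBdry,
    pathIntegral_surfacePhase_div_partitionFunction hβ,
    pathIntegral_surfacePhase_div_partitionFunction (betaDual_pos hβ θ), hsurface, hflux,
    fluxSum_dual hβ θ qe qm, hvacuum, Int.cast_neg]
  rw [div_mul_eq_mul_div, div_eq_div_iff hsum (right_ne_zero_of_mul hsum)]
  linear_combination pairConst β θ ^ 3 * fluxSum (betaDual β θ) (thetaDual β θ) 0 0 0 *
    fluxSum (betaDual β θ) (thetaDual β θ) qm (-qe) (flux (realForm ℓ)) * hdual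

end Duality

end LatticeMaxwell

end

theorem mainTheorem4 (N : ℕ) [NeZero N] (β θ : ℝ) (hβ : 0 < β) (p qe qm : ℤ)
    (γ : Contour N .primal) :
    EVDefined β θ (dyonicWeight β θ p qe qm γ) ∧
    EVDefined (betaDual β θ) (thetaDual β θ)
      (dualDyonicWeight (betaDual β θ) (thetaDual β θ) p qm (-qe) γ.toDual) ∧
    (∀ l : Form N .primal 2 ℤ, IsSurfaceForm γ l →
      dyonicEV β θ p qe qm γ =
        dualDyonicEV (betaDual β θ) (thetaDual β θ) p qm (-qe) γ.toDual *
          Complex.exp (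
            - Complex.I * θ * uNumber l * (1 / 2) * (qm : ℂ) ^ 2
            - Complex.I * thetaDual β θ * uNumber l * (1 / 2) * (qe : ℂ) ^ 2
            - Complex.I * p * Real.pi * (pontryagin l : ℤ) * ((qm : ℂ) ^ 2 + (qe : ℂ) ^ 2))) ∧
    dyonicEV β θ p qe qm γ = dyonicEV β θ p (-qe) (-qm) γ := by
  have hβ' := betaDual_pos hβ θ
  exact ⟨⟨pathIntegrable_dyonicWeight hβ θ p qe qm γ, pathIntegrable_partitionWeight hβ θ,
      partitionFunction_ne_zero hβ θ⟩,
    ⟨pathIntegrable_dualDyonicWeight hβ' _ p qm (-qe) γ.toDual,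
      pathIntegrable_partitionWeight hβ' _, partitionFunction_ne_zero hβ' _⟩,
    fun l hl => dyonicEV_eq_dualDyonicEV_mul_dualityPhase hβ θ p qe qm hl,
    dyonicEV_neg β θ p qe qm γ⟩
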